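/- Let $\mathbb F$ be a field of characteristic $0$ and let $\mathcal V$ be an algebra of differential functions over $\mathbb F$ in the variables $u_1,\dots,u_\ell$ which is a domain: $\mathcal V$ is a commutative differential algebra with derivation $\partial$, containing the differential polynomials $R_\ell=\mathbb F[u_i^{(n)}\mid 1\le i\le \ell,\ n\ge 0]$, $\partial u_i^{(n)}=u_i^{(n+1)}$, and endowed with commuting derivations $\frac{\partial}{\partial u_i^{(n)}}$ extending the partial derivatives of $R_\ell$, such that for every $f\in\mathcal V$ only finitely many $\frac{\partial f}{\partial u_i^{(n)}}$ are nonzero, and $\big[\frac{\partial}{\partial u_i^{(n)}},\partial\big]=\frac{\partial}{\partial u_i^{(n-1)}}$ (which is $0$ for $n=0$). A matrix $H=(H_{ij}(\partial))\in\mathrm{Mat}_{\ell\times\ell}\mathcal V((\partial^{-1}))$ of pseudodifferential operators is called *rational* if each entry is of the form $P(\partial)Q(\partial)^{-1}$ with $P,Q\in\mathcal V[\partial]$, $Q\neq 0$ (the inverse being taken over the field of fractions of $\mathcal V$). With $H$ one associates the $\lambda$-bracket $$\{f_\lambda g\}_H=\sum_{i,j=1}^{\ell}\sum_{r,n\ge0}\frac{\partial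 g}{\partial u_j^{(n)}}(\lambda+\partial)^nH_{ji}(\lambda+\partial)(-\lambda-\partial)^r\frac{\partial f}{\partial u_i^{(r)}}\in\mathcal V((\lambda^{-1})).$$ $H$ is a *(non-local) Poisson structure* on $\mathcal V$ if it is rational, skewadjoint ($H^*=-H$), and satisfies the Jacobi identity on generators, $$\{{u_i}_\lambda\{{u_j}_\mu u_k\}_H\}_H-\{{u_j}_\mu\{{u_i}_\lambda u_k\}_H\}_H-\{{\{{u_i}_\lambda u_j\}_H}_{\lambda+\mu}u_k\}_H=0\qquad(1\le i,j,k\le\ell),$$ in the space $\mathcal V_{\lambda,\mu}=\mathcal V[[\lambda^{-1},\mu^{-1},(\lambda+\mu)^{-1}]][\lambda,\mu]$, where $\mathcal V_{\lambda,\mu}$ is identified with its images in $\mathcal V((\lambda^{-1}))((\mu^{-1}))$, $\mathcal V((\mu^{-1}))((\lambda^{-1}))$ and $\mathcal V(((\lambda+\mu)^{-1}))((\lambda^{-1}))$, to which the three terms respectively belong. For $\theta\in\mathcal V^m$ let $D_\theta(\partial)=\big(\sum_{n}\frac{\partial\theta_\alpha}{\partial u_i^{(n)}}\partial^n\big)_{\alpha,i}$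 be its Frechet derivative. Let $H$ be a Poisson structure on $\mathcal V$, let $0\le m\le\ell$, and let $$\theta_\alpha=u_{\ell-m+\alpha}+p_\alpha,\qquad p_\alpha\in\mathcal V,\qquad \frac{\partial p_\alpha}{\partial u_{\ell-m+\beta}^{(n)}}=0\quad(1\le \alpha,\beta\le m,\ n\ge0).$$ Let $\mathcal I\subset\mathcal V$ be the differential ideal generated by $\theta_1,\dots,\theta_m$. Assume that $C(\partial)=D_\theta(\partial)\circ H(\partial)\circ D_\theta^*(\partial)$ is invertible in $\mathrm{Mat}_{m\times m}\mathcal V((\partial^{-1}))$. Write $H=\begin{pmatrix}A&B\\-B^*&D\end{pmatrix}$ with $A$ of size $(\ell-m)\times(\ell-m)$, and let $D_p(\partial)=\big(\sum_n\frac{\partial p_\alpha}{\partial u_i^{(n)}}\partial^n\big)_{1\le\alpha\le m,\ 1\le i\le\ell-m}$. (a) The Dirac modification $$\widetilde H^D=H-H\circ D_\theta^*\circ C^{-1}\circ D_\theta\circ H$$ is a Poisson structure on $\mathcal V$. (b) The differential algebra $\mathcal V$ with the variables $u_1,\dots,u_{\ell-m}$ and the modified partial derivatives $$\frac{\widetilde\partial}{\widetilde\partial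 u_i^{(s)}}=\frac{\partial}{\partial u_i^{(s)}}-\sum_{\alpha=1}^m\sum_{n\ge0}\frac{\partial(\partial^np_\alpha)}{\partial u_i^{(s)}}\frac{\partial}{\partial u_{\ell-m+\alpha}^{(n)}},\qquad 1\le i\le\ell-m,\ s\ge0,$$ is an algebra of differential functions, denoted $\widetilde{\mathcal V}$. The matrix $$A^D=A+(B+A\circ D_p^*)\circ C^{-1}\circ(B^*-D_p\circ A)\in\mathrm{Mat}_{(\ell-m)\times(\ell-m)}\mathcal V((\partial^{-1}))$$ is a Poisson structure on $\widetilde{\mathcal V}$, and it is induced by $\widetilde H^D$: $\{f_\lambda g\}^{\mathcal V}_{\widetilde H^D}=\{f_\lambda g\}^{\widetilde{\mathcal V}}_{A^D}$ for all $f,g\in\mathcal V$. (c) Assume that $\mathcal I\cap R_{\ell-m}=0$, that $\mathcal V/\mathcal I$ is a domain, and that the matrix $\overline{A^D}(\partial)\in\mathrm{Mat}_{(\ell-m)\times(\ell-m)}(\mathcal V/\mathcal I)((\partial^{-1}))$, obtained by reducing all coefficients of $A^D$ modulo $\mathcal I$, is rational. Then $\mathcal V/\mathcal I$ is an algebra of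 differential functions in $u_1,\dots,u_{\ell-m}$ with the partial derivatives induced by $\frac{\widetilde\partial}{\widetilde\partial u_i^{(s)}}$, and $H^D=\overline{A^D}$ is a Poisson structure on it, induced by $A^D$: $\{\bar f_\lambda\bar g\}_{H^D}=\overline{\{f_\lambda g\}^{\widetilde{\mathcal V}}_{A^D}}$ for all $f,g\in\mathcal V$. -/

import Mathlib

noncomputable section

namespace DiracReduction

section PseudoDifferential

variable {F V : Type*} [Field F] [CommRing V] [Algebra F V]

/-- Families `(a n)` indexed by `ℤ` which vanish for all large `n`: the coefficient families of
formal Laurent series in `λ⁻¹`. -/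
def laurentCoeffs (V : Type*) [CommRing V] : AddSubgroup (ℤ → V) where
  carrier := {a | ∃ N : ℤ, ∀ n, N < n → a n = 0}
  zero_mem' := ⟨0, fun _ _ => rfl⟩
  add_mem' := by
    rintro a b ⟨N, hN⟩ ⟨M, hM⟩
    refine ⟨max N M, fun n hn => ?_⟩
    simp [hN n (lt_of_le_of_lt (le_max_left _ _) hn),
      hM n (lt_of_le_of_lt (le_max_right _ _) hn)]
  neg_mem' := by
    rintro a ⟨N, hN⟩
    exact ⟨N, fun n hn => by simp [hN n hn]⟩

/-- The space `V((∂⁻¹))` of pseudodifferential operators `∑_{n ≤ N} aₙ ∂ⁿ` over the differential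
algebra `(V, D)`.  An operator is identified with its symbol `∑ aₙ λⁿ`, so the same type also
serves as `V((λ⁻¹))`. -/
def PDO (_D : Derivation F V V) : Type _ := laurentCoeffs V

namespace PDO

variable {D : Derivation F V V}

instance : AddCommGroup (PDO D) := inferInstanceAs (AddCommGroup (laurentCoeffs V))

/-- The coefficient of `∂ⁿ` (equivalently, of `λⁿ` in the symbol). -/
def coeff (a : PDO D) (n : ℤ) : V := a.1 n

/-- The identity operator. -/
instance : One (PDO D) :=
  ⟨⟨fun n => if n = 0 then 1 else 0, 0, fun _ hn => if_neg hn.ne'⟩⟩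

/-- Composition of pseudodifferential operators, determined by
`∂ⁱ ∘ b = ∑_{k ≥ 0} (i choose k) b⁽ᵏ⁾ ∂^{i-k}` for every integer `i`. The coefficient of `∂ⁿ` in
`a ∘ b` is the finite sum of `(i choose k) aᵢ bⱼ⁽ᵏ⁾` over `i + j - k = n`, `k ≥ 0`; here
`q = (i, k)`. -/
instance : Mul (PDO D) :=
  ⟨fun a b =>
    ⟨fun n => ∑ᶠ q : ℤ × ℕ,
        Ring.choose q.1 q.2 • (a.coeff q.1 * D^[q.2] (b.coeff (n + q.2 - q.1))), by
      obtain ⟨N, hN⟩ := a.2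
      obtain ⟨M, hM⟩ := b.2
      refine ⟨N + M, fun n hn => ?_⟩
      refine (finsum_congr fun q => ?_).trans finsum_zero
      by_cases h : N < q.1
      · have : a.coeff q.1 = 0 := hN _ h
        rw [this, zero_mul, smul_zero]
      · have : b.coeff (n + q.2 - q.1) = 0 := hM _ (by push Not at h; omega)
        rw [this, Function.iterate_fixed (map_zero D), mul_zero, smul_zero]⟩⟩

/-- The formal adjoint `(∑ aₙ ∂ⁿ)* = ∑ (-∂)ⁿ ∘ aₙ`; the coefficient of `∂ʲ` is
`∑_{k ≥ 0} (-1)^{j+k} (j+k choose k) a_{j+k}⁽ᵏ⁾`. -/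
def adjoint (a : PDO D) : PDO D :=
  ⟨fun j => ∑ᶠ k : ℕ,
      (((-1 : ℤˣ) ^ (j + k) : ℤˣ) : ℤ) • Ring.choose (j + k) k • D^[k] (a.coeff (j + k)), by
    obtain ⟨N, hN⟩ := a.2
    refine ⟨N, fun j hj => (finsum_congr fun k => ?_).trans finsum_zero⟩
    have : a.coeff (j + k) = 0 := hN _ (by omega)
    rw [this, Function.iterate_fixed (map_zero D), smul_zero, smul_zero]⟩

/-- `a` is a differential operator, i.e. it lies in `V[∂]`. -/
def IsDifferential (a : PDO D) : Prop := ∀ n : ℤ, n < 0 → a.coeff n = 0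

/-- `L` is a rational pseudodifferential operator with coefficients in the domain `V`:
`L = A ∘ B⁻¹` with `A, B ∈ V[∂]` and `B ≠ 0`.  The inverse of `B` is taken over the field of
fractions of `V`, where every nonzero `B` is invertible, and `L = A ∘ B⁻¹` reads `L ∘ B = A`. -/
def IsRational (L : PDO D) : Prop :=
  ∃ A B : PDO D, A.IsDifferential ∧ B.IsDifferential ∧ B ≠ 0 ∧ L * B = A

/-- Apply an additive map to all coefficients. -/
def mapCoeff {W : Type*} [CommRing W] [Algebra F W] {D' : Derivation F W W} (φ : V →+ W)
    (a : PDO D) : PDO D' :=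
  ⟨fun n => φ (a.coeff n), by
    obtain ⟨N, hN⟩ := a.2
    refine ⟨N, fun n hn => ?_⟩
    have : a.coeff n = 0 := hN n hn
    exact (congrArg φ this).trans (map_zero φ)⟩

end PDO

/-- The formal adjoint of a matrix pseudodifferential operator. -/
def adjointMatrix {D : Derivation F V V} {r s : ℕ} (M : Matrix (Fin r) (Fin s) (PDO D)) :
    Matrix (Fin s) (Fin r) (PDO D) :=
  M.transpose.map PDO.adjoint

end PseudoDifferential

section DoubleSeries

variable {V : Type*} [CommRing V]

/-! The space `V_{λ,μ} = V[[λ⁻¹,μ⁻¹,(λ+μ)⁻¹]][λ,μ]` is the quotient of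
`V[[λ⁻¹,μ⁻¹,ν⁻¹]][λ,μ,ν]` by the submodule `(ν-λ-μ) V[[λ⁻¹,μ⁻¹,ν⁻¹]][λ,μ,ν]`. We work with
representatives: `X i j k` is the coefficient of `λⁱ μʲ νᵏ`. -/

/-- `X` belongs to `V[[λ⁻¹,μ⁻¹,ν⁻¹]][λ,μ,ν]`. -/
def IsTripleSeries (X : ℤ → ℤ → ℤ → V) : Prop :=
  ∃ N : ℤ, ∀ i j k, (N < i ∨ N < j ∨ N < k) → X i j k = 0

/-- `X` belongs to `(ν-λ-μ) V[[λ⁻¹,μ⁻¹,ν⁻¹]][λ,μ,ν]`, i.e. it vanishes in `V_{λ,μ}`. -/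
def VanishesModRelation (X : ℤ → ℤ → ℤ → V) : Prop :=
  ∃ W : ℤ → ℤ → ℤ → V, IsTripleSeries W ∧
    ∀ i j k, X i j k = W i j (k - 1) - W (i - 1) j k - W i (j - 1) k

/-- The embedding `ι_{μ,λ} : V_{λ,μ} → V((λ⁻¹))((μ⁻¹))`, which substitutes
`νᵏ = ∑_{l ≥ 0} (k choose l) λˡ μ^{k-l}`: the coefficient of `λᵃ μᵇ`. Here `q = (l, k)`. -/
def expandMuLam (X : ℤ → ℤ → ℤ → V) (a b : ℤ) : V :=
  ∑ᶠ q : ℕ × ℤ, Ring.choose q.2 q.1 • X (a - q.1) (b - q.2 + q.1) q.2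

/-- The embedding `ι_{λ,μ} : V_{λ,μ} → V((μ⁻¹))((λ⁻¹))`, which substitutes
`νᵏ = ∑_{l ≥ 0} (k choose l) μˡ λ^{k-l}`: the coefficient of `λᵃ μᵇ`. Here `q = (l, k)`. -/
def expandLamMu (X : ℤ → ℤ → ℤ → V) (a b : ℤ) : V :=
  ∑ᶠ q : ℕ × ℤ, Ring.choose q.2 q.1 • X (a - q.2 + q.1) (b - q.1) q.2

/-- The embedding `ι_{λ,λ+μ} : V_{λ,μ} → V(((λ+μ)⁻¹))((λ⁻¹))`, which substitutes
`μʲ = (-λ+ν)ʲ = ∑_{l ≥ 0} (j choose l) (-λ)^{j-l} νˡ`: the coefficient of `λᵃ νᶜ`,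
`ν = λ+μ`. Here `q = (l, j)`. -/
def expandLamNu (X : ℤ → ℤ → ℤ → V) (a c : ℤ) : V :=
  ∑ᶠ q : ℕ × ℤ, (((-1 : ℤˣ) ^ (q.2 - q.1) : ℤˣ) : ℤ) • Ring.choose q.2 q.1 •
    X (a - q.2 + q.1) q.2 (c - q.1)

end DoubleSeries

section DifferentialFunctions

variable {F V : Type*} [Field F] [CommRing V] [Algebra F V]

/-- The structure of an algebra of differential functions in the variables `u₁, …, u_ℓ` on the
differential algebra `(V, D)`: the elements `uᵢ⁽ⁿ⁾ = Dⁿ uᵢ` generate a copy of the algebra of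
differential polynomials `R_ℓ`, and `pd i n` is the derivation `∂/∂uᵢ⁽ⁿ⁾`. -/
structure DiffFunctions (D : Derivation F V V) (ℓ : ℕ) where
  u : Fin ℓ → V
  pd : Fin ℓ → ℕ → Derivation F V V
  algebraicIndependent :
    AlgebraicIndependent F (fun q : Fin ℓ × ℕ => D^[q.2] (u q.1))
  pd_u : ∀ i n j r, pd i n (D^[r] (u j)) = if i = j ∧ n = r then 1 else 0
  pd_comm : ∀ i n j r f, pd i n (pd j r f) = pd j r (pd i n f)
  pd_finite : ∀ f, {q : Fin ℓ × ℕ | pd q.1 q.2 f ≠ 0}.Finite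
  pd_D_zero : ∀ i f, pd i 0 (D f) - D (pd i 0 f) = 0
  pd_D_succ : ∀ i n f, pd i (n + 1) (D f) - D (pd i (n + 1) f) = pd i n f

namespace DiffFunctions

variable {D : Derivation F V V} {ℓ : ℕ} (𝒱 : DiffFunctions D ℓ)

/-- The entry `∑_{n ≥ 0} (∂f/∂uᵢ⁽ⁿ⁾) ∂ⁿ` of the Frechet derivative of `f`. -/
def frechet (f : V) (i : Fin ℓ) : PDO D :=
  ⟨fun n => if 0 ≤ n then 𝒱.pd i n.toNat f else 0, by
    have hinj : Set.InjOn (fun n : ℕ => (i, n)) ((fun n : ℕ => (i, n)) ⁻¹'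
        {q : Fin ℓ × ℕ | 𝒱.pd q.1 q.2 f ≠ 0}) := fun a _ b _ h => (Prod.ext_iff.1 h).2
    obtain ⟨N, hN⟩ := ((𝒱.pd_finite f).preimage hinj).bddAbove
    refine ⟨N, fun n hn => ?_⟩
    by_contra h
    have h0 : 0 ≤ n := by omega
    have : n.toNat ≤ N := hN (show 𝒱.pd i n.toNat f ≠ 0 by simpa [h0] using h)
    omega⟩

/-- The Frechet derivative `D_θ(∂)` of `θ = (θ_1, …, θ_m)`, an `m × ℓ` matrix. -/
def frechetMatrix {m : ℕ} (θ : Fin m → V) : Matrix (Fin m) (Fin ℓ) (PDO D) :=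
  Matrix.of fun α i => 𝒱.frechet (θ α) i

/-- The Master Formula
`{f_λ g}_H = ∑_{i,j,m,n} (∂g/∂u_j⁽ⁿ⁾) (λ+∂)ⁿ H_{ji}(λ+∂) (-λ-∂)ᵐ (∂f/∂u_i⁽ᵐ⁾)`.
This is the symbol of the operator `∑_{i,j} D_g(∂)_j ∘ H_{ji}(∂) ∘ D_f^*(∂)_i`, where
`D_g(∂)_j = ∑_n (∂g/∂u_j⁽ⁿ⁾) ∂ⁿ` and `D_f^*(∂)_i = ∑_m (-∂)ᵐ ∘ (∂f/∂u_i⁽ᵐ⁾)`. -/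
def bracket (H : Matrix (Fin ℓ) (Fin ℓ) (PDO D)) (f g : V) : PDO D :=
  ∑ i, ∑ j, 𝒱.frechet g j * H j i * (𝒱.frechet f i).adjoint

/-- The Jacobi identity
`{a_λ {b_μ c}} - {b_μ {a_λ c}} - {{a_λ b}_{λ+μ} c} = 0` in the space `V_{λ,μ}`:
the three terms lie in the images of `V_{λ,μ}` under `ι_{μ,λ}`, `ι_{λ,μ}`, `ι_{λ,λ+μ}`,
and the elements `X, Y, Z` of `V_{λ,μ}` they come from satisfy `X - Y - Z = 0`. -/
def Jacobi (H : Matrix (Fin ℓ) (Fin ℓ) (PDO D)) (a b c : V) : Prop :=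
  ∃ X Y Z : ℤ → ℤ → ℤ → V, IsTripleSeries X ∧ IsTripleSeries Y ∧ IsTripleSeries Z ∧
    (∀ r s, expandMuLam X r s = (𝒱.bracket H a ((𝒱.bracket H b c).coeff s)).coeff r) ∧
    (∀ r s, expandLamMu Y r s = (𝒱.bracket H b ((𝒱.bracket H a c).coeff r)).coeff s) ∧
    (∀ r t, expandLamNu Z r t = (𝒱.bracket H ((𝒱.bracket H a b).coeff r) c).coeff t) ∧
    VanishesModRelation (fun i j k => X i j k - Y i j k - Z i j k)

/-- A (non-local) Poisson structure: a skewadjoint rational matrix pseudodifferential operator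
whose `λ`-bracket satisfies the Jacobi identity on the generators `u_i`. -/
structure IsPoisson (H : Matrix (Fin ℓ) (Fin ℓ) (PDO D)) : Prop where
  skewadjoint : adjointMatrix H = -H
  rational : ∀ i j, (H i j).IsRational
  jacobi : ∀ i j k, 𝒱.Jacobi H (𝒱.u i) (𝒱.u j) (𝒱.u k)

/-- The operator `C(∂) = D_θ(∂) ∘ H(∂) ∘ D_θ^*(∂)`. -/
def constraintMatrix {m : ℕ} (H : Matrix (Fin ℓ) (Fin ℓ) (PDO D)) (θ : Fin m → V) :
    Matrix (Fin m) (Fin m) (PDO D) :=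
  𝒱.frechetMatrix θ * H * adjointMatrix (𝒱.frechetMatrix θ)

/-- The Dirac modification `H - H ∘ D_θ^* ∘ C⁻¹ ∘ D_θ ∘ H`, where `Cinv` is the inverse of
`C`. -/
def diracModification {m : ℕ} (H : Matrix (Fin ℓ) (Fin ℓ) (PDO D)) (θ : Fin m → V)
    (Cinv : Matrix (Fin m) (Fin m) (PDO D)) : Matrix (Fin ℓ) (Fin ℓ) (PDO D) :=
  H - H * adjointMatrix (𝒱.frechetMatrix θ) * Cinv * 𝒱.frechetMatrix θ * H

end DiffFunctions

/-! From now on there are `ℓ = k + m` variables: `u (Fin.castAdd m i)` are the first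
`k = ℓ - m` ones, and `u (Fin.natAdd k α)` is `u_{ℓ-m+α}`. -/

namespace DiffFunctions

variable {D : Derivation F V V} {k m : ℕ} (𝒱 : DiffFunctions D (k + m))

/-- The `m × (ℓ-m)` matrix `D_p(∂)`. -/
def reducedFrechet (p : Fin m → V) : Matrix (Fin m) (Fin k) (PDO D) :=
  (𝒱.frechetMatrix p).submatrix id (Fin.castAdd m)

/-- The matrix `A^D = A + (B + A ∘ D_p^*) ∘ C⁻¹ ∘ (B^* - D_p ∘ A)`, where `A` and `B` are the
upper left `(ℓ-m) × (ℓ-m)` and the upper right `(ℓ-m) × m` block of `H`, and `Cinv` is the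
inverse of `C`. -/
def diracReduced (H : Matrix (Fin (k + m)) (Fin (k + m)) (PDO D)) (p : Fin m → V)
    (Cinv : Matrix (Fin m) (Fin m) (PDO D)) : Matrix (Fin k) (Fin k) (PDO D) :=
  let A := H.submatrix (Fin.castAdd m) (Fin.castAdd m)
  let B := H.submatrix (Fin.castAdd m) (Fin.natAdd k)
  A + (B + A * adjointMatrix (𝒱.reducedFrechet p)) * Cinv *
    (adjointMatrix B - 𝒱.reducedFrechet p * A)

/-- The modified partial derivative
`∂/∂uᵢ⁽ˢ⁾ - ∑_α ∑_n (∂(∂ⁿ p_α)/∂uᵢ⁽ˢ⁾) ∂/∂u_{ℓ-m+α}⁽ⁿ⁾`, for `i ≤ ℓ-m`. -/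
def modifiedPd (p : Fin m → V) (i : Fin k) (s : ℕ) (f : V) : V :=
  𝒱.pd (Fin.castAdd m i) s f -
    ∑ α, ∑ᶠ n : ℕ, 𝒱.pd (Fin.castAdd m i) s (D^[n] (p α)) * 𝒱.pd (Fin.natAdd k α) n f

/-- The algebra `R_{ℓ-m}` of differential polynomials in the first `ℓ-m` variables, inside
`V`. -/
def reducedPolynomials : Subalgebra F V :=
  Algebra.adjoin F (Set.range fun q : Fin k × ℕ => D^[q.2] (𝒱.u (Fin.castAdd m q.1)))

end DiffFunctions

/-- The differential ideal generated by `θ_1, …, θ_m`. -/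
def diffIdeal (D : Derivation F V V) {m : ℕ} (θ : Fin m → V) : Ideal V :=
  Ideal.span (Set.range fun q : Fin m × ℕ => D^[q.2] (θ q.1))

theorem map_mem_diffIdeal (D : Derivation F V V) {m : ℕ} (θ : Fin m → V) {x : V}
    (hx : x ∈ diffIdeal D θ) : D x ∈ diffIdeal D θ := by
  unfold diffIdeal at hx ⊢
  induction hx using Submodule.span_induction with
  | mem x hx =>
    obtain ⟨q, rfl⟩ := hx
    exact Ideal.subset_span ⟨(q.1, q.2 + 1), Function.iterate_succ_apply' _ _ _⟩
  | zero => simp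
  | add x y _ _ hx hy => rw [map_add]; exact add_mem hx hy
  | smul a x hmem hx =>
    rw [smul_eq_mul, D.leibniz, smul_eq_mul, smul_eq_mul]
    exact add_mem (Ideal.mul_mem_left _ _ hx) (Ideal.mul_mem_right _ _ hmem)

/-- The derivation induced by `D` on the quotient `V ⧸ I` by the differential ideal `I` generated
by `θ_1, …, θ_m`. -/
def quotDerivation (D : Derivation F V V) {m : ℕ} (θ : Fin m → V) :
    Derivation F (V ⧸ diffIdeal D θ) (V ⧸ diffIdeal D θ) :=
  Derivation.mk'
    (Submodule.mapQ ((diffIdeal D θ).restrictScalars F) ((diffIdeal D θ).restrictScalars F)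
      (D : V →ₗ[F] V) (fun _ hx => map_mem_diffIdeal D θ hx) :
        (V ⧸ diffIdeal D θ) →ₗ[F] (V ⧸ diffIdeal D θ))
    (by
      intro a b
      obtain ⟨a, rfl⟩ := Ideal.Quotient.mk_surjective a
      obtain ⟨b, rfl⟩ := Ideal.Quotient.mk_surjective b
      exact congrArg (Ideal.Quotient.mk (diffIdeal D θ)) (D.leibniz a b))

end DifferentialFunctions

end DiracReduction

end

noncomputable section

namespace DiracReduction

/-! ### The ring of pseudodifferential operators. -/

namespace PDO

variable {F V : Type*} [Field F] [CommRing V] [Algebra F V] {D : Derivation F V V}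

/-! Write N = D_θ, S = N*, C = N H S, c = C⁻¹ and G = H − H S c N H. Since H and c are skewadjoint,
so is G. Its entries are rational because rational operators form a ring closed under adjoints, and
the inverse of an invertible matrix of rational operators is again rational
(`IsRational.of_mul_eq_one`); both facts come from an Ore condition proved by counting unknowns. The
real content of (a) is the Jacobi identity for G.

To handle it, apply the formal adjoint in the variable ν. This turns the relation ν = λ + μ defining
V_{λ,μ} into the symmetric relation ∂ + λ₁ + λ₂ + λ₃ = 0, so a double bracket becomes a trilinear
operator modulo total derivatives (`TriOp`), on which operators act by right composition in each of
the three slots. The derivative ∂/∂u_h of symbols is then a derivation from the ring of operators to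
a bimodule (`variation_mul`), and taking adjoints exchanges two slots (`variation_adjoint`). For a
skewadjoint H all three terms of the Jacobi identity are instances of one trilinear operator with
permuted indices (`jacobi_iff`).

Differentiating G as in any noncommutative ring (`derivation_diracModification`) gives a term (1 − H
S c N) dH (1 − S c N H) and two terms in dS and dN. As G = H A with A = 1 − S c N H, and 1 − H S c N
= A*, the first term is the double bracket of H with A applied in all three slots; a witness of
Jacobi for H is transported along A. The other two are second Frechet derivatives of θ; these are
symmetric because partial derivatives commute, and the six of them cancel in the Jacobi sum
(`jacobi_diracModification`). Classes in `TriOp` allow larger families than V_{λ,μ} does, so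
explicit representatives are kept throughout.

For (b), N G = 0 and G S = 0 express the last m rows and columns of G through the first ones;
substituting them into the Master Formula turns D_f into the Frechet derivative with respect to the
modified partial derivatives (`bracket_diracModification`). The matrix A^D is the upper left block
of G (`diracReduced_eq_submatrix`), so it inherits everything from G. For (c), the modified partial
derivatives annihilate every θ_α, hence preserve the ideal, and brackets and Jacobi witnesses reduce
coefficientwise (`Jacobi.map`). -/

@[ext] theorem ext {a b : PDO D} (h : ∀ n, a.coeff n = b.coeff n) : a = b :=
  Subtype.ext (funext h)

@[simp] theorem coeff_zero (n : ℤ) : (0 : PDO D).coeff n = 0 := rfl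
@[simp] theorem coeff_add (a b : PDO D) (n : ℤ) : (a + b).coeff n = a.coeff n + b.coeff n := rfl
@[simp] theorem coeff_neg (a : PDO D) (n : ℤ) : (-a).coeff n = -a.coeff n := rfl
@[simp] theorem coeff_sub (a b : PDO D) (n : ℤ) : (a - b).coeff n = a.coeff n - b.coeff n := rfl
theorem coeff_one (n : ℤ) : (1 : PDO D).coeff n = if n = 0 then 1 else 0 := rfl

/-- Taking the coefficient of `∂ⁿ`, as an additive map. -/
def coeffHom (n : ℤ) : PDO D →+ V where
  toFun a := a.coeff n
  map_zero' := rfl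
  map_add' _ _ := rfl

@[simp] theorem coeff_sum {ι : Type*} (s : Finset ι) (f : ι → PDO D) (n : ℤ) :
    (∑ i ∈ s, f i).coeff n = ∑ i ∈ s, (f i).coeff n :=
  map_sum (coeffHom n) f s

@[simp] theorem coeff_zsmul (z : ℤ) (a : PDO D) (n : ℤ) : (z • a).coeff n = z • a.coeff n :=
  map_zsmul (coeffHom n) z a

/-- `a` has order at most `N`. -/
def OrdLE (a : PDO D) (N : ℤ) : Prop := ∀ n, N < n → a.coeff n = 0

theorem exists_ordLE (a : PDO D) : ∃ N, a.OrdLE N := a.2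

theorem OrdLE.mono {a : PDO D} {N M : ℤ} (h : a.OrdLE N) (hNM : N ≤ M) : a.OrdLE M :=
  fun n hn => h n (by omega)

theorem OrdLE.add {a b : PDO D} {N : ℤ} (ha : a.OrdLE N) (hb : b.OrdLE N) : (a + b).OrdLE N :=
  fun n hn => by simp [ha n hn, hb n hn]

theorem OrdLE.neg {a : PDO D} {N : ℤ} (ha : a.OrdLE N) : (-a).OrdLE N :=
  fun n hn => by simp [ha n hn]

/-- The operator `v ∂ⁿ`. -/
def single (n : ℤ) (v : V) : PDO D :=
  ⟨fun i => if i = n then v else 0, n, fun _ hi => if_neg hi.ne'⟩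

theorem coeff_single (n : ℤ) (v : V) (i : ℤ) :
    (single n v : PDO D).coeff i = if i = n then v else 0 := rfl

/-- The operator `∂ⁿ`. -/
def dpow (n : ℤ) : PDO D := single n 1

theorem coeff_dpow (n i : ℤ) : (dpow n : PDO D).coeff i = if i = n then 1 else 0 := rfl

theorem dpow_zero : (dpow 0 : PDO D) = 1 := rfl

theorem exists_sum_single (a : PDO D) (L : ℤ) :
    ∃ s : Finset ℤ, (a - ∑ n ∈ s, single n (a.coeff n)).OrdLE L := by
  obtain ⟨N, hN⟩ := a.exists_ordLE
  refine ⟨Finset.Icc L N, fun n hn => ?_⟩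
  simp only [coeff_sub, coeff_sum, coeff_single, Finset.sum_ite_eq, Finset.mem_Icc]
  split_ifs with h
  · simp
  · rw [hN n (by omega), sub_zero]

/-- An additive endomorphism which raises the order by a bounded amount. -/
def Filtered (φ : PDO D →+ PDO D) : Prop := ∃ d : ℤ, ∀ a N, OrdLE a N → OrdLE (φ a) (N + d)

/-- A density argument: every operator is a finite sum of monomials up to arbitrarily low order, and
filtered maps keep the error low. It reduces the ring and adjoint identities below to monomials. -/
theorem eq_of_single {φ ψ : PDO D →+ PDO D} (hφ : Filtered φ) (hψ : Filtered ψ)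
    (h : ∀ n v, φ (single n v) = ψ (single n v)) (a : PDO D) : φ a = ψ a := by
  obtain ⟨d, hd⟩ := hφ
  obtain ⟨e, he⟩ := hψ
  ext n
  -- The remainder must still have order at most `n - 1` after either map raises it by `d` or `e`.
  obtain ⟨s, hs⟩ := exists_sum_single a (n - 1 - max d e)
  have h1 := hd _ _ hs n (by omega)
  have h2 := he _ _ hs n (by omega)
  rw [map_sub, map_sum, coeff_sub, sub_eq_zero] at h1 h2
  rw [h1, h2]
  simp only [h]

theorem Filtered.comp {φ ψ : PDO D →+ PDO D} (hφ : Filtered φ) (hψ : Filtered ψ) :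
    Filtered (φ.comp ψ) := by
  obtain ⟨d, hd⟩ := hφ
  obtain ⟨e, he⟩ := hψ
  exact ⟨e + d, fun a N h => by have := hd _ _ (he _ _ h); rwa [add_assoc] at this⟩

theorem iterate_zero (p : ℕ) : D^[p] (0 : V) = 0 := Function.iterate_fixed (map_zero D) p

theorem mul_coeff (a b : PDO D) (n : ℤ) : (a * b).coeff n =
    ∑ᶠ q : ℤ × ℕ, Ring.choose q.1 q.2 • (a.coeff q.1 * D^[q.2] (b.coeff (n + q.2 - q.1))) := rfl

theorem mul_coeff_eq_sum {a b : PDO D} {N M : ℤ} (ha : a.OrdLE N) (hb : b.OrdLE M) (n : ℤ) :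
    (a * b).coeff n = ∑ q ∈ Finset.Icc (n - M) N ×ˢ Finset.range ((M + N - n).toNat + 1),
      Ring.choose q.1 q.2 • (a.coeff q.1 * D^[q.2] (b.coeff (n + q.2 - q.1))) := by
  rw [mul_coeff]
  refine finsum_eq_sum_of_support_subset _ fun q hq => ?_
  have h1 : q.1 ≤ N := by
    by_contra h
    exact hq (by simp only [ha q.1 (by omega), zero_mul, smul_zero])
  have h2 : n + q.2 - q.1 ≤ M := by
    by_contra h
    exact hq (by simp only [hb _ (not_le.1 h), iterate_zero, mul_zero, smul_zero])
  simp only [Finset.coe_product, Set.mem_prod, Finset.mem_coe, Finset.mem_Icc, Finset.mem_range]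
  omega

theorem OrdLE.mul {a b : PDO D} {N M : ℤ} (ha : a.OrdLE N) (hb : b.OrdLE M) :
    (a * b).OrdLE (N + M) := by
  intro n hn
  rw [mul_coeff_eq_sum ha hb, Finset.Icc_eq_empty (by omega)]
  simp

protected theorem add_mul (a b c : PDO D) : (a + b) * c = a * c + b * c := by
  obtain ⟨N, hN⟩ := a.exists_ordLE
  obtain ⟨N', hN'⟩ := b.exists_ordLE
  obtain ⟨M, hM⟩ := c.exists_ordLE
  have ha := hN.mono (le_max_left N N')
  have hb := hN'.mono (le_max_right N N')
  ext n
  rw [coeff_add, mul_coeff_eq_sum (ha.add hb) hM, mul_coeff_eq_sum ha hM,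
    mul_coeff_eq_sum hb hM, ← Finset.sum_add_distrib]
  exact Finset.sum_congr rfl fun q _ => by rw [coeff_add, add_mul, smul_add]

protected theorem mul_add (a b c : PDO D) : a * (b + c) = a * b + a * c := by
  obtain ⟨N, hN⟩ := b.exists_ordLE
  obtain ⟨N', hN'⟩ := c.exists_ordLE
  obtain ⟨M, hM⟩ := a.exists_ordLE
  have hb := hN.mono (le_max_left N N')
  have hc := hN'.mono (le_max_right N N')
  ext n
  rw [coeff_add, mul_coeff_eq_sum hM (hb.add hc), mul_coeff_eq_sum hM hb,
    mul_coeff_eq_sum hM hc, ← Finset.sum_add_distrib]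
  exact Finset.sum_congr rfl fun q _ => by
    rw [coeff_add, iterate_map_add, mul_add, smul_add]

/-- Right multiplication, as an additive map. -/
def mulRightHom (c : PDO D) : PDO D →+ PDO D :=
  AddMonoidHom.mk' (· * c) fun a b => PDO.add_mul a b c

/-- Left multiplication, as an additive map. -/
def mulLeftHom (c : PDO D) : PDO D →+ PDO D :=
  AddMonoidHom.mk' (c * ·) fun a b => PDO.mul_add c a b

theorem mulRightHom_apply (a c : PDO D) : mulRightHom c a = a * c := rfl
theorem filtered_mulRightHom (c : PDO D) : Filtered (mulRightHom c) := by
  obtain ⟨M, hM⟩ := c.exists_ordLE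
  exact ⟨M, fun a N ha => ha.mul hM⟩

theorem filtered_mulLeftHom (c : PDO D) : Filtered (mulLeftHom c) := by
  obtain ⟨M, hM⟩ := c.exists_ordLE
  exact ⟨M, fun a N ha => by rw [add_comm]; exact hM.mul ha⟩

/-- Multiplication of all coefficients by an element of `V`. -/
instance : Module V (PDO D) where
  smul v a := ⟨fun n => v * a.coeff n, by
    obtain ⟨N, hN⟩ := a.2
    exact ⟨N, fun n hn => (congrArg (v * ·) (hN n hn)).trans (mul_zero v)⟩⟩
  one_smul a := ext fun n => one_mul (a.coeff n)
  mul_smul v w a := ext fun n => mul_assoc v w (a.coeff n)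
  smul_zero v := ext fun _ => mul_zero v
  smul_add v a b := ext fun n => mul_add v (a.coeff n) (b.coeff n)
  add_smul v w a := ext fun n => add_mul v w (a.coeff n)
  zero_smul a := ext fun n => zero_mul (a.coeff n)

@[simp] theorem coeff_smul (v : V) (a : PDO D) (n : ℤ) : (v • a).coeff n = v * a.coeff n := rfl

theorem smul_single (v w : V) (n : ℤ) : v • (single n w : PDO D) = single n (v * w) := by
  ext i; simp only [coeff_smul, coeff_single]; split_ifs <;> simp

theorem single_eq_smul (n : ℤ) (v : V) : (single n v : PDO D) = v • dpow n := by
  rw [dpow, smul_single, mul_one]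

theorem OrdLE.smul {a : PDO D} {N : ℤ} (v : V) (ha : a.OrdLE N) : (v • a).OrdLE N :=
  fun n hn => by simp [ha n hn]

/-- `V`-scalar multiplication, as an additive map. -/
def smulHom (v : V) : PDO D →+ PDO D := DistribSMul.toAddMonoidHom (PDO D) v

theorem filtered_smulHom (v : V) : Filtered (smulHom v : PDO D →+ PDO D) :=
  ⟨0, fun a N ha => by rw [add_zero]; exact ha.smul v⟩

theorem single_mul_coeff (i : ℤ) (u : V) (b : PDO D) (n : ℤ) {K : ℕ}
    (hK : ∀ p : ℕ, K ≤ p → b.coeff (n + p - i) = 0) :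
    (single i u * b).coeff n =
      ∑ p ∈ Finset.range K, Ring.choose i p • (u * D^[p] (b.coeff (n + p - i))) := by
  rw [mul_coeff, finsum_eq_sum_of_support_subset (s := {i} ×ˢ Finset.range K)]
  · rw [Finset.sum_product]
    simp [coeff_single]
  · intro q hq
    have h1 : q.1 = i := by
      by_contra h
      exact hq (by simp only [coeff_single, if_neg h, zero_mul, smul_zero])
    have h2 : q.2 < K := by
      by_contra h
      exact hq (by simp only [h1, hK _ (not_lt.1 h), iterate_zero, mul_zero, smul_zero])
    simpa using ⟨q.2, h2, by rw [← h1]⟩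

theorem single_mul (i : ℤ) (u : V) (b : PDO D) : single i u * b = u • (dpow i * b) := by
  obtain ⟨M, hM⟩ := b.exists_ordLE
  ext n
  have hK : ∀ p : ℕ, (M + i - n).toNat + 1 ≤ p → b.coeff (n + p - i) = 0 :=
    fun p hp => hM _ (by omega)
  rw [coeff_smul, dpow, single_mul_coeff _ _ _ _ hK, single_mul_coeff _ _ _ _ hK,
    Finset.mul_sum]
  exact Finset.sum_congr rfl fun p _ => by rw [one_mul, mul_smul_comm]

/-- Left composition with `∂`. -/
def dmul : PDO D →+ PDO D where
  toFun a := ⟨fun n => D (a.coeff n) + a.coeff (n - 1), by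
    obtain ⟨N, hN⟩ := a.exists_ordLE
    exact ⟨N + 1, fun n hn => by
      change D (a.coeff n) + a.coeff (n - 1) = 0
      rw [hN n (by omega), hN (n - 1) (by omega)]; simp⟩⟩
  map_zero' := by
    ext n
    change D 0 + 0 = (0 : V)
    simp
  map_add' a b := by
    ext n
    change D (a.coeff n + b.coeff n) + (a.coeff (n - 1) + b.coeff (n - 1)) =
      D (a.coeff n) + a.coeff (n - 1) + (D (b.coeff n) + b.coeff (n - 1))
    rw [map_add]; abel

theorem coeff_dmul (a : PDO D) (n : ℤ) :
    (dmul a).coeff n = D (a.coeff n) + a.coeff (n - 1) := rfl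

theorem filtered_dmul : Filtered (dmul : PDO D →+ PDO D) :=
  ⟨1, fun a N ha n hn => by rw [coeff_dmul, ha n (by omega), ha (n - 1) (by omega)]; simp⟩

/-- If ∂∘a = 0, the coefficient of ∂ⁿ⁺¹ expresses aₙ through the derivative of aₙ₊₁, so all
coefficients vanish by descent from the top. Injectivity is what lets inductions on exponents pass
to negative powers of ∂. -/
theorem dmul_injective : Function.Injective (dmul : PDO D →+ PDO D) := by
  refine (injective_iff_map_eq_zero _).2 fun a ha => ?_
  obtain ⟨N, hN⟩ := a.exists_ordLE
  have key : ∀ p : ℕ, ∀ n : ℤ, N - p < n → a.coeff n = 0 := by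
    intro p
    induction p with
    | zero => exact fun n hn => hN n (by simpa using hn)
    | succ p ih =>
      intro n hn
      have h := congrArg (fun x => coeff x (n + 1)) ha
      simp only [coeff_dmul, coeff_zero, add_sub_cancel_right] at h
      rwa [ih (n + 1) (by push_cast at hn; omega), map_zero, zero_add] at h
  ext n
  exact key (N - n + 1).toNat n (by omega)

theorem dmul_smul (v : V) (a : PDO D) : dmul (v • a) = D v • a + v • dmul a := by
  ext n
  simp only [coeff_dmul, coeff_smul, coeff_add, Derivation.leibniz, smul_eq_mul]
  ring

theorem dmul_single (n : ℤ) (v : V) :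
    dmul (single n v : PDO D) = single n (D v) + single (n + 1) v := by
  ext i
  simp only [coeff_dmul, coeff_single, coeff_add]
  congr 1
  · split_ifs <;> simp
  · simp [sub_eq_iff_eq_add]

theorem dmul_dpow (n : ℤ) : dmul (dpow n : PDO D) = dpow (n + 1) := by
  rw [dpow, dmul_single, D.map_one_eq_zero, dpow]
  ext i
  simp [coeff_single]

/-- This is Pascal's rule for binomial coefficients with an integer upper argument. -/
theorem dpow_succ_mul (i : ℤ) (b : PDO D) : dpow (i + 1) * b = dmul (dpow i * b) := by
  obtain ⟨M, hM⟩ := b.exists_ordLE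
  ext n
  set K := (M + i - n).toNat + 1 with hK
  rw [coeff_dmul, dpow, dpow, single_mul_coeff (K := K + 1) _ _ _ _ fun p hp => hM _ (by omega),
    single_mul_coeff (K := K) _ _ _ _ fun p hp => hM _ (by omega),
    single_mul_coeff (K := K + 1) _ _ _ _ fun p hp => hM _ (by omega),
    Finset.sum_range_succ', Finset.sum_range_succ' _ K, map_sum, ← add_assoc,
    ← Finset.sum_add_distrib]
  congr 1
  · refine Finset.sum_congr rfl fun p _ => ?_
    rw [Ring.choose_succ_succ, add_smul, map_zsmul, one_mul, one_mul, one_mul,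
      ← Function.iterate_succ_apply' D, show n + ((p + 1 : ℕ) : ℤ) - (i + 1) = n + p - i by
        push_cast; ring, show n - 1 + ((p + 1 : ℕ) : ℤ) - i = n + p - i by push_cast; ring]
  · simp only [Nat.cast_zero, Ring.choose_zero_right, Function.iterate_zero, id, one_mul, one_smul]
    congr 1
    ring

theorem dpow_zero_mul (b : PDO D) : dpow 0 * b = b := by
  obtain ⟨M, hM⟩ := b.exists_ordLE
  ext n
  rw [dpow, single_mul_coeff (K := (M - n).toNat + 1) _ _ _ _ fun p hp => hM _ (by omega),
    Finset.sum_range_succ']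
  simp [Ring.choose_zero_succ]

protected theorem smul_mul (v : V) (a b : PDO D) : (v • a) * b = v • (a * b) := by
  refine eq_of_single (φ := (mulRightHom b).comp (smulHom v))
    (ψ := (smulHom v).comp (mulRightHom b)) ?_ ?_ (fun n w => ?_) a
  · exact (filtered_mulRightHom b).comp (filtered_smulHom v)
  · exact (filtered_smulHom v).comp (filtered_mulRightHom b)
  · change (v • single n w) * b = v • (single n w * b)
    rw [smul_single, single_mul, single_mul, mul_smul]

theorem dmul_mul (a b : PDO D) : dmul a * b = dmul (a * b) := by
  refine eq_of_single (φ := (mulRightHom b).comp dmul) (ψ := dmul.comp (mulRightHom b))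
    ?_ ?_ (fun n w => ?_) a
  · exact (filtered_mulRightHom b).comp filtered_dmul
  · exact filtered_dmul.comp (filtered_mulRightHom b)
  · change dmul (single n w) * b = dmul (single n w * b)
    rw [dmul_single, PDO.add_mul, single_mul, single_mul, single_mul, dmul_smul, dpow_succ_mul]

/-- The core of associativity: the general case follows by V-linearity on the left and density of
monomials. -/
theorem dpow_mul_assoc (i : ℤ) (b c : PDO D) : dpow i * b * c = dpow i * (b * c) := by
  induction i using Int.induction_on with
  | zero => rw [dpow_zero_mul, dpow_zero_mul]
  | succ n ih => rw [dpow_succ_mul, dpow_succ_mul, dmul_mul, ih]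
  | pred n ih =>
    apply dmul_injective
    rw [← dmul_mul, ← dpow_succ_mul, ← dpow_succ_mul, sub_add_cancel, ih]

protected theorem mul_assoc (a b c : PDO D) : a * b * c = a * (b * c) := by
  refine eq_of_single (φ := (mulRightHom c).comp (mulRightHom b))
    (ψ := mulRightHom (b * c)) ?_ ?_ (fun n w => ?_) a
  · exact (filtered_mulRightHom c).comp (filtered_mulRightHom b)
  · exact filtered_mulRightHom _
  · change single n w * b * c = single n w * (b * c)
    rw [single_mul, single_mul, PDO.smul_mul, dpow_mul_assoc]

theorem dpow_mul_one (i : ℤ) : dpow i * (1 : PDO D) = dpow i := by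
  induction i using Int.induction_on with
  | zero => rw [dpow_zero_mul, dpow_zero]
  | succ n ih => rw [dpow_succ_mul, ih, dmul_dpow]
  | pred n ih =>
    apply dmul_injective
    rw [← dpow_succ_mul, dmul_dpow, sub_add_cancel, ih]

protected theorem mul_one (a : PDO D) : a * 1 = a := by
  refine eq_of_single (φ := mulRightHom 1) (ψ := AddMonoidHom.id _) (filtered_mulRightHom _)
    ⟨0, fun a N ha => by simpa using ha⟩ (fun n w => ?_) a
  change single n w * 1 = single n w
  rw [single_mul, dpow_mul_one, single_eq_smul]

/-- Pseudodifferential operators form a ring under composition. -/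
scoped instance : Ring (PDO D) :=
  { (inferInstance : AddCommGroup (PDO D)) with
    mul := (· * ·)
    one := 1
    left_distrib := PDO.mul_add
    right_distrib := PDO.add_mul
    zero_mul := fun a => (mulRightHom a).map_zero
    mul_zero := fun a => (mulLeftHom a).map_zero
    mul_assoc := PDO.mul_assoc
    one_mul := dpow_zero_mul
    mul_one := PDO.mul_one }

theorem dpow_one_mul (a : PDO D) : dpow 1 * a = dmul a := by
  have := dpow_succ_mul 0 a
  rwa [dpow_zero_mul, zero_add] at this

theorem dpow_mul_dpow (i j : ℤ) : (dpow i * dpow j : PDO D) = dpow (i + j) := by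
  induction i using Int.induction_on with
  | zero => rw [dpow_zero_mul, zero_add]
  | succ n ih => rw [dpow_succ_mul, ih, dmul_dpow]; congr 1; ring
  | pred n ih =>
    apply dmul_injective
    rw [← dpow_succ_mul, dmul_dpow, sub_add_cancel, ih]; congr 1; ring

theorem single_zero_mul (v : V) (a : PDO D) : single 0 v * a = v • a := by
  rw [single_mul, dpow_zero_mul]

theorem dpow_one_mul_single (v : V) :
    (dpow 1 * single 0 v : PDO D) = single 0 (D v) + single 0 v * dpow 1 := by
  rw [dpow_one_mul, dmul_single, single_zero_mul, ← single_eq_smul, zero_add]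

theorem coeff_mul_dpow (a : PDO D) (i n : ℤ) : (a * dpow i).coeff n = a.coeff (n - i) := by
  let shift : PDO D →+ PDO D :=
    { toFun := fun a => ⟨fun n => a.coeff (n - i), by
        obtain ⟨N, hN⟩ := a.exists_ordLE
        exact ⟨N + i, fun n hn => hN _ (by omega)⟩⟩
      map_zero' := rfl
      map_add' := fun _ _ => rfl }
  have : mulRightHom (dpow i) a = shift a := by
    refine eq_of_single (filtered_mulRightHom _)
      ⟨i, fun b N hb n hn => hb (n - i) (by omega)⟩ (fun m w => ?_) a
    rw [mulRightHom_apply, single_mul, dpow_mul_dpow, ← single_eq_smul]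
    ext j
    change _ = (single m w : PDO D).coeff (j - i)
    simp [coeff_single, sub_eq_iff_eq_add]
  exact congrArg (fun x : PDO D => x.coeff n) this

/-- Right multiplication by `b` is V-linear in the coefficients of `a`. This form makes sense for
bare coefficient families, and is what `rmul` later uses. -/
theorem mul_coeff_eq_sum_dpow (a b : PDO D) {N M : ℤ} (ha : a.OrdLE N) (hb : b.OrdLE M) (n : ℤ) :
    (a * b).coeff n = ∑ i ∈ Finset.Icc (n - M) N, a.coeff i * (dpow i * b).coeff n := by
  rw [mul_coeff_eq_sum ha hb, Finset.sum_product]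
  refine Finset.sum_congr rfl fun i hi => ?_
  rw [Finset.mem_Icc] at hi
  rw [dpow, single_mul_coeff (K := (M + N - n).toNat + 1) _ _ _ _ fun p hp => hb _ (by omega),
    Finset.mul_sum]
  exact Finset.sum_congr rfl fun p _ => by rw [one_mul, mul_smul_comm]

/-! ### The formal adjoint as an anti-involution. -/

/-- The sign `(-1)ⁿ`. -/
def sgn (n : ℤ) : ℤ := (((-1 : ℤˣ) ^ n : ℤˣ) : ℤ)

theorem sgn_zero : sgn 0 = 1 := by simp [sgn]
theorem sgn_add (m n : ℤ) : sgn (m + n) = sgn m * sgn n := by simp [sgn, zpow_add]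
theorem sgn_one : sgn 1 = -1 := by simp [sgn]
theorem sgn_mul_self (n : ℤ) : sgn n * sgn n = 1 := by
  rw [sgn, ← Units.val_mul, Int.units_mul_self, Units.val_one]
theorem sgn_neg (n : ℤ) : sgn (-n) = sgn n := by simp [sgn]

theorem sgn_add_one (n : ℤ) : sgn (n + 1) = -sgn n := by rw [sgn_add, sgn_one]; ring
theorem sgn_sub (m n : ℤ) : sgn (m - n) = sgn m * sgn n := by
  rw [sub_eq_add_neg, sgn_add, sgn_neg]

theorem adjoint_coeff (a : PDO D) (j : ℤ) : a.adjoint.coeff j =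
    ∑ᶠ k : ℕ, sgn (j + k) • Ring.choose (j + k) k • D^[k] (a.coeff (j + k)) := rfl

theorem adjoint_coeff_eq_sum {a : PDO D} {j : ℤ} {K : ℕ}
    (hK : ∀ k : ℕ, K ≤ k → a.coeff (j + k) = 0) : a.adjoint.coeff j =
      ∑ k ∈ Finset.range K, sgn (j + k) • Ring.choose (j + k) k • D^[k] (a.coeff (j + k)) := by
  rw [adjoint_coeff]
  refine finsum_eq_sum_of_support_subset _ fun k hk => ?_
  by_contra h
  exact hk (by simp only [hK k (by simpa using h), iterate_zero, smul_zero])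

theorem OrdLE.adjoint {a : PDO D} {N : ℤ} (ha : a.OrdLE N) : a.adjoint.OrdLE N := by
  intro n hn
  rw [adjoint_coeff_eq_sum (K := 0) fun k _ => ha _ (by omega), Finset.sum_range_zero]

/-- The formal adjoint, as an additive map. -/
def adjointHom : PDO D →+ PDO D := AddMonoidHom.mk' adjoint fun a b => by
  obtain ⟨N, hN⟩ := a.exists_ordLE
  obtain ⟨M, hM⟩ := b.exists_ordLE
  have ha := hN.mono (le_max_left N M)
  have hb := hM.mono (le_max_right N M)
  ext j
  have key : ∀ c : PDO D, c.OrdLE (max N M) → ∀ k : ℕ, (max N M - j).toNat + 1 ≤ k →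
    c.coeff (j + k) = 0 := fun c hc k hk => hc _ (by omega)
  rw [coeff_add, adjoint_coeff_eq_sum (key _ ha), adjoint_coeff_eq_sum (key _ hb),
    adjoint_coeff_eq_sum (key _ (ha.add hb)), ← Finset.sum_add_distrib]
  exact Finset.sum_congr rfl fun k _ => by
    rw [coeff_add, iterate_map_add, smul_add, smul_add]

@[simp] theorem adjoint_add (a b : PDO D) : (a + b).adjoint = a.adjoint + b.adjoint :=
  map_add adjointHom a b
@[simp] theorem adjoint_sub (a b : PDO D) : (a - b).adjoint = a.adjoint - b.adjoint :=
  map_sub adjointHom a b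
@[simp] theorem adjoint_zero : (0 : PDO D).adjoint = 0 := map_zero adjointHom
@[simp] theorem adjoint_sum {ι : Type*} (s : Finset ι) (f : ι → PDO D) :
    (∑ i ∈ s, f i).adjoint = ∑ i ∈ s, (f i).adjoint := map_sum adjointHom f s
theorem adjoint_zsmul (z : ℤ) (a : PDO D) : (z • a).adjoint = z • a.adjoint :=
  map_zsmul adjointHom z a

theorem filtered_adjointHom : Filtered (adjointHom : PDO D →+ PDO D) :=
  ⟨0, fun a N ha => by rw [add_zero]; exact ha.adjoint⟩

/-- Links the coefficient formula to the intended meaning (−∂)ⁿ∘v; from here on adjoints are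
computed by ring algebra only. -/
theorem adjoint_single (n : ℤ) (v : V) :
    (single n v : PDO D).adjoint = sgn n • (dpow n * single 0 v) := by
  ext j
  have hK : ∀ k : ℕ, (n - j).toNat + 1 ≤ k → (single n v : PDO D).coeff (j + k) = 0 :=
    fun k hk => if_neg (by omega)
  have hK' : ∀ k : ℕ, (n - j).toNat + 1 ≤ k → (single 0 v : PDO D).coeff (j + k - n) = 0 :=
    fun k hk => if_neg (by omega)
  rw [adjoint_coeff_eq_sum hK, coeff_zsmul, dpow, single_mul_coeff _ _ _ _ hK', Finset.smul_sum]
  refine Finset.sum_congr rfl fun k _ => ?_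
  rw [one_mul, coeff_single, coeff_single]
  by_cases h : j + k = n
  · rw [h, sub_self]; simp
  · rw [if_neg h, if_neg (by omega), iterate_zero]; simp

theorem adjoint_dpow (n : ℤ) : (dpow n : PDO D).adjoint = sgn n • dpow n := by
  rw [dpow, adjoint_single]
  change sgn n • (dpow n * 1) = _
  rw [mul_one]; rfl

theorem adjoint_single_zero (v : V) : (single 0 v : PDO D).adjoint = single 0 v := by
  rw [adjoint_single, sgn_zero, dpow_zero_mul, one_smul]

theorem adjoint_one : (1 : PDO D).adjoint = 1 := adjoint_single_zero 1

theorem adjoint_dmul (b : PDO D) : (dmul b).adjoint = -(b.adjoint * dpow 1) := by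
  refine eq_of_single (φ := adjointHom.comp dmul)
    (ψ := -((mulRightHom (dpow 1)).comp adjointHom)) ?_ ?_ (fun n v => ?_) b
  · exact filtered_adjointHom.comp filtered_dmul
  · obtain ⟨d, hd⟩ := (filtered_mulRightHom (dpow 1 : PDO D)).comp filtered_adjointHom
    exact ⟨d, fun a N ha => (hd a N ha).neg⟩
  · change (dmul (single n v)).adjoint = -((single n v).adjoint * dpow 1)
    rw [dmul_single, adjoint_add, adjoint_single, adjoint_single, adjoint_single, sgn_add_one,
      ← dpow_mul_dpow, mul_assoc, dpow_one_mul_single, mul_add, smul_mul_assoc, mul_assoc,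
      neg_smul, smul_add]
    abel

theorem adjoint_dpow_mul (i : ℤ) (b : PDO D) :
    (dpow i * b).adjoint = b.adjoint * (dpow i).adjoint := by
  have step : ∀ i : ℤ, (dpow (i + 1) * b).adjoint = -((dpow i * b).adjoint * dpow 1) :=
    fun i => by rw [dpow_succ_mul, adjoint_dmul]
  have step' : ∀ i : ℤ, (dpow (i + 1) : PDO D).adjoint = -((dpow i).adjoint * dpow 1) :=
    fun i => by rw [← dmul_dpow, adjoint_dmul]
  induction i using Int.induction_on with
  | zero => rw [dpow_zero_mul, dpow_zero, adjoint_one, mul_one]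
  | succ n ih => rw [step, step', ih, mul_neg, mul_assoc]
  | pred n ih =>
    -- One step upwards from exponent `-n - 1` gives the identity up to a right factor ∂, which is
    -- then cancelled by composing with ∂⁻¹.
    have h := step (-n - 1)
    rw [sub_add_cancel, ih, ← sub_add_cancel (-n : ℤ) 1, step', mul_neg, neg_inj, ← mul_assoc] at h
    have h2 := congrArg (· * dpow (-1)) h
    simp only [mul_assoc, dpow_mul_dpow] at h2
    simpa [dpow_zero] using h2.symm

theorem adjoint_smul (v : V) (b : PDO D) : (v • b).adjoint = b.adjoint * single 0 v := by
  refine eq_of_single (φ := adjointHom.comp (smulHom v))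
    (ψ := (mulRightHom (single 0 v)).comp adjointHom) ?_ ?_ (fun n w => ?_) b
  · exact filtered_adjointHom.comp (filtered_smulHom v)
  · exact (filtered_mulRightHom _).comp filtered_adjointHom
  · change (v • single n w).adjoint = (single n w).adjoint * single 0 v
    rw [smul_single, adjoint_single, adjoint_single, smul_mul_assoc, mul_assoc, single_zero_mul,
      smul_single, mul_comm]

theorem adjoint_mul (a b : PDO D) : (a * b).adjoint = b.adjoint * a.adjoint := by
  refine eq_of_single (φ := adjointHom.comp (mulRightHom b))
    (ψ := (mulLeftHom b.adjoint).comp adjointHom) ?_ ?_ (fun n w => ?_) a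
  · exact filtered_adjointHom.comp (filtered_mulRightHom b)
  · exact (filtered_mulLeftHom _).comp filtered_adjointHom
  · change (single n w * b).adjoint = b.adjoint * (single n w).adjoint
    rw [single_mul, adjoint_smul, adjoint_dpow_mul, single_eq_smul n w, adjoint_smul, mul_assoc]

theorem adjoint_adjoint (a : PDO D) : a.adjoint.adjoint = a := by
  refine eq_of_single (φ := adjointHom.comp adjointHom)
    (ψ := AddMonoidHom.id _) ?_ ⟨0, fun a N ha => by simpa using ha⟩ (fun n w => ?_) a
  · exact filtered_adjointHom.comp filtered_adjointHom
  · change (single n w).adjoint.adjoint = single n w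
    rw [adjoint_single, adjoint_zsmul, adjoint_mul, adjoint_single_zero, adjoint_dpow,
      mul_smul_comm, smul_smul, sgn_mul_self, one_smul, single_zero_mul, ← single_eq_smul]

end PDO

/-! ### Differential and rational operators. -/

namespace PDO

section Differential

variable {F V : Type*} [Field F] [CommRing V] [Algebra F V] {D : Derivation F V V}

theorem IsDifferential.add {a b : PDO D} (ha : a.IsDifferential) (hb : b.IsDifferential) :
    (a + b).IsDifferential := fun n hn => by simp [ha n hn, hb n hn]

theorem isDifferential_zero : (0 : PDO D).IsDifferential := fun _ _ => rfl

theorem isDifferential_one : (1 : PDO D).IsDifferential := fun _ hn => if_neg hn.ne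

theorem IsDifferential.neg {a : PDO D} (ha : a.IsDifferential) : (-a).IsDifferential :=
  fun n hn => by simp [ha n hn]

theorem IsDifferential.sum {ι : Type*} {s : Finset ι} {f : ι → PDO D}
    (h : ∀ i ∈ s, (f i).IsDifferential) : (∑ i ∈ s, f i).IsDifferential := fun n hn => by
  rw [coeff_sum]; exact Finset.sum_eq_zero fun i hi => h i hi n hn

theorem IsDifferential.smul {a : PDO D} (v : V) (ha : a.IsDifferential) :
    (v • a).IsDifferential := fun n hn => by simp [ha n hn]

theorem isDifferential_dpow (n : ℕ) : (dpow n : PDO D).IsDifferential :=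
  fun i hi => if_neg (by omega)

theorem IsDifferential.dpow_mul {b : PDO D} (hb : b.IsDifferential) (i : ℕ) :
    (dpow i * b).IsDifferential := by
  induction i with
  | zero => exact (dpow_zero_mul b).symm ▸ hb
  | succ i ih =>
    intro n hn
    rw [Nat.cast_succ, dpow_succ_mul, coeff_dmul, ih n hn, ih (n - 1) (by omega)]
    simp

theorem IsDifferential.mul {a b : PDO D} (ha : a.IsDifferential) (hb : b.IsDifferential) :
    (a * b).IsDifferential := by
  intro n hn
  obtain ⟨N, hN⟩ := a.exists_ordLE
  obtain ⟨M, hM⟩ := b.exists_ordLE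
  rw [mul_coeff_eq_sum_dpow a b hN hM]
  refine Finset.sum_eq_zero fun i _ => ?_
  rcases lt_or_ge i 0 with h | h
  · rw [ha i h, zero_mul]
  · lift i to ℕ using h
    rw [hb.dpow_mul i n hn, mul_zero]

/-- For a negative index j, either j + k is negative and the coefficient is zero, or 0 ≤ j + k < k
and the binomial coefficient is zero. -/
theorem IsDifferential.adjoint {a : PDO D} (ha : a.IsDifferential) :
    a.adjoint.IsDifferential := by
  intro j hj
  rw [adjoint_coeff]
  refine (finsum_congr fun k => ?_).trans finsum_zero
  rcases lt_or_ge (j + k) 0 with h | h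
  · rw [ha _ h, iterate_zero, smul_zero, smul_zero]
  · obtain ⟨l, hl⟩ := Int.eq_ofNat_of_zero_le h
    rw [hl, Ring.choose_natCast, Nat.choose_eq_zero_of_lt (by omega)]
    simp

theorem coeff_mul_of_ordLE {a b : PDO D} {N M : ℤ} (ha : a.OrdLE N) (hb : b.OrdLE M) :
    (a * b).coeff (N + M) = a.coeff N * b.coeff M := by
  rw [mul_coeff_eq_sum_dpow a b ha hb, add_sub_cancel_right, Finset.Icc_self,
    Finset.sum_singleton, dpow, single_mul_coeff (K := 1) _ _ _ _ fun p hp => hb _ (by omega)]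
  simp

theorem exists_leading {a : PDO D} (ha : a ≠ 0) : ∃ N, a.OrdLE N ∧ a.coeff N ≠ 0 := by
  obtain ⟨M, hM⟩ := a.exists_ordLE
  have hne : ∃ n, a.coeff n ≠ 0 := by
    by_contra h
    push Not at h
    exact ha (ext h)
  obtain ⟨N, h1, h2⟩ := Int.exists_greatest_of_bdd (P := fun n => a.coeff n ≠ 0)
    ⟨M, fun n hn => by by_contra h; exact hn (hM n (by omega))⟩ hne
  exact ⟨N, fun n hn => by by_contra h; exact absurd (h2 n h) (by omega), h1⟩

/-- `L = B⁻¹ ∘ A` for differential operators `A` and `B ≠ 0`. -/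
def IsLeftRational (L : PDO D) : Prop :=
  ∃ B : PDO D, B.IsDifferential ∧ B ≠ 0 ∧ (B * L).IsDifferential

theorem isRational_iff {L : PDO D} : L.IsRational ↔ L.adjoint.IsLeftRational := by
  constructor
  · rintro ⟨A, B, hA, hB, hB0, rfl⟩
    refine ⟨B.adjoint, hB.adjoint, fun h => hB0 ?_, ?_⟩
    · rw [← adjoint_adjoint B, h, adjoint_zero]
    · rw [← adjoint_mul]; exact hA.adjoint
  · rintro ⟨B, hB, hB0, hA⟩
    refine ⟨L * B.adjoint, B.adjoint, ?_, hB.adjoint, fun h => hB0 ?_, rfl⟩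
    · have := hA.adjoint
      rwa [adjoint_mul, adjoint_adjoint] at this
    · rw [← adjoint_adjoint B, h, adjoint_zero]

end Differential

variable {F V : Type*} [Field F] [CommRing V] [IsDomain V] [Algebra F V] {D : Derivation F V V}

/-- Leading coefficients multiply, and V is a domain. -/
instance : NoZeroDivisors (PDO D) where
  eq_zero_or_eq_zero_of_mul_eq_zero := by
    intro a b hab
    by_contra! h
    obtain ⟨N, hN, hN'⟩ := exists_leading h.1
    obtain ⟨M, hM, hM'⟩ := exists_leading h.2
    have := coeff_mul_of_ordLE hN hM
    rw [hab, coeff_zero] at this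
    exact mul_ne_zero hN' hM' this.symm

/-- A matrix of differential operators with more rows than columns has a nontrivial left
kernel. -/
theorem exists_row_mul_eq_zero {ι κ : Type*} [Fintype ι] [Fintype κ]
    (hcard : Fintype.card κ < Fintype.card ι) (C : ι → κ → PDO D)
    (hC : ∀ i j, (C i j).IsDifferential) :
    ∃ X : ι → PDO D, (∀ i, (X i).IsDifferential) ∧ X ≠ 0 ∧ ∀ j, ∑ i, X i * C i j = 0 := by
  classical
  obtain ⟨n, hn⟩ : ∃ n : ℕ, ∀ i j, (C i j).OrdLE n := by
    choose f hf using fun q : ι × κ => (C q.1 q.2).exists_ordLE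
    refine ⟨∑ q, (f q).toNat, fun i j => (hf (i, j)).mono ?_⟩
    have : (f (i, j)).toNat ≤ ∑ q, (f q).toNat :=
      Finset.single_le_sum (f := fun q => (f q).toNat) (fun _ _ => Nat.zero_le _)
        (Finset.mem_univ (i, j))
    omega
  -- With `n` bounding the orders of the entries, look for operators of order at most `N`. There are
  -- at least (|κ| + 1)(N + 1) unknown coefficients and |κ|(N + n + 1) equations, linear over V;
  -- this `N` makes the former exceed the latter by one.
  set N : ℕ := Fintype.card κ * n with hN
  let op : (ι × Fin (N + 1) → V) → ι → PDO D := fun x i => ∑ s, x (i, s) • dpow (s : ℕ)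
  have op_add : ∀ x y i, op (x + y) i = op x i + op y i := fun x y i => by
    simp only [op, Pi.add_apply, add_smul, Finset.sum_add_distrib]
  have op_smul : ∀ (v : V) x i, op (v • x) i = v • op x i := fun v x i => by
    simp only [op, Pi.smul_apply, smul_eq_mul, mul_smul, Finset.smul_sum]
  let T : (ι × Fin (N + 1) → V) →ₗ[V] (κ × Fin (N + n + 1) → V) :=
    { toFun := fun x q => (∑ i, op x i * C i q.1).coeff (q.2 : ℕ)
      map_add' := fun x y => by
        funext q
        simp only [op_add, add_mul, Finset.sum_add_distrib, coeff_add, Pi.add_apply]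
      map_smul' := fun v x => by
        funext q
        simp only [op_smul, PDO.smul_mul, ← Finset.smul_sum, coeff_smul, Pi.smul_apply,
          RingHom.id_apply, smul_eq_mul] }
  have hT : ¬ Function.Injective T := by
    intro h
    have h1 := card_le_of_injective V T h
    rw [Fintype.card_prod, Fintype.card_prod, Fintype.card_fin,
      Fintype.card_fin] at h1
    have h2 : (Fintype.card κ + 1) * (N + 1) ≤ Fintype.card κ * (N + n + 1) :=
      (Nat.mul_le_mul_right _ hcard).trans h1
    have h3 : (Fintype.card κ + 1) * (N + 1) = Fintype.card κ * (N + n + 1) + 1 := by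
      rw [hN]; ring
    omega
  rw [injective_iff_map_eq_zero] at hT
  push Not at hT
  obtain ⟨x, hx, hx0⟩ := hT
  have hdiff : ∀ i, (op x i).IsDifferential := fun i =>
    IsDifferential.sum fun s _ => (isDifferential_dpow _).smul _
  have hord : ∀ i, (op x i).OrdLE N := fun i t ht => by
    simp only [op, coeff_sum, coeff_smul, coeff_dpow]
    refine Finset.sum_eq_zero fun s _ => ?_
    rw [if_neg (by have := s.2; omega), mul_zero]
  refine ⟨op x, hdiff, fun h => hx0 ?_, fun j => ?_⟩
  · funext q
    have := congrArg (fun a : PDO D => a.coeff (q.2 : ℕ)) (congrFun h q.1)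
    simpa [op, coeff_dpow, Fin.val_inj] using this
  · ext t
    by_cases h0 : t < 0
    · exact IsDifferential.sum (fun i _ => (hdiff i).mul (hC i j)) t h0
    · by_cases h1 : t ≤ N + n
      · lift t to ℕ using not_lt.1 h0
        exact congrFun hx (j, ⟨t, by omega⟩)
      · rw [coeff_sum]
        exact Finset.sum_eq_zero fun i _ => (hord i).mul (hn i j) t (by omega)

/-- The left Ore condition for differential operators. -/
theorem exists_common_left_multiple {A B : PDO D} (hA : A.IsDifferential)
    (hB : B.IsDifferential) (hB0 : B ≠ 0) :
    ∃ X Y : PDO D, X.IsDifferential ∧ Y.IsDifferential ∧ X ≠ 0 ∧ X * A = Y * B := by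
  obtain ⟨X, h1, h2, h3⟩ := exists_row_mul_eq_zero (ι := Fin 2) (κ := Fin 1) (by simp)
    (fun i _ => ![A, B] i) (fun i _ => by fin_cases i <;> assumption)
  have h := h3 0
  simp only [Fin.sum_univ_two, Matrix.cons_val_zero, Matrix.cons_val_one] at h
  refine ⟨X 0, -X 1, h1 0, (h1 1).neg, fun h0 => h2 ?_, by
    rw [neg_mul]; exact eq_neg_of_add_eq_zero_left h⟩
  rw [h0, zero_mul, zero_add] at h
  funext i
  fin_cases i
  · exact h0
  · exact (mul_eq_zero.1 h).resolve_right hB0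

/-- Denominators are merged one at a time by the Ore condition; enlarging the common one on the left
keeps the earlier products differential. -/
theorem exists_common_denominator {ι : Type*} (s : Finset ι) (L : ι → PDO D)
    (hL : ∀ i ∈ s, (L i).IsLeftRational) :
    ∃ B : PDO D, B.IsDifferential ∧ B ≠ 0 ∧ ∀ i ∈ s, (B * L i).IsDifferential := by
  classical
  induction s using Finset.induction_on with
  | empty =>
    refine ⟨1, isDifferential_one, fun h => ?_, by simp⟩
    have := congrArg (fun a : PDO D => a.coeff 0) h
    simp [coeff_one] at this
  | insert i s hi ih =>
    obtain ⟨B, hB, hB0, hs⟩ := ih fun j hj => hL j (Finset.mem_insert_of_mem hj)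
    obtain ⟨B', hB', hB0', hA⟩ := hL i (Finset.mem_insert_self _ _)
    obtain ⟨X, Y, hX, hY, hX0, hXY⟩ := exists_common_left_multiple hB hB' hB0'
    refine ⟨X * B, hX.mul hB, mul_ne_zero hX0 hB0, fun j hj => ?_⟩
    rcases Finset.mem_insert.1 hj with rfl | hj
    · rw [hXY, mul_assoc]; exact hY.mul hA
    · rw [mul_assoc]; exact hX.mul (hs j hj)

theorem IsLeftRational.add {L L' : PDO D} (h : L.IsLeftRational) (h' : L'.IsLeftRational) :
    (L + L').IsLeftRational := by
  obtain ⟨B, hB, hB0, hA⟩ := exists_common_denominator Finset.univ ![L, L'] (fun i _ => by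
    fin_cases i <;> assumption)
  refine ⟨B, hB, hB0, ?_⟩
  rw [mul_add]
  exact (hA 0 (Finset.mem_univ _)).add (hA 1 (Finset.mem_univ _))

theorem IsLeftRational.mul {L L' : PDO D} (h : L.IsLeftRational) (h' : L'.IsLeftRational) :
    (L * L').IsLeftRational := by
  obtain ⟨B, hB, hB0, hA⟩ := h
  obtain ⟨B', hB', hB0', hA'⟩ := h'
  obtain ⟨X, Y, hX, hY, hX0, hXY⟩ := exists_common_left_multiple hA hB' hB0'
  refine ⟨X * B, hX.mul hB, mul_ne_zero hX0 hB0, ?_⟩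
  rw [← mul_assoc, mul_assoc X, hXY, mul_assoc]
  exact hY.mul hA'

/-- Clear denominators in each row of C and put the unit row eᵢ on top: there is one more row than
columns, so a nontrivial left relation exists. Multiplying it on the right by C' shows that the
coefficient of eᵢ is a left denominator for the whole i-th row of C'. -/
theorem IsLeftRational.of_mul_eq_one {ι : Type*} [Fintype ι] [DecidableEq ι]
    {C C' : Matrix ι ι (PDO D)} (hC : ∀ i j, (C i j).IsLeftRational) (h : C * C' = 1) (i j : ι) :
    (C' i j).IsLeftRational := by
  choose b hb hb0 hbC using fun i =>
    exists_common_denominator Finset.univ (C i) fun j _ => hC i j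
  obtain ⟨X, h1, h2, h3⟩ := exists_row_mul_eq_zero (ι := Option ι) (κ := ι) (by simp)
    (fun o l => o.elim (if l = i then 1 else 0) fun r => b r * C r l) (by
      rintro (_ | r) l
      · change (if l = i then 1 else 0 : PDO D).IsDifferential
        split_ifs
        exacts [isDifferential_one, isDifferential_zero]
      · exact hbC r l (Finset.mem_univ _))
  simp only [Fintype.sum_option, Option.elim] at h3
  have key : ∀ l, X none * C' i l + X (some l) * b l = 0 := by
    intro l
    have hsum : ∑ s, (X none * (if s = i then 1 else 0) +
        ∑ r, X (some r) * (b r * C r s)) * C' s l = 0 :=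
      Finset.sum_eq_zero fun s _ => by rw [h3, zero_mul]
    have hone : ∀ r, ∑ s, C r s * C' s l = if r = l then 1 else 0 := fun r => by
      rw [← Matrix.mul_apply, h, Matrix.one_apply]
    simp only [add_mul, Finset.sum_add_distrib, Finset.sum_mul, mul_ite, mul_one, mul_zero,
      ite_mul, zero_mul, Finset.sum_ite_eq', Finset.mem_univ, if_true] at hsum
    rw [Finset.sum_comm] at hsum
    simpa only [mul_assoc, ← Finset.mul_sum, hone, mul_ite, mul_one, mul_zero, Finset.sum_ite_eq',
      Finset.sum_ite_eq, Finset.mem_univ, if_true] using hsum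
  -- If the coefficient of the unit row vanished, the relation would read X_l b_l = 0 for every l,
  -- and cancelling the nonzero b_l would make it trivial.
  refine ⟨X none, h1 none, fun h0 => h2 ?_, ?_⟩
  · funext o
    rcases o with _ | l
    · exact h0
    · have := key l
      rw [h0, zero_mul, zero_add] at this
      exact (mul_eq_zero.1 this).resolve_right (hb0 l)
  · rw [eq_neg_of_add_eq_zero_left (key j)]
    exact ((h1 _).mul (hb j)).neg

theorem IsRational.add {L L' : PDO D} (h : L.IsRational) (h' : L'.IsRational) :
    (L + L').IsRational := by
  rw [isRational_iff] at *
  rw [adjoint_add]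
  exact h.add h'

theorem IsRational.mul {L L' : PDO D} (h : L.IsRational) (h' : L'.IsRational) :
    (L * L').IsRational := by
  rw [isRational_iff] at *
  rw [adjoint_mul]
  exact h'.mul h

theorem IsDifferential.isRational {L : PDO D} (h : L.IsDifferential) : L.IsRational :=
  ⟨L, 1, h, isDifferential_one, fun h => by
    simpa [coeff_one] using congrArg (fun a : PDO D => a.coeff 0) h, mul_one L⟩

theorem IsRational.neg {L : PDO D} (h : L.IsRational) : (-L).IsRational := by
  rw [← neg_one_mul]
  exact isDifferential_one.neg.isRational.mul h

theorem IsRational.sum {ι : Type*} {s : Finset ι} {f : ι → PDO D}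
    (h : ∀ i ∈ s, (f i).IsRational) : (∑ i ∈ s, f i).IsRational :=
  Finset.sum_induction f IsRational (fun _ _ => IsRational.add)
    isDifferential_zero.isRational h

theorem IsRational.matrix_mul {ι κ σ : Type*} [Fintype κ] {M : Matrix ι κ (PDO D)}
    {N : Matrix κ σ (PDO D)} (hM : ∀ i j, (M i j).IsRational) (hN : ∀ i j, (N i j).IsRational)
    (i : ι) (j : σ) : ((M * N) i j).IsRational :=
  IsRational.sum fun l _ => (hM i l).mul (hN l j)

/-- A right fraction becomes a left one: from L B = A and an Ore relation X₀ B + X₁ A = 0 one gets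
(X₀ + X₁ L) B = 0, and B can be cancelled. -/
theorem IsRational.adjoint {L : PDO D} (h : L.IsRational) : L.adjoint.IsRational := by
  rw [isRational_iff, adjoint_adjoint]
  obtain ⟨A, B, hA, hB, hB0, hL⟩ := h
  obtain ⟨X, h1, h2, h3⟩ := exists_row_mul_eq_zero (ι := Fin 2) (κ := Fin 1) (by simp)
    (fun i _ => ![B, A] i) (fun i _ => by fin_cases i <;> assumption)
  have h := h3 0
  simp only [Fin.sum_univ_two, Matrix.cons_val_zero, Matrix.cons_val_one] at h
  have h' : (X 0 + X 1 * L) * B = 0 := by rw [add_mul, mul_assoc, hL, h]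
  have h'' := (mul_eq_zero.1 h').resolve_right hB0
  refine ⟨X 1, h1 1, fun h0 => h2 ?_, ?_⟩
  · rw [h0, zero_mul, add_zero] at h''
    funext i
    fin_cases i
    · exact h''
    · exact h0
  · rw [eq_neg_of_add_eq_zero_right h'']
    exact (h1 0).neg

theorem isRational_iff_isLeftRational {L : PDO D} : L.IsRational ↔ L.IsLeftRational :=
  ⟨fun h => by have := isRational_iff.1 h.adjoint; rwa [adjoint_adjoint] at this,
    fun h => by
      rw [← adjoint_adjoint L] at h
      have := (isRational_iff.2 h).adjoint
      rwa [adjoint_adjoint] at this⟩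

theorem IsRational.of_mul_eq_one {ι : Type*} [Fintype ι] [DecidableEq ι]
    {C C' : Matrix ι ι (PDO D)} (hC : ∀ i j, (C i j).IsRational) (h : C * C' = 1) (i j : ι) :
    (C' i j).IsRational :=
  isRational_iff_isLeftRational.2 (IsLeftRational.of_mul_eq_one
    (fun i j => isRational_iff_isLeftRational.1 (hC i j)) h i j)

end PDO

open scoped PDO

/-! ### Right multiplication on coefficient families. -/

section RightMultiplication

variable {F V : Type*} [Field F] [CommRing V] [Algebra F V] {D : Derivation F V V}

theorem exists_coeff_eq (D : Derivation F V V) {f : ℤ → V} (hf : f ∈ laurentCoeffs V) :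
    ∃ a : PDO D, f = a.coeff := ⟨⟨f, hf⟩, rfl⟩

theorem PDO.coeff_mem (a : PDO D) : a.coeff ∈ laurentCoeffs V := a.2

/-- Right multiplication by `L` on coefficient families. -/
def rmul (f : ℤ → V) (L : PDO D) (n : ℤ) : V := ∑ᶠ i : ℤ, f i * (PDO.dpow i * L).coeff n

theorem PDO.coeff_dpow_mul_of_lt {L : PDO D} {M : ℤ} (hL : L.OrdLE M) {i n : ℤ}
    (h : i + M < n) : (PDO.dpow i * L).coeff n = 0 := by
  have hi : (PDO.dpow i : PDO D).OrdLE i := fun j hj => if_neg hj.ne'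
  exact hi.mul hL n h

theorem rmul_eq_sum {f : ℤ → V} {N : ℤ} (hf : ∀ i, N < i → f i = 0) {L : PDO D} {M : ℤ}
    (hL : L.OrdLE M) (n : ℤ) :
    rmul f L n = ∑ i ∈ Finset.Icc (n - M) N, f i * (PDO.dpow i * L).coeff n := by
  refine finsum_eq_sum_of_support_subset _ fun i hi => ?_
  rw [Finset.coe_Icc, Set.mem_Icc]
  constructor
  · by_contra h
    exact hi (by simp only [PDO.coeff_dpow_mul_of_lt hL (show i + M < n by omega), mul_zero])
  · by_contra h
    exact hi (by simp only [hf i (by omega), zero_mul])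

theorem rmul_coeff (a L : PDO D) : rmul a.coeff L = (a * L).coeff := by
  obtain ⟨N, hN⟩ := a.exists_ordLE
  obtain ⟨M, hM⟩ := L.exists_ordLE
  funext n
  rw [rmul_eq_sum hN hM, PDO.mul_coeff_eq_sum_dpow a L hN hM]

theorem rmul_eq_zero {f : ℤ → V} {N : ℤ} (hf : ∀ i, N < i → f i = 0) {L : PDO D} {M : ℤ}
    (hL : L.OrdLE M) {n : ℤ} (hn : N + M < n) : rmul f L n = 0 := by
  rw [rmul_eq_sum hf hL, Finset.Icc_eq_empty (by omega), Finset.sum_empty]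

theorem rmul_mem {f : ℤ → V} (hf : f ∈ laurentCoeffs V) (L : PDO D) :
    rmul f L ∈ laurentCoeffs V := by
  obtain ⟨a, rfl⟩ := exists_coeff_eq D hf
  rw [rmul_coeff]; exact PDO.coeff_mem _

theorem rmul_add_left {f g : ℤ → V} (hf : f ∈ laurentCoeffs V) (hg : g ∈ laurentCoeffs V)
    (L : PDO D) : rmul (f + g) L = rmul f L + rmul g L := by
  obtain ⟨a, rfl⟩ := exists_coeff_eq D hf
  obtain ⟨b, rfl⟩ := exists_coeff_eq D hg
  rw [show a.coeff + b.coeff = (a + b).coeff from rfl, rmul_coeff, rmul_coeff, rmul_coeff,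
    add_mul]
  rfl

theorem rmul_add_right {f : ℤ → V} (hf : f ∈ laurentCoeffs V) (L L' : PDO D) :
    rmul f (L + L') = rmul f L + rmul f L' := by
  obtain ⟨a, rfl⟩ := exists_coeff_eq D hf
  rw [rmul_coeff, rmul_coeff, rmul_coeff, mul_add]
  rfl

theorem rmul_rmul {f : ℤ → V} (hf : f ∈ laurentCoeffs V) (L L' : PDO D) :
    rmul (rmul f L) L' = rmul f (L * L') := by
  obtain ⟨a, rfl⟩ := exists_coeff_eq D hf
  rw [rmul_coeff, rmul_coeff, rmul_coeff, mul_assoc]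

theorem rmul_one {f : ℤ → V} (hf : f ∈ laurentCoeffs V) : rmul f (1 : PDO D) = f := by
  obtain ⟨a, rfl⟩ := exists_coeff_eq D hf
  rw [rmul_coeff, mul_one]

theorem rmul_dpow {f : ℤ → V} (hf : f ∈ laurentCoeffs V) (m n : ℤ) :
    rmul f (PDO.dpow m : PDO D) n = f (n - m) := by
  obtain ⟨a, rfl⟩ := exists_coeff_eq D hf
  rw [rmul_coeff, PDO.coeff_mul_dpow]

theorem rmul_derivation {f : ℤ → V} (hf : f ∈ laurentCoeffs V) (L : PDO D) (n : ℤ) :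
    rmul (fun i => D (f i) + f (i - 1)) L n = D (rmul f L n) + rmul f L (n - 1) := by
  obtain ⟨a, rfl⟩ := exists_coeff_eq D hf
  rw [show (fun i => D (a.coeff i) + a.coeff (i - 1)) = (PDO.dmul a).coeff from rfl, rmul_coeff,
    rmul_coeff, PDO.dmul_mul, PDO.coeff_dmul]

/-- For a fixed output index only finitely many `b'` contribute, so the bounds in `a`, which may
depend on `b`, become uniform there. Both sides are then the same finite double sum. -/
theorem rmul_comm {f : ℤ → ℤ → V} {N : ℤ} (hN : ∀ a b, N < b → f a b = 0)
    (hf : ∀ b, ∃ B, ∀ a, B < a → f a b = 0) (L L' : PDO D) (a b : ℤ) :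
    rmul (fun a' => rmul (f a') L b) L' a =
      rmul (fun b' => rmul (fun a' => f a' b') L' a) L b := by
  obtain ⟨M, hM⟩ := L.exists_ordLE
  obtain ⟨M', hM'⟩ := L'.exists_ordLE
  choose g hg using hf
  obtain ⟨B, hB⟩ := ((Finset.Icc (b - M) N).image g).exists_le
  have hB' : ∀ b' ∈ Finset.Icc (b - M) N, ∀ a', B < a' → f a' b' = 0 := fun b' hb' a' ha' =>
    hg b' a' ((hB _ (Finset.mem_image_of_mem g hb')).trans_lt ha')
  have h1 : ∀ a', rmul (f a') L b =
      ∑ b' ∈ Finset.Icc (b - M) N, f a' b' * (PDO.dpow b' * L).coeff b :=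
    fun a' => rmul_eq_sum (hN a') hM b
  have h2 : ∀ a', B < a' → rmul (f a') L b = 0 := fun a' ha' => by
    rw [h1]
    exact Finset.sum_eq_zero fun b' hb' => by rw [hB' b' hb' a' ha', zero_mul]
  have h3 : ∀ b', N < b' → rmul (fun a' => f a' b') L' a = 0 := fun b' hb' =>
    (rmul_eq_sum (N := a - M' - 1) (fun a' _ => hN a' b' hb') hM' a).trans (by
      rw [Finset.Icc_eq_empty (by omega), Finset.sum_empty])
  rw [rmul_eq_sum h2 hM', rmul_eq_sum h3 hM]
  simp only [h1, Finset.sum_mul]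
  rw [Finset.sum_comm]
  refine Finset.sum_congr rfl fun b' hb' => ?_
  rw [rmul_eq_sum (hB' b' hb') hM', Finset.sum_mul]
  exact Finset.sum_congr rfl fun a' _ => mul_right_comm _ _ _

end RightMultiplication

/-! ### Families in three variables, slotwise composition and total derivatives. -/

section Wide

variable {F V : Type*} [Field F] [CommRing V] [Algebra F V]

/-- Three-variable families whose second and third indices are bounded above, and whose first
index is bounded above when the other two are fixed. -/
def IsWide (T : ℤ → ℤ → ℤ → V) : Prop :=
  (∃ N : ℤ, ∀ i j k, (N < j ∨ N < k) → T i j k = 0) ∧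
    ∀ j k, ∃ M : ℤ, ∀ i, M < i → T i j k = 0

theorem isWide_zero : IsWide (0 : ℤ → ℤ → ℤ → V) :=
  ⟨⟨0, fun _ _ _ _ => rfl⟩, fun _ _ => ⟨0, fun _ _ => rfl⟩⟩

theorem IsWide.add {S T : ℤ → ℤ → ℤ → V} (hS : IsWide S) (hT : IsWide T) : IsWide (S + T) := by
  obtain ⟨⟨N, hN⟩, hS⟩ := hS
  obtain ⟨⟨M, hM⟩, hT⟩ := hT
  refine ⟨⟨max N M, fun i j k h => ?_⟩, fun j k => ?_⟩
  · rw [Pi.add_apply, Pi.add_apply, Pi.add_apply, hN i j k (by omega), hM i j k (by omega),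
      add_zero]
  · obtain ⟨A, hA⟩ := hS j k
    obtain ⟨B, hB⟩ := hT j k
    exact ⟨max A B, fun i hi => by
      rw [Pi.add_apply, Pi.add_apply, Pi.add_apply, hA i (by omega), hB i (by omega), add_zero]⟩

theorem IsWide.neg {T : ℤ → ℤ → ℤ → V} (hT : IsWide T) : IsWide (-T) := by
  obtain ⟨⟨N, hN⟩, hT⟩ := hT
  refine ⟨⟨N, fun i j k h => ?_⟩, fun j k => ?_⟩
  · rw [Pi.neg_apply, Pi.neg_apply, Pi.neg_apply, hN i j k h, neg_zero]
  · obtain ⟨A, hA⟩ := hT j k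
    exact ⟨A, fun i hi => by rw [Pi.neg_apply, Pi.neg_apply, Pi.neg_apply, hA i hi, neg_zero]⟩

theorem IsWide.sub {S T : ℤ → ℤ → ℤ → V} (hS : IsWide S) (hT : IsWide T) : IsWide (S - T) :=
  sub_eq_add_neg S T ▸ hS.add hT.neg

theorem IsTripleSeries.isWide {T : ℤ → ℤ → ℤ → V} (hT : IsTripleSeries T) : IsWide T := by
  obtain ⟨N, hN⟩ := hT
  exact ⟨⟨N, fun i j k h => hN i j k (Or.inr h)⟩, fun j k => ⟨N, fun i hi => hN i j k (Or.inl hi)⟩⟩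

theorem isTripleSeries_zero : IsTripleSeries (0 : ℤ → ℤ → ℤ → V) := ⟨0, fun _ _ _ _ => rfl⟩

theorem IsTripleSeries.add {S T : ℤ → ℤ → ℤ → V} (hS : IsTripleSeries S)
    (hT : IsTripleSeries T) : IsTripleSeries (S + T) := by
  obtain ⟨N, hN⟩ := hS
  obtain ⟨M, hM⟩ := hT
  exact ⟨max N M, fun i j k h => by
    rw [Pi.add_apply, Pi.add_apply, Pi.add_apply, hN i j k (by omega), hM i j k (by omega),
      add_zero]⟩

theorem IsTripleSeries.neg {T : ℤ → ℤ → ℤ → V} (hT : IsTripleSeries T) :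
    IsTripleSeries (-T) := by
  obtain ⟨N, hN⟩ := hT
  exact ⟨N, fun i j k h => by rw [Pi.neg_apply, Pi.neg_apply, Pi.neg_apply, hN i j k h, neg_zero]⟩

theorem IsTripleSeries.sub {S T : ℤ → ℤ → ℤ → V} (hS : IsTripleSeries S)
    (hT : IsTripleSeries T) : IsTripleSeries (S - T) :=
  sub_eq_add_neg S T ▸ hS.add hT.neg

/-- Exchange of the first two variables. -/
def swap12 (T : ℤ → ℤ → ℤ → V) (i j k : ℤ) : V := T j i k

/-- Exchange of the last two variables. -/
def swap23 (T : ℤ → ℤ → ℤ → V) (i j k : ℤ) : V := T i k j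

/-- Cyclic permutation of the variables. -/
def rotate (T : ℤ → ℤ → ℤ → V) (i j k : ℤ) : V := T j k i

theorem IsWide.swap23 {T : ℤ → ℤ → ℤ → V} (hT : IsWide T) : IsWide (swap23 T) := by
  obtain ⟨⟨N, hN⟩, hT⟩ := hT
  exact ⟨⟨N, fun i j k h => hN i k j h.symm⟩, fun j k => hT k j⟩

theorem IsTripleSeries.swap12 {T : ℤ → ℤ → ℤ → V} (hT : IsTripleSeries T) :
    IsTripleSeries (swap12 T) := by
  obtain ⟨N, hN⟩ := hT
  exact ⟨N, fun i j k h => hN j i k (by tauto)⟩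

theorem IsTripleSeries.swap23 {T : ℤ → ℤ → ℤ → V} (hT : IsTripleSeries T) :
    IsTripleSeries (swap23 T) := by
  obtain ⟨N, hN⟩ := hT
  exact ⟨N, fun i j k h => hN i k j (by tauto)⟩

theorem IsTripleSeries.rotate {T : ℤ → ℤ → ℤ → V} (hT : IsTripleSeries T) :
    IsTripleSeries (rotate T) := by
  obtain ⟨N, hN⟩ := hT
  exact ⟨N, fun i j k h => hN j k i (by tauto)⟩

theorem IsWide.mem1 {T : ℤ → ℤ → ℤ → V} (hT : IsWide T) (j k : ℤ) :
    (fun i => T i j k) ∈ laurentCoeffs V := hT.2 j k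

theorem IsWide.mem2 {T : ℤ → ℤ → ℤ → V} (hT : IsWide T) (i k : ℤ) :
    (fun j => T i j k) ∈ laurentCoeffs V := by
  obtain ⟨⟨N, hN⟩, -⟩ := hT
  exact ⟨N, fun j hj => hN i j k (Or.inl hj)⟩

theorem IsWide.mem3 {T : ℤ → ℤ → ℤ → V} (hT : IsWide T) (i j : ℤ) :
    T i j ∈ laurentCoeffs V := by
  obtain ⟨⟨N, hN⟩, -⟩ := hT
  exact ⟨N, fun k hk => hN i j k (Or.inr hk)⟩

variable {D : Derivation F V V}

/-- Right composition with `L` in the first variable. -/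
def act1 (T : ℤ → ℤ → ℤ → V) (L : PDO D) (i j k : ℤ) : V := rmul (fun i' => T i' j k) L i

/-- Right composition with `L` in the second variable. -/
def act2 (T : ℤ → ℤ → ℤ → V) (L : PDO D) (i j k : ℤ) : V := rmul (fun j' => T i j' k) L j

/-- Right composition with `L` in the third variable. -/
def act3 (T : ℤ → ℤ → ℤ → V) (L : PDO D) (i j k : ℤ) : V := rmul (T i j) L k

theorem IsWide.act1 {T : ℤ → ℤ → ℤ → V} (hT : IsWide T) (L : PDO D) : IsWide (act1 T L) := by
  obtain ⟨N, hN⟩ := hT.1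
  refine ⟨⟨N, fun i j k h => ?_⟩, fun j k => rmul_mem (hT.mem1 j k) L⟩
  rw [DiracReduction.act1, show (fun i' => T i' j k) = (0 : PDO D).coeff from
    funext fun i' => hN i' j k h, rmul_coeff, zero_mul, PDO.coeff_zero]

/-- A coefficient of the result uses only a finite window of second indices, so the maximum of the
bounds on the first index over that window suffices. -/
theorem IsWide.act2 {T : ℤ → ℤ → ℤ → V} (hT : IsWide T) (L : PDO D) : IsWide (act2 T L) := by
  obtain ⟨N, hN⟩ := hT.1
  obtain ⟨M, hM⟩ := L.exists_ordLE
  have hN2 : ∀ i k j, N < j → T i j k = 0 := fun i k j hj => hN i j k (Or.inl hj)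
  refine ⟨⟨max N (N + M), fun i j k h => ?_⟩, fun j k => ?_⟩
  · rcases h with h | h
    · exact rmul_eq_zero (hN2 i k) hM (by omega)
    · rw [DiracReduction.act2, show (fun j' => T i j' k) = (0 : PDO D).coeff from
        funext fun j' => hN i j' k (Or.inr (by omega)), rmul_coeff, zero_mul, PDO.coeff_zero]
  · choose g hg using fun j' => hT.2 j' k
    obtain ⟨B, hB⟩ := ((Finset.Icc (j - M) N).image g).exists_le
    refine ⟨B, fun i hi => ?_⟩
    rw [DiracReduction.act2, rmul_eq_sum (hN2 i k) hM]
    exact Finset.sum_eq_zero fun j' hj' => by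
      rw [hg j' i ((hB _ (Finset.mem_image_of_mem g hj')).trans_lt hi), zero_mul]

theorem IsWide.act3 {T : ℤ → ℤ → ℤ → V} (hT : IsWide T) (L : PDO D) : IsWide (act3 T L) :=
  (hT.swap23.act2 L).swap23

theorem IsTripleSeries.act1 {T : ℤ → ℤ → ℤ → V} (hT : IsTripleSeries T) (L : PDO D) :
    IsTripleSeries (act1 T L) := by
  obtain ⟨N, hN⟩ := hT
  obtain ⟨M, hM⟩ := L.exists_ordLE
  refine ⟨max N (N + M), fun i j k h => ?_⟩
  rcases lt_or_ge (N + M) i with h' | h'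
  · exact rmul_eq_zero (fun i' hi' => hN i' j k (Or.inl hi')) hM h'
  · rw [DiracReduction.act1, show (fun i' => T i' j k) = (0 : PDO D).coeff from
      funext fun i' => hN i' j k (by omega), rmul_coeff, zero_mul, PDO.coeff_zero]

theorem IsTripleSeries.act2 {T : ℤ → ℤ → ℤ → V} (hT : IsTripleSeries T) (L : PDO D) :
    IsTripleSeries (act2 T L) := (hT.swap12.act1 L).swap12

theorem IsTripleSeries.act3 {T : ℤ → ℤ → ℤ → V} (hT : IsTripleSeries T) (L : PDO D) :
    IsTripleSeries (act3 T L) := (hT.swap23.act2 L).swap23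

theorem act1_add {S T : ℤ → ℤ → ℤ → V} (hS : IsWide S) (hT : IsWide T) (L : PDO D) :
    act1 (S + T) L = act1 S L + act1 T L := by
  funext i j k
  exact congrFun (rmul_add_left (hS.mem1 j k) (hT.mem1 j k) L) i

theorem act2_add {S T : ℤ → ℤ → ℤ → V} (hS : IsWide S) (hT : IsWide T) (L : PDO D) :
    act2 (S + T) L = act2 S L + act2 T L := by
  funext i j k
  exact congrFun (rmul_add_left (hS.mem2 i k) (hT.mem2 i k) L) j

theorem act3_add {S T : ℤ → ℤ → ℤ → V} (hS : IsWide S) (hT : IsWide T) (L : PDO D) :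
    act3 (S + T) L = act3 S L + act3 T L := by
  funext i j k
  exact congrFun (rmul_add_left (hS.mem3 i j) (hT.mem3 i j) L) k

theorem act1_add_right {T : ℤ → ℤ → ℤ → V} (hT : IsWide T) (L L' : PDO D) :
    act1 T (L + L') = act1 T L + act1 T L' := by
  funext i j k
  exact congrFun (rmul_add_right (hT.mem1 j k) L L') i

theorem act2_add_right {T : ℤ → ℤ → ℤ → V} (hT : IsWide T) (L L' : PDO D) :
    act2 T (L + L') = act2 T L + act2 T L' := by
  funext i j k
  exact congrFun (rmul_add_right (hT.mem2 i k) L L') j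

theorem act3_add_right {T : ℤ → ℤ → ℤ → V} (hT : IsWide T) (L L' : PDO D) :
    act3 T (L + L') = act3 T L + act3 T L' := by
  funext i j k
  exact congrFun (rmul_add_right (hT.mem3 i j) L L') k

theorem act1_act1 {T : ℤ → ℤ → ℤ → V} (hT : IsWide T) (L L' : PDO D) :
    act1 (act1 T L) L' = act1 T (L * L') := by
  funext i j k
  exact congrFun (rmul_rmul (hT.mem1 j k) L L') i

theorem act2_act2 {T : ℤ → ℤ → ℤ → V} (hT : IsWide T) (L L' : PDO D) :
    act2 (act2 T L) L' = act2 T (L * L') := by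
  funext i j k
  exact congrFun (rmul_rmul (hT.mem2 i k) L L') j

theorem act3_act3 {T : ℤ → ℤ → ℤ → V} (hT : IsWide T) (L L' : PDO D) :
    act3 (act3 T L) L' = act3 T (L * L') := by
  funext i j k
  exact congrFun (rmul_rmul (hT.mem3 i j) L L') k

theorem act2_one {T : ℤ → ℤ → ℤ → V} (hT : IsWide T) : act2 T (1 : PDO D) = T := by
  funext i j k
  exact congrFun (rmul_one (hT.mem2 i k)) j

theorem act3_one {T : ℤ → ℤ → ℤ → V} (hT : IsWide T) : act3 T (1 : PDO D) = T := by
  funext i j k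
  exact congrFun (rmul_one (hT.mem3 i j)) k

theorem act1_act2 {T : ℤ → ℤ → ℤ → V} (hT : IsWide T) (L L' : PDO D) :
    act1 (act2 T L) L' = act2 (act1 T L') L := by
  obtain ⟨N, hN⟩ := hT.1
  funext i j k
  exact rmul_comm (f := fun a b => T a b k) (fun a b h => hN a b k (Or.inl h))
    (fun b => hT.2 b k) L L' i j

theorem act1_act3 {T : ℤ → ℤ → ℤ → V} (hT : IsWide T) (L L' : PDO D) :
    act1 (act3 T L) L' = act3 (act1 T L') L := by
  obtain ⟨N, hN⟩ := hT.1
  funext i j k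
  exact rmul_comm (f := fun a b => T a j b) (fun a b h => hN a j b (Or.inr h))
    (fun b => hT.2 j b) L L' i k

theorem act2_act3 {T : ℤ → ℤ → ℤ → V} (hT : IsWide T) (L L' : PDO D) :
    act2 (act3 T L) L' = act3 (act2 T L') L := by
  obtain ⟨N, hN⟩ := hT.1
  funext i j k
  exact rmul_comm (f := fun a b => T i a b) (fun a b h => hN i a b (Or.inr h))
    (fun b => ⟨N, fun a h => hN i a b (Or.inl h)⟩) L L' j k

variable (D)

/-- The total derivative `∂ + λ₁ + λ₂ + λ₃`. -/
def total (W : ℤ → ℤ → ℤ → V) (i j k : ℤ) : V :=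
  D (W i j k) + W (i - 1) j k + W i (j - 1) k + W i j (k - 1)

theorem total_add (S T : ℤ → ℤ → ℤ → V) : total D (S + T) = total D S + total D T := by
  funext i j k
  simp only [total, Pi.add_apply, map_add]
  abel

theorem total_neg (T : ℤ → ℤ → ℤ → V) : total D (-T) = -total D T := by
  funext i j k
  simp only [total, Pi.neg_apply, map_neg]
  abel

theorem swap23_total (T : ℤ → ℤ → ℤ → V) : swap23 (total D T) = total D (swap23 T) := by
  funext i j k
  simp only [total, swap23]
  abel

theorem IsWide.shift3 {T : ℤ → ℤ → ℤ → V} (hT : IsWide T) : IsWide fun i j k => T i j (k - 1) := by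
  obtain ⟨⟨N, hN⟩, hT⟩ := hT
  exact ⟨⟨N + 1, fun i j k h => hN _ _ _ (by omega)⟩, fun j k => hT j (k - 1)⟩

theorem IsWide.shift2 {T : ℤ → ℤ → ℤ → V} (hT : IsWide T) : IsWide fun i j k => T i (j - 1) k :=
  hT.swap23.shift3.swap23

theorem IsWide.shift1 {T : ℤ → ℤ → ℤ → V} (hT : IsWide T) : IsWide fun i j k => T (i - 1) j k := by
  obtain ⟨⟨N, hN⟩, hT⟩ := hT
  refine ⟨⟨N, fun i j k h => hN _ _ _ h⟩, fun j k => ?_⟩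
  obtain ⟨M, hM⟩ := hT j k
  exact ⟨M + 1, fun i hi => hM _ (by omega)⟩

theorem IsWide.map {W G : Type*} [CommRing W] [FunLike G V W] [AddMonoidHomClass G V W] (φ : G)
    {T : ℤ → ℤ → ℤ → V} (hT : IsWide T) : IsWide fun i j k => φ (T i j k) := by
  obtain ⟨⟨N, hN⟩, hT⟩ := hT
  refine ⟨⟨N, fun i j k h => (congrArg φ (hN _ _ _ h)).trans (map_zero φ)⟩, fun j k => ?_⟩
  obtain ⟨M, hM⟩ := hT j k
  exact ⟨M, fun i hi => (congrArg φ (hM _ hi)).trans (map_zero φ)⟩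

theorem IsWide.total {T : ℤ → ℤ → ℤ → V} (hT : IsWide T) : IsWide (total D T) :=
  (((hT.map D).add hT.shift1).add hT.shift2).add hT.shift3

variable {D}

/-- In the acted variable, D plus the shift is left composition with ∂, which commutes with right
composition; the other two shifts do not touch this variable. Hence slotwise composition descends to
the quotient by total derivatives. -/
theorem act1_total {T : ℤ → ℤ → ℤ → V} (hT : IsWide T) (L : PDO D) :
    act1 (total D T) L = total D (act1 T L) := by
  funext i j k
  have h1 := hT.mem1 j k
  have h2 : (fun i => D (T i j k) + T (i - 1) j k) ∈ laurentCoeffs V :=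
    ((hT.map D).add hT.shift1).mem1 j k
  have h3 := hT.mem1 (j - 1) k
  have h4 := hT.mem1 j (k - 1)
  change rmul ((fun i => D (T i j k) + T (i - 1) j k) + (fun i => T i (j - 1) k) +
    (fun i => T i j (k - 1))) L i = _
  rw [rmul_add_left (add_mem h2 h3) h4, rmul_add_left h2 h3, Pi.add_apply, Pi.add_apply,
    rmul_derivation h1]
  rfl

theorem act2_total {T : ℤ → ℤ → ℤ → V} (hT : IsWide T) (L : PDO D) :
    act2 (total D T) L = total D (act2 T L) := by
  funext i j k
  have h1 := hT.mem2 i k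
  have h2 : (fun j => D (T i j k) + T i (j - 1) k) ∈ laurentCoeffs V :=
    ((hT.map D).add hT.shift2).mem2 i k
  have h3 := hT.mem2 (i - 1) k
  have h4 := hT.mem2 i (k - 1)
  have key : (fun j' => total D T i j' k) = (fun j => D (T i j k) + T i (j - 1) k) +
      (fun j => T (i - 1) j k) + (fun j => T i j (k - 1)) := by
    funext j'; simp only [total, Pi.add_apply]; abel
  rw [act2, key, rmul_add_left (add_mem h2 h3) h4, rmul_add_left h2 h3, Pi.add_apply, Pi.add_apply,
    rmul_derivation h1]
  simp only [total, act2]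
  abel

theorem act3_total {T : ℤ → ℤ → ℤ → V} (hT : IsWide T) (L : PDO D) :
    act3 (total D T) L = total D (act3 T L) := by
  change swap23 (act2 (swap23 (total D T)) L) = _
  rw [swap23_total, act2_total hT.swap23, swap23_total]
  rfl

variable (D)

/-- Wide families which are total derivatives of wide families. -/
def IsNull (T : ℤ → ℤ → ℤ → V) : Prop := ∃ W, IsWide W ∧ T = total D W

variable {D}

theorem IsNull.isWide {T : ℤ → ℤ → ℤ → V} (hT : IsNull D T) : IsWide T := by
  obtain ⟨W, hW, rfl⟩ := hT; exact hW.total D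

theorem isNull_zero : IsNull D (0 : ℤ → ℤ → ℤ → V) :=
  ⟨0, isWide_zero, by funext i j k; simp [total]⟩

theorem IsNull.add {S T : ℤ → ℤ → ℤ → V} (hS : IsNull D S) (hT : IsNull D T) :
    IsNull D (S + T) := by
  obtain ⟨W, hW, rfl⟩ := hS
  obtain ⟨W', hW', rfl⟩ := hT
  exact ⟨_, hW.add hW', (total_add D W W').symm⟩

theorem IsNull.neg {T : ℤ → ℤ → ℤ → V} (hT : IsNull D T) : IsNull D (-T) := by
  obtain ⟨W, hW, rfl⟩ := hT
  exact ⟨_, hW.neg, (total_neg D W).symm⟩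

theorem IsNull.act1 {T : ℤ → ℤ → ℤ → V} (hT : IsNull D T) (L : PDO D) : IsNull D (act1 T L) := by
  obtain ⟨W, hW, rfl⟩ := hT
  exact ⟨_, hW.act1 L, act1_total hW L⟩

theorem IsNull.act2 {T : ℤ → ℤ → ℤ → V} (hT : IsNull D T) (L : PDO D) : IsNull D (act2 T L) := by
  obtain ⟨W, hW, rfl⟩ := hT
  exact ⟨_, hW.act2 L, act2_total hW L⟩

theorem IsNull.act3 {T : ℤ → ℤ → ℤ → V} (hT : IsNull D T) (L : PDO D) : IsNull D (act3 T L) := by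
  obtain ⟨W, hW, rfl⟩ := hT
  exact ⟨_, hW.act3 L, act3_total hW L⟩

theorem IsNull.swap23 {T : ℤ → ℤ → ℤ → V} (hT : IsNull D T) : IsNull D (swap23 T) := by
  obtain ⟨W, hW, rfl⟩ := hT
  exact ⟨_, hW.swap23, swap23_total D W⟩

end Wide

/-! ### Expansion of ν = λ + μ as divisibility by ν − λ − μ. -/

section Expansion

variable {V : Type*} [CommRing V]

/-- The coefficient of `λⁱ μʲ` in `(λ+μ)ᵉ X_k(λ, μ)`, expanded for large `μ`, where `X_k` is the
coefficient of `νᵏ` in `X`. -/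
def sumPow (X : ℤ → ℤ → ℤ → V) (k e i j : ℤ) : V :=
  ∑ᶠ l : ℕ, Ring.choose e l • X (i - l) (j - e + l) k

theorem sumPow_eq_sum {X : ℤ → ℤ → ℤ → V} {N : ℤ} (hN : ∀ i j k, (N < j ∨ N < k) → X i j k = 0)
    (k e i j : ℤ) {K : ℕ} (hK : N + e < j + K) :
    sumPow X k e i j = ∑ l ∈ Finset.range K, Ring.choose e l • X (i - l) (j - e + l) k := by
  refine finsum_eq_sum_of_support_subset _ fun l hl => ?_
  rw [Finset.coe_range, Set.mem_Iio]
  by_contra h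
  exact hl (by simp only [hN (i - l) (j - e + l) k (by omega), smul_zero])

theorem sumPow_eq_zero {X : ℤ → ℤ → ℤ → V} {N : ℤ}
    (hN : ∀ i j k, (N < j ∨ N < k) → X i j k = 0) {k e i j : ℤ} (h : N + e < j ∨ N < k) :
    sumPow X k e i j = 0 := by
  refine (finsum_congr fun l => ?_).trans finsum_zero
  rw [hN _ _ _ (by omega), smul_zero]

theorem sumPow_zero (X : ℤ → ℤ → ℤ → V) (k i j : ℤ) : sumPow X k 0 i j = X i j k := by
  rw [sumPow, finsum_eq_single _ 0]
  · simp
  · intro l hl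
    obtain ⟨l, rfl⟩ := Nat.exists_eq_succ_of_ne_zero hl
    simp [Ring.choose_zero_succ]

theorem sumPow_succ {X : ℤ → ℤ → ℤ → V} (hX : IsWide X) (k e i j : ℤ) :
    sumPow X k (e + 1) i j = sumPow X k e (i - 1) j + sumPow X k e i (j - 1) := by
  obtain ⟨N, hN⟩ := hX.1
  set K := (N + e - j).toNat + 2
  rw [sumPow_eq_sum hN k (e + 1) i j (K := K + 1) (by omega),
    sumPow_eq_sum hN k e (i - 1) j (K := K) (by omega),
    sumPow_eq_sum hN k e i (j - 1) (K := K + 1) (by omega), Finset.sum_range_succ',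
    Finset.sum_range_succ' _ K, ← add_assoc, ← Finset.sum_add_distrib]
  congr 1
  · refine Finset.sum_congr rfl fun l _ => ?_
    rw [Ring.choose_succ_succ, add_smul, show i - ((l + 1 : ℕ) : ℤ) = i - 1 - l by push_cast; ring,
      show j - (e + 1) + ((l + 1 : ℕ) : ℤ) = j - e + l by push_cast; ring,
      show j - 1 - e + ((l + 1 : ℕ) : ℤ) = j - e + l by push_cast; ring]
  · rw [Ring.choose_zero_right, Ring.choose_zero_right, show j - (e + 1) = j - 1 - e by ring]

/-- Only powers of ν between b − N and N contribute. The lower limit is left free so that several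
such sums can be put on one range. -/
theorem expandMuLam_eq_sum {X : ℤ → ℤ → ℤ → V} {N : ℤ}
    (hN : ∀ i j k, (N < j ∨ N < k) → X i j k = 0) (a b : ℤ) {L : ℤ} (hL : L ≤ b - N) :
    expandMuLam X a b = ∑ k ∈ Finset.Icc L N, sumPow X k k a b := by
  set K := (2 * N - b).toNat + 1
  have hs : ∀ k ∈ Finset.Icc L N, sumPow X k k a b =
      ∑ l ∈ Finset.range K, Ring.choose k l • X (a - l) (b - k + l) k := fun k hk => by
    rw [Finset.mem_Icc] at hk
    exact sumPow_eq_sum hN k k a b (by omega)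
  rw [Finset.sum_congr rfl hs, Finset.sum_comm, ← Finset.sum_product (s := Finset.range K)
    (t := Finset.Icc L N) (f := fun q => Ring.choose q.2 q.1 • X (a - q.1) (b - q.2 + q.1) q.2)]
  refine finsum_eq_sum_of_support_subset _ fun q hq => ?_
  have h : ¬ (N < b - q.2 + q.1 ∨ N < q.2) := fun h => hq (by simp only [hN _ _ _ h, smul_zero])
  simp only [Finset.coe_product, Set.mem_prod, Finset.mem_coe, Finset.mem_range, Finset.mem_Icc]
  omega

/-- Extension of a two-variable family by the exponent `0` in the third variable. -/
def ofTwo (P : ℤ → ℤ → V) (i j k : ℤ) : V := if k = 0 then P i j else 0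

/-- Multiplication by `ν - λ - μ`. -/
def relation (W : ℤ → ℤ → ℤ → V) (i j k : ℤ) : V := W i j (k - 1) - W (i - 1) j k - W i (j - 1) k

/-- The division of `X - X|_{ν=λ+μ}` by `ν - λ - μ`. -/
def quotientSeries (X : ℤ → ℤ → ℤ → V) (N i j k : ℤ) : V :=
  if k < 0 then -∑ k' ∈ Finset.Icc (j + k + 1 - N) k, sumPow X k' (k' - k - 1) i j
  else ∑ k' ∈ Finset.Ioc k N, sumPow X k' (k' - k - 1) i j

theorem quotientSeries_of_neg {X : ℤ → ℤ → ℤ → V} {N : ℤ}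
    (hN : ∀ i j k, (N < j ∨ N < k) → X i j k = 0) {i j k : ℤ} (hk : k < 0) {L : ℤ}
    (hL : L ≤ j + k + 1 - N) :
    quotientSeries X N i j k = -∑ k' ∈ Finset.Icc L k, sumPow X k' (k' - k - 1) i j := by
  rw [quotientSeries, if_pos hk]
  congr 1
  refine Finset.sum_subset (Finset.Icc_subset_Icc_left hL) fun k' h1 h2 => ?_
  rw [Finset.mem_Icc] at h1 h2
  exact sumPow_eq_zero hN (by omega)

theorem quotientSeries_of_nonneg {X : ℤ → ℤ → ℤ → V} {N i j k : ℤ} (hk : 0 ≤ k) :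
    quotientSeries X N i j k = ∑ k' ∈ Finset.Ioc k N, sumPow X k' (k' - k - 1) i j :=
  if_neg (by omega)

theorem IsWide.exists_sumPow_eq_zero {X : ℤ → ℤ → ℤ → V} (hX : IsWide X) (k e j : ℤ) :
    ∃ B, ∀ i, B < i → sumPow X k e i j = 0 := by
  obtain ⟨N, hN⟩ := hX.1
  set K := (N + e - j).toNat + 1
  choose g hg using fun j' => hX.2 j' k
  obtain ⟨B, hB⟩ := ((Finset.range K).image fun l : ℕ => g (j - e + l)).exists_le
  refine ⟨B + K, fun i hi => ?_⟩
  rw [sumPow_eq_sum hN k e i j (K := K) (by omega)]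
  refine Finset.sum_eq_zero fun l hl => ?_
  have := hB _ (Finset.mem_image_of_mem _ hl)
  rw [Finset.mem_range] at hl
  rw [hg _ _ (by omega), smul_zero]

/-- Expanding powers of λ + μ for large μ produces arbitrarily high powers of λ, so the quotient is
not bounded uniformly in the first index. This is why wide families are needed besides triple
series. -/
theorem IsWide.quotientSeries {X : ℤ → ℤ → ℤ → V} (hX : IsWide X) {N : ℤ} (h0 : 0 ≤ N)
    (hN : ∀ i j k, (N < j ∨ N < k) → X i j k = 0) : IsWide (quotientSeries X N) := by
  refine ⟨⟨2 * N, fun i j k h => ?_⟩, fun j k => ?_⟩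
  · rcases lt_or_ge k 0 with hk | hk
    · rw [quotientSeries_of_neg hN hk le_rfl, Finset.Icc_eq_empty (by omega), Finset.sum_empty,
        neg_zero]
    · rw [quotientSeries_of_nonneg hk]
      refine Finset.sum_eq_zero fun k' hk' => ?_
      rw [Finset.mem_Ioc] at hk'
      exact sumPow_eq_zero hN (by omega)
  · choose g hg using fun k' => hX.exists_sumPow_eq_zero k' (k' - k - 1) j
    obtain ⟨B, hB⟩ := ((Finset.Icc (j + k + 1 - N) k ∪ Finset.Ioc k N).image g).exists_le
    refine ⟨B, fun i hi => ?_⟩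
    have hz : ∀ k' ∈ Finset.Icc (j + k + 1 - N) k ∪ Finset.Ioc k N,
        sumPow X k' (k' - k - 1) i j = 0 := fun k' hk' =>
      hg k' i ((hB _ (Finset.mem_image_of_mem g hk')).trans_lt hi)
    rw [DiracReduction.quotientSeries]
    split_ifs
    · rw [Finset.sum_eq_zero fun k' hk' => hz k' (Finset.mem_union_left _ hk'), neg_zero]
    · exact Finset.sum_eq_zero fun k' hk' => hz k' (Finset.mem_union_right _ hk')

/-- The geometric sum for (νᵏ − (λ+μ)ᵏ)/(ν − λ − μ), applied to each power of ν: nonnegative powers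
of ν in the quotient come from the positive powers in X, negative ones from the negative powers. -/
theorem relation_quotientSeries {X : ℤ → ℤ → ℤ → V} (hX : IsWide X) {N : ℤ} (h0 : 0 ≤ N)
    (hN : ∀ i j k, (N < j ∨ N < k) → X i j k = 0) :
    relation (quotientSeries X N) = X - ofTwo (expandMuLam X) := by
  funext i j k
  -- A single lower limit valid for the three quotient coefficients and for the expansion at once.
  set L : ℤ := min (j + k - N) (-1) - |k| with hL
  have hL1 : L ≤ j + k - N := by have := abs_nonneg k; omega
  have hL2 : L ≤ -1 := by have := abs_nonneg k; omega
  have hL3 : L ≤ k - 1 := by have := neg_abs_le k; omega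
  have hp : ∀ k', sumPow X k' (k' - k - 1) (i - 1) j + sumPow X k' (k' - k - 1) i (j - 1) =
      sumPow X k' (k' - k) i j := fun k' => by
    rw [← sumPow_succ hX]; congr 1; ring
  change quotientSeries X N i j (k - 1) - quotientSeries X N (i - 1) j k -
    quotientSeries X N i (j - 1) k = X i j k - ofTwo (expandMuLam X) i j k
  -- Away from k = 0 the two sums differ by the term k' = k, which is the coefficient of X. At k = 0
  -- the negative and the positive half meet and form the whole expansion except its term k' = 0.
  rcases lt_trichotomy k 0 with hk | hk | hk
  · rw [quotientSeries_of_neg hN (show k - 1 < 0 by omega) (L := L) (by omega),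
      quotientSeries_of_neg hN hk (L := L) (by omega),
      quotientSeries_of_neg hN hk (L := L) (by omega), ofTwo, if_neg hk.ne, sub_zero,
      sub_sub, ← neg_add, ← Finset.sum_add_distrib]
    simp only [hp]
    rw [sub_neg_eq_add, neg_add_eq_sub, sub_eq_iff_eq_add,
      ← Finset.insert_Icc_sub_one_right_eq_Icc (show L ≤ k by omega),
      Finset.sum_insert (by simp), sub_self, sumPow_zero]
    congr 1
    exact Finset.sum_congr rfl fun k' _ => by congr 1; ring
  · subst hk
    rw [quotientSeries_of_neg hN (show (0 : ℤ) - 1 < 0 by omega) (L := L) (by omega),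
      quotientSeries_of_nonneg le_rfl, quotientSeries_of_nonneg le_rfl, sub_sub,
      ← Finset.sum_add_distrib, ofTwo, if_pos rfl,
      expandMuLam_eq_sum hN i j (L := L) (by omega)]
    simp only [hp]
    have hu : Finset.Icc L N = insert 0 (Finset.Icc L (0 - 1) ∪ Finset.Ioc 0 N) := by
      ext x; simp only [Finset.mem_insert, Finset.mem_union, Finset.mem_Icc, Finset.mem_Ioc]; omega
    rw [hu, Finset.sum_insert (by simp), Finset.sum_union, sumPow_zero]
    · simp only [sub_zero, show ∀ x : ℤ, x - (0 - 1) - 1 = x from fun x => by ring]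
      abel
    · rw [Finset.disjoint_left]
      intro x h1 h2
      rw [Finset.mem_Icc] at h1
      rw [Finset.mem_Ioc] at h2
      omega
  · rw [quotientSeries_of_nonneg (show 0 ≤ k - 1 by omega), quotientSeries_of_nonneg hk.le,
      quotientSeries_of_nonneg hk.le, sub_sub, ← Finset.sum_add_distrib, ofTwo, if_neg hk.ne',
      sub_zero]
    simp only [hp]
    by_cases hkN : k ≤ N
    · have hu : Finset.Ioc (k - 1) N = insert k (Finset.Ioc k N) := by
        ext x; simp only [Finset.mem_insert, Finset.mem_Ioc]; omega
      rw [hu, Finset.sum_insert (by simp), show k - (k - 1) - 1 = 0 by ring, sumPow_zero,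
        add_sub_assoc, add_eq_left, sub_eq_zero]
      exact Finset.sum_congr rfl fun k' _ => by congr 1; ring
    · rw [Finset.Ioc_eq_empty (by omega), Finset.Ioc_eq_empty (by omega), Finset.sum_empty,
        Finset.sum_empty, hN _ _ _ (by omega), sub_zero]

theorem sumPow_add {X Y : ℤ → ℤ → ℤ → V} (hX : IsWide X) (hY : IsWide Y) (k e i j : ℤ) :
    sumPow (X + Y) k e i j = sumPow X k e i j + sumPow Y k e i j := by
  obtain ⟨N, hN⟩ := hX.1
  obtain ⟨M, hM⟩ := hY.1
  obtain ⟨R, hR⟩ := (hX.add hY).1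
  set K := (N + e - j).toNat + (M + e - j).toNat + (R + e - j).toNat + 1
  rw [sumPow_eq_sum hN k e i j (K := K) (by omega), sumPow_eq_sum hM k e i j (K := K) (by omega),
    sumPow_eq_sum hR k e i j (K := K) (by omega), ← Finset.sum_add_distrib]
  exact Finset.sum_congr rfl fun l _ => smul_add _ _ _

theorem sumPow_neg (X : ℤ → ℤ → ℤ → V) (k e i j : ℤ) :
    sumPow (-X) k e i j = -sumPow X k e i j := by
  rw [sumPow, sumPow, ← finsum_neg_distrib]
  exact finsum_congr fun l => smul_neg _ _

theorem IsWide.sumBound {X Y : ℤ → ℤ → ℤ → V} {N M : ℤ}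
    (hN : ∀ i j k, (N < j ∨ N < k) → X i j k = 0)
    (hM : ∀ i j k, (M < j ∨ M < k) → Y i j k = 0) (i j k : ℤ)
    (h : max N M < j ∨ max N M < k) : (X + Y) i j k = 0 := by
  rw [Pi.add_apply, Pi.add_apply, Pi.add_apply, hN i j k (by omega), hM i j k (by omega), add_zero]

theorem expandMuLam_add {X Y : ℤ → ℤ → ℤ → V} (hX : IsWide X) (hY : IsWide Y) (a b : ℤ) :
    expandMuLam (X + Y) a b = expandMuLam X a b + expandMuLam Y a b := by
  obtain ⟨N, hN⟩ := hX.1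
  obtain ⟨M, hM⟩ := hY.1
  have h1 : ∀ i j k, (max N M < j ∨ max N M < k) → X i j k = 0 := fun i j k h =>
    hN i j k (by omega)
  have h2 : ∀ i j k, (max N M < j ∨ max N M < k) → Y i j k = 0 := fun i j k h =>
    hM i j k (by omega)
  rw [expandMuLam_eq_sum (IsWide.sumBound hN hM) a b le_rfl, expandMuLam_eq_sum h1 a b le_rfl,
    expandMuLam_eq_sum h2 a b le_rfl, ← Finset.sum_add_distrib]
  exact Finset.sum_congr rfl fun k _ => sumPow_add hX hY _ _ _ _

theorem expandMuLam_ofTwo (P : ℤ → ℤ → V) (a b : ℤ) : expandMuLam (ofTwo P) a b = P a b := by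
  rw [expandMuLam, finsum_eq_single _ (0, 0)]
  · simp [ofTwo]
  · rintro ⟨l, k⟩ h
    by_cases hk : k = 0
    · subst hk
      obtain ⟨l, rfl⟩ := Nat.exists_eq_succ_of_ne_zero (n := l) (by rintro rfl; exact h rfl)
      simp [Ring.choose_zero_succ]
    · simp [ofTwo, hk]

theorem IsWide.relation {W : ℤ → ℤ → ℤ → V} (hW : IsWide W) : IsWide (relation W) :=
  (hW.shift3.sub hW.shift1).sub hW.shift2

theorem sum_Icc_int_telescope (g : ℤ → V) (L : ℤ) (n : ℕ) :
    ∑ k ∈ Finset.Icc L (L + n), (g (k - 1) - g k) = g (L - 1) - g (L + n) := by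
  induction n with
  | zero => simp
  | succ n ih =>
    rw [← Finset.insert_Icc_sub_one_right_eq_Icc (show L ≤ L + (n + 1 : ℕ) by omega),
      Finset.sum_insert (by simp),
      show L + ((n + 1 : ℕ) : ℤ) - 1 = L + n by push_cast; ring, ih]
    abel

theorem sumPow_relation {W : ℤ → ℤ → ℤ → V} (hW : IsWide W) (k e i j : ℤ) :
    sumPow (relation W) k e i j = sumPow W (k - 1) e i j - sumPow W k (e + 1) i j := by
  have h : relation W = (fun i j k => W i j (k - 1)) + -(fun i j k => W (i - 1) j k) +
      -(fun i j k => W i (j - 1) k) := by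
    funext i j k
    simp only [relation, Pi.add_apply, Pi.neg_apply]
    abel
  rw [h, sumPow_add (hW.shift3.add hW.shift1.neg) hW.shift2.neg,
    sumPow_add hW.shift3 hW.shift1.neg, sumPow_neg, sumPow_neg, sumPow_succ hW]
  have h1 : sumPow (fun i j k => W i j (k - 1)) k e i j = sumPow W (k - 1) e i j := rfl
  have h2 : sumPow (fun i j k => W (i - 1) j k) k e i j = sumPow W k e (i - 1) j :=
    finsum_congr fun l => by simp only [show i - (l : ℤ) - 1 = i - 1 - l by ring]
  have h3 : sumPow (fun i j k => W i (j - 1) k) k e i j = sumPow W k e i (j - 1) :=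
    finsum_congr fun l => by simp only [show j - e + (l : ℤ) - 1 = j - 1 - e + l by ring]
  rw [h1, h2, h3]
  abel

/-- The contribution of each power of ν is a difference of consecutive values of k ↦ (λ+μ)ᵏ⁺¹ W_k,
so the sum telescopes. -/
theorem expandMuLam_relation {W : ℤ → ℤ → ℤ → V} (hW : IsWide W) (a b : ℤ) :
    expandMuLam (relation W) a b = 0 := by
  obtain ⟨N, hN⟩ := hW.1
  obtain ⟨M, hM⟩ := hW.relation.1
  -- The range is taken wide enough for both boundary terms of the telescoping sum to vanish.
  set N' := max N M + |b| + 1 with hN'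
  have hb : b ≤ |b| := le_abs_self b
  have hM' : ∀ i j k, (N' < j ∨ N' < k) → relation W i j k = 0 := fun i j k h =>
    hM i j k (by have := abs_nonneg b; omega)
  set L := min (b - N') (min N' (b - N - 1)) with hL
  rw [expandMuLam_eq_sum hM' a b (L := L) (by omega)]
  have hs : ∀ k ∈ Finset.Icc L N', sumPow (relation W) k k a b =
      (fun k => sumPow W k (k + 1) a b) (k - 1) - (fun k => sumPow W k (k + 1) a b) k :=
    fun k _ => by simp only [sumPow_relation hW, sub_add_cancel]
  have ht := sum_Icc_int_telescope (fun k => sumPow W k (k + 1) a b) L (N' - L).toNat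
  rw [show L + ((N' - L).toNat : ℤ) = N' by omega] at ht
  rw [Finset.sum_congr rfl hs, ht]
  rw [sumPow_eq_zero hN (by omega),
    sumPow_eq_zero hN (by have := abs_nonneg b; omega), sub_zero]

/-- `X` expands to `P` exactly when they differ by a multiple of `ν - λ - μ`. -/
theorem expandMuLam_eq_iff {X : ℤ → ℤ → ℤ → V} (hX : IsWide X) (P : ℤ → ℤ → V) :
    (∀ a b, expandMuLam X a b = P a b) ↔ ∃ W, IsWide W ∧ X - ofTwo P = relation W := by
  constructor
  · intro h
    obtain ⟨N, hN⟩ := hX.1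
    have hN' : ∀ i j k, (max N 0 < j ∨ max N 0 < k) → X i j k = 0 := fun i j k h =>
      hN i j k (by omega)
    obtain rfl : expandMuLam X = P := funext fun a => funext fun b => h a b
    exact ⟨_, hX.quotientSeries (le_max_right N 0) hN',
      (relation_quotientSeries hX (le_max_right N 0) hN').symm⟩
  · rintro ⟨W, hW, h⟩ a b
    rw [sub_eq_iff_eq_add] at h
    have hP : IsWide (ofTwo P) := by
      rw [← sub_eq_iff_eq_add'.2 h]
      exact hX.sub hW.relation
    rw [h, expandMuLam_add hW.relation hP, expandMuLam_relation hW, expandMuLam_ofTwo, zero_add]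

end Expansion

/-! ### From the relation ν = λ + μ to total derivatives. -/

section Adjoint

open PDO

variable {F V : Type*} [Field F] [CommRing V] [Algebra F V] (D : Derivation F V V)

/-- The formal adjoint on coefficient families. -/
def adjFun (f : ℤ → V) (j : ℤ) : V :=
  ∑ᶠ k : ℕ, sgn (j + k) • Ring.choose (j + k) k • D^[k] (f (j + k))

variable {D}

theorem adjFun_coeff (a : PDO D) : adjFun D a.coeff = a.adjoint.coeff := rfl

theorem adjFun_mem {f : ℤ → V} (hf : f ∈ laurentCoeffs V) : adjFun D f ∈ laurentCoeffs V := by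
  obtain ⟨a, rfl⟩ := exists_coeff_eq D hf
  exact coeff_mem a.adjoint

theorem adjFun_eq_zero {f : ℤ → V} {n : ℤ} (hf : ∀ k : ℕ, f (n + k) = 0) : adjFun D f n = 0 :=
  (finsum_congr fun k => by rw [hf k, iterate_zero, smul_zero, smul_zero]).trans finsum_zero

theorem adjFun_add {f g : ℤ → V} (hf : f ∈ laurentCoeffs V) (hg : g ∈ laurentCoeffs V) :
    adjFun D (f + g) = adjFun D f + adjFun D g := by
  obtain ⟨a, rfl⟩ := exists_coeff_eq D hf
  obtain ⟨b, rfl⟩ := exists_coeff_eq D hg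
  exact congrArg coeff (adjoint_add a b)

theorem adjFun_sub {f g : ℤ → V} (hf : f ∈ laurentCoeffs V) (hg : g ∈ laurentCoeffs V) :
    adjFun D (f - g) = adjFun D f - adjFun D g := by
  obtain ⟨a, rfl⟩ := exists_coeff_eq D hf
  obtain ⟨b, rfl⟩ := exists_coeff_eq D hg
  exact congrArg coeff (adjoint_sub a b)

theorem adjFun_adjFun {f : ℤ → V} (hf : f ∈ laurentCoeffs V) : adjFun D (adjFun D f) = f := by
  obtain ⟨a, rfl⟩ := exists_coeff_eq D hf
  exact congrArg coeff (adjoint_adjoint a)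

theorem adjFun_shift {f : ℤ → V} (hf : f ∈ laurentCoeffs V) (n : ℤ) :
    adjFun D (fun i => f (i - 1)) n = -(D (adjFun D f n) + adjFun D f (n - 1)) := by
  obtain ⟨a, rfl⟩ := exists_coeff_eq D hf
  have h : (fun i => a.coeff (i - 1)) = (a * dpow 1).coeff :=
    funext fun i => (coeff_mul_dpow a 1 i).symm
  rw [h, adjFun_coeff, adjFun_coeff, adjoint_mul, adjoint_dpow, sgn_one, neg_smul, one_smul,
    neg_mul, dpow_one_mul, coeff_neg, coeff_dmul]

theorem adjFun_single_zero (v : V) (n : ℤ) :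
    adjFun D (fun k => if k = 0 then v else 0) n = if n = 0 then v else 0 :=
  congrArg (fun a : PDO D => a.coeff n) (adjoint_single_zero v)

variable (D)

/-- The formal adjoint with respect to the third variable. -/
def adjThird (T : ℤ → ℤ → ℤ → V) (i j k : ℤ) : V := adjFun D (T i j) k

/-- The formal adjoint with respect to the first variable. -/
def adjFirst (T : ℤ → ℤ → ℤ → V) (i j k : ℤ) : V := adjFun D (fun i' => T i' j k) i

variable {D}

theorem IsWide.adjFirst {T : ℤ → ℤ → ℤ → V} (hT : IsWide T) : IsWide (adjFirst D T) := by
  obtain ⟨N, hN⟩ := hT.1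
  exact ⟨⟨N, fun i j k h => adjFun_eq_zero fun l => hN _ j k h⟩, fun j k => adjFun_mem (hT.mem1 j k)⟩

theorem IsWide.adjThird {T : ℤ → ℤ → ℤ → V} (hT : IsWide T) : IsWide (adjThird D T) := by
  obtain ⟨N, hN⟩ := hT.1
  refine ⟨⟨N, fun i j k h => adjFun_eq_zero fun l => hN i j _ (by omega)⟩, fun j k => ?_⟩
  choose g hg using hT.2 j
  obtain ⟨B, hB⟩ := ((Finset.Icc k N).image g).exists_le
  refine ⟨B, fun i hi => adjFun_eq_zero fun l => ?_⟩
  by_cases h : k + l ≤ N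
  · exact hg _ i ((hB _ (Finset.mem_image_of_mem g (Finset.mem_Icc.2 ⟨by omega, h⟩))).trans_lt hi)
  · exact hN i j _ (by omega)

theorem IsTripleSeries.adjThird {T : ℤ → ℤ → ℤ → V} (hT : IsTripleSeries T) :
    IsTripleSeries (adjThird D T) := by
  obtain ⟨N, hN⟩ := hT
  exact ⟨N, fun i j k h => adjFun_eq_zero fun l => hN i j _ (by omega)⟩

theorem adjThird_sub {S T : ℤ → ℤ → ℤ → V} (hS : IsWide S) (hT : IsWide T) :
    adjThird D (S - T) = adjThird D S - adjThird D T :=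
  funext fun i => funext fun j => adjFun_sub (hS.mem3 i j) (hT.mem3 i j)

theorem adjThird_adjThird {T : ℤ → ℤ → ℤ → V} (hT : IsWide T) :
    adjThird D (adjThird D T) = T :=
  funext fun i => funext fun j => adjFun_adjFun (hT.mem3 i j)

theorem adjThird_neg {T : ℤ → ℤ → ℤ → V} (hT : IsWide T) : adjThird D (-T) = -adjThird D T := by
  have h0 : adjThird D (0 : ℤ → ℤ → ℤ → V) = 0 := by
    funext i j k; exact adjFun_eq_zero fun _ => rfl
  rw [← zero_sub, adjThird_sub isWide_zero hT, h0, zero_sub]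

theorem adjFirst_adjFirst {T : ℤ → ℤ → ℤ → V} (hT : IsWide T) :
    adjFirst D (adjFirst D T) = T := by
  funext i j k
  exact congrFun (adjFun_adjFun (hT.mem1 j k)) i

theorem adjThird_ofTwo (P : ℤ → ℤ → V) : adjThird D (ofTwo P) = ofTwo P := by
  funext i j k
  exact adjFun_single_zero (P i j) k

/-- The adjoint in the third variable replaces ν by −∂ − ν, so ν − λ − μ turns into −(∂ + λ + μ +
ν), which is symmetric in the three variables. -/
theorem adjThird_relation {W : ℤ → ℤ → ℤ → V} (hW : IsWide W) :
    adjThird D (relation W) = -total D (adjThird D W) := by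
  have h : relation W = (fun i j k => W i j (k - 1)) - (fun i j k => W (i - 1) j k) -
      (fun i j k => W i (j - 1) k) := rfl
  rw [h, adjThird_sub (hW.shift3.sub hW.shift1) hW.shift2, adjThird_sub hW.shift3 hW.shift1]
  funext i j k
  simp only [Pi.sub_apply, Pi.neg_apply, total]
  rw [show adjThird D (fun i j k => W i j (k - 1)) i j k = _ from adjFun_shift (hW.mem3 i j) k]
  simp only [adjThird]
  abel

theorem IsWide.ofTwo_of_sub {X : ℤ → ℤ → ℤ → V} {P : ℤ → ℤ → V} (hX : IsWide X)
    (h : IsWide (X - ofTwo P)) : IsWide (ofTwo P) := by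
  rw [← sub_sub_cancel X (ofTwo P)]
  exact hX.sub h

theorem expandMuLam_eq_iff_isNull {X : ℤ → ℤ → ℤ → V} (hX : IsWide X) (P : ℤ → ℤ → V) :
    (∀ a b, expandMuLam X a b = P a b) ↔ IsNull D (adjThird D X - ofTwo P) := by
  rw [expandMuLam_eq_iff hX]
  constructor
  · rintro ⟨W, hW, h⟩
    have hP := hX.ofTwo_of_sub (h ▸ hW.relation)
    refine ⟨-adjThird D W, hW.adjThird.neg, ?_⟩
    rw [total_neg, ← adjThird_relation hW, ← h, adjThird_sub hX hP, adjThird_ofTwo]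
  · rintro ⟨W, hW, h⟩
    have hP := hX.adjThird.ofTwo_of_sub (h ▸ hW.total D)
    refine ⟨_, (hW.adjThird (D := D)).neg, ?_⟩
    have h1 : adjThird D (relation (adjThird D W)) = -total D W := by
      rw [adjThird_relation hW.adjThird, adjThird_adjThird hW]
    have h2 : relation (-adjThird D W) = -relation (adjThird D W) := by
      funext i j k
      simp only [relation, Pi.neg_apply]
      abel
    have h3 := congrArg (adjThird D) h
    rw [adjThird_sub hX.adjThird hP, adjThird_adjThird hX, adjThird_ofTwo] at h3
    rw [h3, h2, ← adjThird_adjThird (D := D) (hW.adjThird (D := D)).relation, h1,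
      adjThird_neg (hW.total D), neg_neg]

/-- A wide family which agrees with null families up to arbitrarily low total order in the last
two variables is null. -/
theorem isNull_of_approx {T : ℤ → ℤ → ℤ → V} (hT : IsWide T)
    (h : ∀ s : ℤ, ∃ T', IsNull D T' ∧ ∀ i j k, s ≤ j + k → T i j k = T' i j k) : IsNull D T := by
  have key := expandMuLam_eq_iff_isNull (D := D) (hT.adjThird (D := D)) 0
  have h0 : ofTwo (0 : ℤ → ℤ → V) = 0 := by funext i j k; simp [ofTwo]
  rw [adjThird_adjThird hT, h0, sub_zero] at key
  rw [← key]
  intro a b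
  -- Nullity is equivalent to the vanishing of every coefficient of an expansion, and the one at (a,
  -- b) depends only on entries with j + k ≥ b.
  obtain ⟨T', hT', hs⟩ := h b
  have hT'' := hT'.isWide
  have key' := expandMuLam_eq_iff_isNull (D := D) (hT''.adjThird (D := D)) 0
  rw [adjThird_adjThird hT'', h0, sub_zero] at key'
  rw [← key'.2 hT' a b]
  refine finsum_congr fun q => ?_
  congr 1
  refine finsum_congr fun k => ?_
  rw [hs _ _ _ (by omega)]

theorem expandLamMu_eq (Y : ℤ → ℤ → ℤ → V) (a b : ℤ) :
    expandLamMu Y a b = expandMuLam (swap12 Y) b a := rfl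

theorem sgn_eq_or (n : ℤ) : sgn n = 1 ∨ sgn n = -1 := by
  rcases Int.units_eq_one_or ((-1 : ℤˣ) ^ n) with h | h <;> simp [sgn, h]

theorem sgn_smul_finsum {ι : Type*} (n : ℤ) (f : ι → V) :
    sgn n • ∑ᶠ i, f i = ∑ᶠ i, sgn n • f i := by
  rcases sgn_eq_or n with h | h
  · simp [h]
  · simp [h, finsum_neg_distrib]

/-- Multiplication of the coefficients by `(-1)ʲ`. -/
def signSecond (T : ℤ → ℤ → ℤ → V) (i j k : ℤ) : V := sgn j • T i j k

theorem signSecond_signSecond (T : ℤ → ℤ → ℤ → V) : signSecond (signSecond T) = T := by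
  funext i j k
  rw [signSecond, signSecond, smul_smul, sgn_mul_self, one_smul]

theorem IsWide.signSecond {T : ℤ → ℤ → ℤ → V} (hT : IsWide T) : IsWide (signSecond T) := by
  obtain ⟨⟨N, hN⟩, hT⟩ := hT
  refine ⟨⟨N, fun i j k h => (congrArg (sgn j • ·) (hN i j k h)).trans (smul_zero _)⟩,
    fun j k => ?_⟩
  obtain ⟨M, hM⟩ := hT j k
  exact ⟨M, fun i hi => (congrArg (sgn j • ·) (hM i hi)).trans (smul_zero _)⟩

/-- Solving for μ = ν + (−λ) makes μ the dependent variable: after a cyclic permutation and the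
substitution λ ↦ −λ this is the expansion already studied. -/
theorem expandLamNu_eq (Z : ℤ → ℤ → ℤ → V) (a c : ℤ) :
    expandLamNu Z a c = sgn a • expandMuLam (signSecond (rotate Z)) c a := by
  rw [expandLamNu, expandMuLam, sgn_smul_finsum]
  refine finsum_congr fun q => ?_
  change sgn (q.2 - q.1) • Ring.choose q.2 q.1 • Z (a - q.2 + q.1) q.2 (c - q.1) =
    sgn a • Ring.choose q.2 q.1 • sgn (a - q.2 + q.1) • Z (a - q.2 + q.1) q.2 (c - q.1)
  rw [smul_comm (Ring.choose q.2 q.1) (sgn _), smul_smul (sgn a),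
    show a - q.2 + q.1 = a - (q.2 - q.1) by ring, sgn_sub a, ← mul_assoc, sgn_mul_self, one_mul]

/-- With the sign removed the relation reads μ + λ − ν, the variable ν being the first one; the
adjoint sends ν to −∂ − ν. -/
theorem adjFirst_relation_signSecond {W : ℤ → ℤ → ℤ → V} (hW : IsWide W) :
    adjFirst D (signSecond (relation (signSecond W))) = total D (adjFirst D W) := by
  have h : signSecond (relation (signSecond W)) = fun i j k =>
      (W i j (k - 1) + W i (j - 1) k) - W (i - 1) j k := by
    funext i j k
    simp only [signSecond, relation, smul_sub, smul_smul, sgn_mul_self, one_smul]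
    rw [sgn_sub, sgn_one, mul_neg_one, mul_neg, sgn_mul_self, neg_one_smul]
    abel
  rw [h]
  funext i j k
  have e := congrFun (adjFun_sub (D := D) (add_mem (hW.mem1 j (k - 1)) (hW.mem1 (j - 1) k))
    (hW.shift1.mem1 j k)) i
  have e' := congrFun (adjFun_add (D := D) (hW.mem1 j (k - 1)) (hW.mem1 (j - 1) k)) i
  rw [Pi.sub_apply, e', adjFun_shift (hW.mem1 j k)] at e
  refine e.trans ?_
  simp only [Pi.add_apply, total, adjFirst]
  abel

theorem adjFirst_sub {S T : ℤ → ℤ → ℤ → V} (hS : IsWide S) (hT : IsWide T) :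
    adjFirst D (S - T) = adjFirst D S - adjFirst D T := by
  funext i j k
  exact congrFun (adjFun_sub (hS.mem1 j k) (hT.mem1 j k)) i

/-- The counterpart of `expandMuLam_eq_iff_isNull` for the third Jacobi term. Here ν occurs in the
expansion itself, so the adjoint also acts on `R`. -/
theorem expandLamNu_eq_iff_isNull {Z : ℤ → ℤ → ℤ → V} (hZ : IsTripleSeries Z) {R : ℤ → ℤ → V}
    (hR : ∀ a, R a ∈ laurentCoeffs V) :
    (∀ a c, expandLamNu Z a c = R a c) ↔
      IsNull D (rotate (adjThird D Z) - ofTwo fun i j => adjFun D (R j) i) := by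
  have hr : IsWide (rotate Z) := hZ.rotate.isWide
  have hadj : adjFirst D (ofTwo fun i j => R j i) = ofTwo fun i j => adjFun D (R j) i := by
    funext i j k
    by_cases hk : k = 0
    · subst hk; simp [adjFirst, ofTwo]
    · simp only [ofTwo, if_neg hk]
      exact adjFun_eq_zero fun l => if_neg hk
  have hs : signSecond (ofTwo fun i j => sgn j • R j i) = ofTwo fun i j => R j i := by
    funext i j k
    simp only [signSecond, ofTwo]
    split_ifs
    · rw [smul_smul, sgn_mul_self, one_smul]
    · rw [smul_zero]
  have hsub : ∀ S T : ℤ → ℤ → ℤ → V, signSecond (S - T) = signSecond S - signSecond T :=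
    fun S T => by funext i j k; exact smul_sub _ _ _
  have step1 : (∀ a c, expandLamNu Z a c = R a c) ↔
      ∀ c a, expandMuLam (signSecond (rotate Z)) c a = (fun c a => sgn a • R a c) c a := by
    constructor
    · intro h c a
      simp only [← h, expandLamNu_eq, smul_smul, sgn_mul_self, one_smul]
    · intro h a c
      rw [expandLamNu_eq, h, smul_smul, sgn_mul_self, one_smul]
  rw [step1, expandMuLam_eq_iff hr.signSecond]
  change _ ↔ IsNull D (adjFirst D (rotate Z) - _)
  rw [← hadj]
  constructor
  · rintro ⟨W, hW, h⟩
    have h' := congrArg signSecond h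
    rw [hsub, signSecond_signSecond, hs] at h'
    have hRw : IsWide (ofTwo fun i j => R j i) :=
      hr.ofTwo_of_sub (h' ▸ hW.relation.signSecond)
    refine ⟨adjFirst D (signSecond W), hW.signSecond.adjFirst, ?_⟩
    rw [← adjFirst_relation_signSecond hW.signSecond, signSecond_signSecond, ← h',
      adjFirst_sub hr hRw]
  · rintro ⟨W, hW, h⟩
    have hRw : IsWide (adjFirst D (ofTwo fun i j => R j i)) := by
      rw [hadj] at h ⊢
      exact hr.adjFirst.ofTwo_of_sub (h ▸ hW.total D)
    -- Only the adjoint of `R` is known to be bounded in the second index; since the adjoint is an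
    -- involution, `R j` vanishes as soon as its adjoint does.
    have hRw' : IsWide (ofTwo fun i j => R j i) := by
      refine ⟨?_, fun j k => ?_⟩
      · obtain ⟨N, hN⟩ := hRw.1
        refine ⟨N, fun i j k h => ?_⟩
        by_cases hk : k = 0
        · subst hk
          have hz : adjFun D (R j) = (0 : PDO D).coeff := by
            funext i'
            have := hN i' j 0 h
            rw [hadj] at this
            simpa [ofTwo] using this
          have h2 := congrArg (adjFun D) hz
          rw [adjFun_adjFun (hR j), adjFun_coeff, adjoint_zero] at h2
          simp [ofTwo, h2]
        · exact if_neg hk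
      · by_cases hk : k = 0
        · subst hk
          obtain ⟨M, hM⟩ := hR j
          exact ⟨M, fun i hi => (if_pos rfl).trans (hM i hi)⟩
        · exact ⟨0, fun i _ => if_neg hk⟩
    refine ⟨_, (hW.adjFirst (D := D)).signSecond, ?_⟩
    have h1 := adjFirst_relation_signSecond (D := D) (hW.adjFirst (D := D))
    rw [adjFirst_adjFirst hW, ← h, ← adjFirst_sub hr hRw'] at h1
    have h2 := congrArg (adjFirst D) h1
    rw [adjFirst_adjFirst (hW.adjFirst.signSecond.relation.signSecond),
      adjFirst_adjFirst (hr.sub hRw')] at h2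
    have h3 := congrArg signSecond h2
    rw [signSecond_signSecond, hsub, ← hs, signSecond_signSecond] at h3
    exact h3.symm

end Adjoint

/-! ### Trilinear operators modulo total derivatives. -/

section TriOperators

variable {F V : Type*} [Field F] [CommRing V] [Algebra F V]

/-- The group of wide families. -/
def wide (V : Type*) [CommRing V] : AddSubgroup (ℤ → ℤ → ℤ → V) where
  carrier := {T | IsWide T}
  zero_mem' := isWide_zero
  add_mem' := IsWide.add
  neg_mem' := IsWide.neg

/-- The group of null families. -/
def nullFamilies (D : Derivation F V V) : AddSubgroup (wide V) where
  carrier := {T | IsNull D T.1}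
  zero_mem' := isNull_zero
  add_mem' := IsNull.add
  neg_mem' := IsNull.neg

/-- Trilinear pseudodifferential operators: wide families modulo total derivatives. -/
def TriOp (D : Derivation F V V) : Type _ := wide V ⧸ nullFamilies D

namespace TriOp

variable {D : Derivation F V V}

instance : AddCommGroup (TriOp D) := inferInstanceAs (AddCommGroup (wide V ⧸ nullFamilies D))

/-- The class of a wide family. -/
def mk (D : Derivation F V V) (T : ℤ → ℤ → ℤ → V) (hT : IsWide T) : TriOp D :=
  QuotientAddGroup.mk (s := nullFamilies D) ⟨T, hT⟩

theorem mk_eq_iff {S T : ℤ → ℤ → ℤ → V} (hS : IsWide S) (hT : IsWide T) :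
    mk D S hS = mk D T hT ↔ IsNull D (S - T) :=
  QuotientAddGroup.eq_iff_sub_mem

theorem mk_add {S T : ℤ → ℤ → ℤ → V} (hS : IsWide S) (hT : IsWide T) :
    mk D (S + T) (hS.add hT) = mk D S hS + mk D T hT := rfl

theorem mk_neg {T : ℤ → ℤ → ℤ → V} (hT : IsWide T) :
    mk D (-T) hT.neg = -mk D T hT := rfl

theorem mk_congr {S T : ℤ → ℤ → ℤ → V} (hS : IsWide S) (h : S = T) :
    mk D S hS = mk D T (h ▸ hS) := by subst h; rfl

theorem induction {p : TriOp D → Prop} (h : ∀ T hT, p (mk D T hT)) (x : TriOp D) : p x :=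
  Quotient.inductionOn x fun T => h T.1 T.2

/-- The endomorphism of `TriOp D` induced by an additive operation on wide families. -/
def lift (φ : (ℤ → ℤ → ℤ → V) → ℤ → ℤ → ℤ → V) (hw : ∀ T, IsWide T → IsWide (φ T))
    (hadd : ∀ S T, IsWide S → IsWide T → φ (S + T) = φ S + φ T)
    (hn : ∀ T, IsNull D T → IsNull D (φ T)) : TriOp D →+ TriOp D :=
  QuotientAddGroup.map (nullFamilies D) (nullFamilies D)
    (AddMonoidHom.mk' (fun T : wide V => (⟨φ T.1, hw T.1 T.2⟩ : wide V)) fun S T =>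
      Subtype.ext (hadd S.1 T.1 S.2 T.2)) fun T hT => hn T.1 hT

/-- Right composition in the first variable. -/
def act1 (L : PDO D) : TriOp D →+ TriOp D :=
  lift (fun T => DiracReduction.act1 T L) (fun _ h => h.act1 L)
    (fun _ _ hS hT => act1_add hS hT L) fun _ h => h.act1 L

/-- Right composition in the second variable. -/
def act2 (L : PDO D) : TriOp D →+ TriOp D :=
  lift (fun T => DiracReduction.act2 T L) (fun _ h => h.act2 L)
    (fun _ _ hS hT => act2_add hS hT L) fun _ h => h.act2 L

/-- Right composition in the third variable. -/
def act3 (L : PDO D) : TriOp D →+ TriOp D :=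
  lift (fun T => DiracReduction.act3 T L) (fun _ h => h.act3 L)
    (fun _ _ hS hT => act3_add hS hT L) fun _ h => h.act3 L

/-- Exchange of the last two variables. -/
def swap23 : TriOp D →+ TriOp D :=
  lift DiracReduction.swap23 (fun _ h => h.swap23) (fun _ _ _ _ => rfl) fun _ h => h.swap23

theorem act2_mk (L : PDO D) {T : ℤ → ℤ → ℤ → V} (hT : IsWide T) :
    act2 L (mk D T hT) = mk D (DiracReduction.act2 T L) (hT.act2 L) := rfl
theorem act3_mk (L : PDO D) {T : ℤ → ℤ → ℤ → V} (hT : IsWide T) :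
    act3 L (mk D T hT) = mk D (DiracReduction.act3 T L) (hT.act3 L) := rfl
theorem swap23_mk {T : ℤ → ℤ → ℤ → V} (hT : IsWide T) :
    swap23 (mk D T hT) = mk D (DiracReduction.swap23 T) hT.swap23 := rfl

theorem act1_add (L L' : PDO D) (x : TriOp D) : act1 (L + L') x = act1 L x + act1 L' x := by
  induction x using induction with | h T hT => exact mk_congr _ (act1_add_right hT L L')
theorem act2_add (L L' : PDO D) (x : TriOp D) : act2 (L + L') x = act2 L x + act2 L' x := by
  induction x using induction with | h T hT => exact mk_congr _ (act2_add_right hT L L')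
theorem act3_add (L L' : PDO D) (x : TriOp D) : act3 (L + L') x = act3 L x + act3 L' x := by
  induction x using induction with | h T hT => exact mk_congr _ (act3_add_right hT L L')

theorem act1_mul (L L' : PDO D) (x : TriOp D) : act1 (L * L') x = act1 L' (act1 L x) := by
  induction x using induction with | h T hT => exact mk_congr _ (act1_act1 hT L L').symm
theorem act2_mul (L L' : PDO D) (x : TriOp D) : act2 (L * L') x = act2 L' (act2 L x) := by
  induction x using induction with | h T hT => exact mk_congr _ (act2_act2 hT L L').symm
theorem act3_mul (L L' : PDO D) (x : TriOp D) : act3 (L * L') x = act3 L' (act3 L x) := by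
  induction x using induction with | h T hT => exact mk_congr _ (act3_act3 hT L L').symm

theorem act2_one (x : TriOp D) : act2 1 x = x := by
  induction x using induction with | h T hT => exact mk_congr _ (DiracReduction.act2_one hT)
theorem act3_one (x : TriOp D) : act3 1 x = x := by
  induction x using induction with | h T hT => exact mk_congr _ (DiracReduction.act3_one hT)

theorem act1_act2 (L L' : PDO D) (x : TriOp D) : act1 L' (act2 L x) = act2 L (act1 L' x) := by
  induction x using induction with
  | h T hT => exact mk_congr _ (DiracReduction.act1_act2 hT L L')
theorem act1_act3 (L L' : PDO D) (x : TriOp D) : act1 L' (act3 L x) = act3 L (act1 L' x) := by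
  induction x using induction with
  | h T hT => exact mk_congr _ (DiracReduction.act1_act3 hT L L')
theorem act2_act3 (L L' : PDO D) (x : TriOp D) : act2 L' (act3 L x) = act3 L (act2 L' x) := by
  induction x using induction with
  | h T hT => exact mk_congr _ (DiracReduction.act2_act3 hT L L')

theorem swap23_act1 (L : PDO D) (x : TriOp D) : swap23 (act1 L x) = act1 L (swap23 x) := by
  induction x using induction with | h T hT => rfl
theorem swap23_act2 (L : PDO D) (x : TriOp D) : swap23 (act2 L x) = act3 L (swap23 x) := by
  induction x using induction with | h T hT => rfl
theorem swap23_act3 (L : PDO D) (x : TriOp D) : swap23 (act3 L x) = act2 L (swap23 x) := by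
  induction x using induction with | h T hT => rfl

/-- Right composition in the first variable, additive in the operator. -/
def act1Hom (x : TriOp D) : PDO D →+ TriOp D :=
  AddMonoidHom.mk' (fun L => act1 L x) fun L L' => act1_add L L' x
/-- Right composition in the second variable, additive in the operator. -/
def act2Hom (x : TriOp D) : PDO D →+ TriOp D :=
  AddMonoidHom.mk' (fun L => act2 L x) fun L L' => act2_add L L' x
/-- Right composition in the third variable, additive in the operator. -/
def act3Hom (x : TriOp D) : PDO D →+ TriOp D :=
  AddMonoidHom.mk' (fun L => act3 L x) fun L L' => act3_add L L' x

theorem act3_neg (L : PDO D) (x : TriOp D) : act3 (-L) x = -act3 L x := map_neg (act3Hom x) L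
theorem act2_zero (x : TriOp D) : act2 0 x = 0 := map_zero (act2Hom x)
theorem act3_zero (x : TriOp D) : act3 0 x = 0 := map_zero (act3Hom x)
theorem act1_sum {ι : Type*} (s : Finset ι) (L : ι → PDO D) (x : TriOp D) :
    act1 (∑ i ∈ s, L i) x = ∑ i ∈ s, act1 (L i) x := map_sum (act1Hom x) L s

/-- Trilinear operators form a left module through the adjoint of the third composition. -/
instance : Module (PDO D) (TriOp D) where
  smul L x := act3 L.adjoint x
  one_smul x := by
    change act3 (1 : PDO D).adjoint x = x
    rw [PDO.adjoint_one, act3_one]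
  mul_smul L L' x := by
    change act3 (L * L').adjoint x = act3 L.adjoint (act3 L'.adjoint x)
    rw [PDO.adjoint_mul, act3_mul]
  smul_zero _ := map_zero _
  smul_add _ := map_add _
  add_smul L L' x := by
    change act3 (L + L').adjoint x = act3 L.adjoint x + act3 L'.adjoint x
    rw [PDO.adjoint_add, act3_add]
  zero_smul x := by
    change act3 (0 : PDO D).adjoint x = 0
    rw [PDO.adjoint_zero, act3_zero]

/-- Trilinear operators form a right module through the second composition. -/
instance : Module (PDO D)ᵐᵒᵖ (TriOp D) where
  smul L x := act2 L.unop x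
  one_smul x := act2_one x
  mul_smul L L' x := act2_mul L'.unop L.unop x
  smul_zero _ := map_zero _
  smul_add _ := map_add _
  add_smul L L' x := act2_add L.unop L'.unop x
  zero_smul x := act2_zero x

theorem smul_def (L : PDO D) (x : TriOp D) : L • x = act3 L.adjoint x := rfl
theorem op_smul_def (L : PDO D) (x : TriOp D) : MulOpposite.op L • x = act2 L x := rfl

instance : SMulCommClass (PDO D) (PDO D)ᵐᵒᵖ (TriOp D) where
  smul_comm L L' x := (act2_act3 L.adjoint L'.unop x).symm

/-- The analogue of `eq_of_single` for identities between trilinear operators. It needs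
`isNull_of_approx`, since nullity is an existence statement and not directly a coefficientwise one.
-/
theorem isNull_of_single {Ψ : PDO D →+ (ℤ → ℤ → ℤ → V)} (hw : ∀ a, IsWide (Ψ a))
    {d : ℤ} (hd : ∀ (a : PDO D) N, a.OrdLE N → ∀ i j k, N + d < j + k → Ψ a i j k = 0)
    (hs : ∀ n v, IsNull D (Ψ (PDO.single n v))) (a : PDO D) : IsNull D (Ψ a) := by
  refine isNull_of_approx (hw a) fun s => ?_
  obtain ⟨t, ht⟩ := PDO.exists_sum_single a (s - d - 1)
  refine ⟨Ψ (∑ n ∈ t, PDO.single n (a.coeff n)), ?_, fun i j k h => ?_⟩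
  · rw [map_sum]
    exact Finset.sum_induction _ (IsNull D) (fun _ _ => IsNull.add) isNull_zero fun n _ => hs _ _
  · have := hd _ _ ht i j k (by omega)
    rw [map_sub] at this
    exact sub_eq_zero.1 this

end TriOp

end TriOperators

/-! ### Partial derivatives of symbols as a derivation into trilinear operators. -/

namespace DiffFunctions

open PDO

variable {F V : Type*} [Field F] [CommRing V] [Algebra F V] {D : Derivation F V V} {ℓ : ℕ}
  (𝒱 : DiffFunctions D ℓ)

theorem frechet_coeff (f : V) (i : Fin ℓ) (n : ℤ) :
    (𝒱.frechet f i).coeff n = if 0 ≤ n then 𝒱.pd i n.toNat f else 0 := rfl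

theorem frechet_coeff_natCast (f : V) (i : Fin ℓ) (n : ℕ) :
    (𝒱.frechet f i).coeff n = 𝒱.pd i n f := by simp [frechet_coeff]

theorem isDifferential_frechet (f : V) (i : Fin ℓ) : (𝒱.frechet f i).IsDifferential :=
  fun _ hn => if_neg (by omega)

theorem frechet_add (f g : V) (i : Fin ℓ) :
    𝒱.frechet (f + g) i = 𝒱.frechet f i + 𝒱.frechet g i := by
  ext n; simp only [frechet_coeff, coeff_add, map_add]; split_ifs <;> simp

theorem frechet_mul (f g : V) (i : Fin ℓ) :
    𝒱.frechet (f * g) i = f • 𝒱.frechet g i + g • 𝒱.frechet f i := by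
  ext n
  simp only [frechet_coeff, coeff_add, coeff_smul, Derivation.leibniz, smul_eq_mul]
  split_ifs <;> simp

/-- The Frechet derivative as an additive map. -/
def frechetHom (i : Fin ℓ) : V →+ PDO D := AddMonoidHom.mk' (𝒱.frechet · i) fun f g =>
  𝒱.frechet_add f g i

theorem frechet_zero (i : Fin ℓ) : 𝒱.frechet 0 i = 0 := map_zero (𝒱.frechetHom i)

theorem frechet_one (i : Fin ℓ) : 𝒱.frechet 1 i = 0 := by
  ext n; simp [frechet_coeff]

theorem frechet_D (f : V) (i : Fin ℓ) : 𝒱.frechet (D f) i = dmul (𝒱.frechet f i) := by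
  ext n
  rw [coeff_dmul]
  rcases lt_or_ge n 0 with hn | hn
  · rw [frechet_coeff, frechet_coeff, frechet_coeff, if_neg (by omega), if_neg (by omega),
      if_neg (by omega), map_zero, add_zero]
  · lift n to ℕ using hn
    rw [frechet_coeff_natCast, frechet_coeff_natCast]
    rcases n with _ | n
    · rw [sub_eq_zero.1 (𝒱.pd_D_zero i f), frechet_coeff, if_neg (by simp), add_zero]
    · rw [show ((n + 1 : ℕ) : ℤ) - 1 = n by push_cast; ring, frechet_coeff_natCast]
      exact sub_eq_iff_eq_add'.1 (𝒱.pd_D_succ i n f)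

theorem frechet_u (i j : Fin ℓ) : 𝒱.frechet (𝒱.u j) i = if i = j then 1 else 0 := by
  ext n
  rcases lt_or_ge n 0 with hn | hn
  · rw [frechet_coeff, if_neg (by omega)]
    split_ifs
    · rw [coeff_one, if_neg (by omega)]
    · rfl
  · lift n to ℕ using hn
    rw [frechet_coeff_natCast]
    have := 𝒱.pd_u i n j 0
    rw [Function.iterate_zero, id] at this
    rw [this]
    by_cases h : i = j <;> simp [h, coeff_one]

/-- The partial derivative `∑_{n,s} (∂a_s/∂u_h⁽ⁿ⁾) λⁿ μˢ` of the symbol `∑ a_s μˢ`. -/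
def symbolPd (h : Fin ℓ) (a : PDO D) : ℤ → ℤ → ℤ → V :=
  ofTwo fun i j => (𝒱.frechet (a.coeff j) h).coeff i

theorem isWide_symbolPd (h : Fin ℓ) (a : PDO D) : IsWide (𝒱.symbolPd h a) := by
  obtain ⟨N, hN⟩ := a.exists_ordLE
  refine ⟨⟨max N 0, fun i j k hjk => ?_⟩, fun j k => ?_⟩
  · rw [symbolPd, ofTwo]
    split_ifs with hk
    · rw [hN j (by omega), frechet_zero, coeff_zero]
    · rfl
  · obtain ⟨M, hM⟩ := (𝒱.frechet (a.coeff j) h).exists_ordLE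
    refine ⟨M, fun i hi => ?_⟩
    rw [symbolPd, ofTwo, hM i hi, ite_self]

theorem symbolPd_add (h : Fin ℓ) (a b : PDO D) :
    𝒱.symbolPd h (a + b) = 𝒱.symbolPd h a + 𝒱.symbolPd h b := by
  funext i j k
  simp only [symbolPd, ofTwo, coeff_add, frechet_add, Pi.add_apply]
  split_ifs <;> simp

theorem symbolPd_eq_zero (h : Fin ℓ) {a : PDO D} {N : ℤ} (ha : a.OrdLE N) {i j k : ℤ}
    (hjk : N < j ∨ k ≠ 0) : 𝒱.symbolPd h a i j k = 0 := by
  rw [symbolPd, ofTwo]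
  split_ifs with hk
  · rw [ha j (by tauto), frechet_zero, coeff_zero]
  · rfl

theorem symbolPd_dmul (h : Fin ℓ) (a : PDO D) :
    𝒱.symbolPd h (dmul a) =
      total D (𝒱.symbolPd h a) - fun i j k => 𝒱.symbolPd h a i j (k - 1) := by
  funext i j k
  simp only [symbolPd, ofTwo, coeff_dmul, frechet_add, frechet_D, coeff_add, Pi.sub_apply, total,
    add_sub_cancel_right]
  split_ifs <;> simp

/-- The class of `symbolPd`, as an additive map. -/
def variation (h : Fin ℓ) : PDO D →+ TriOp D :=
  AddMonoidHom.mk' (fun a => TriOp.mk D _ (𝒱.isWide_symbolPd h a)) fun a b =>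
    (TriOp.mk_congr _ (𝒱.symbolPd_add h a b)).trans (TriOp.mk_add _ _)

theorem variation_apply (h : Fin ℓ) (a : PDO D) :
    𝒱.variation h a = TriOp.mk D _ (𝒱.isWide_symbolPd h a) := rfl

theorem act3_dpow {T : ℤ → ℤ → ℤ → V} (hT : IsWide T) (m : ℤ) :
    act3 T (dpow m : PDO D) = fun i j k => T i j (k - m) := by
  funext i j k
  exact rmul_dpow (hT.mem3 i j) m k

/-- Composing with ∂ multiplies the differentiated symbol by ∂ + λ + μ, which modulo total
derivatives is −ν, the action of ∂* in the third slot. -/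
theorem variation_dmul (h : Fin ℓ) (a : PDO D) :
    𝒱.variation h (dmul a) = TriOp.act3 (dpow 1).adjoint (𝒱.variation h a) := by
  have hw := 𝒱.isWide_symbolPd h a
  rw [adjoint_dpow, sgn_one, neg_one_smul, TriOp.act3_neg]
  rw [variation_apply, variation_apply, TriOp.act3_mk, ← TriOp.mk_neg, TriOp.mk_eq_iff,
    symbolPd_dmul, act3_dpow hw, sub_neg_eq_add, sub_add_cancel]
  exact ⟨_, hw, rfl⟩

theorem variation_dpow_mul (h : Fin ℓ) (n : ℤ) (b : PDO D) :
    𝒱.variation h (dpow n * b) = TriOp.act3 (dpow n).adjoint (𝒱.variation h b) := by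
  induction n using Int.induction_on with
  | zero => rw [dpow_zero, one_mul, adjoint_one, TriOp.act3_one]
  | succ n ih =>
    rw [dpow_succ_mul, variation_dmul, ih, ← TriOp.act3_mul, ← adjoint_mul, dpow_mul_dpow,
      add_comm]
  | pred n ih =>
    have h1 := 𝒱.variation_dmul h (dpow (-n - 1) * b)
    rw [← dpow_succ_mul, sub_add_cancel, ih] at h1
    have h2 := congrArg (TriOp.act3 (dpow (-1)).adjoint) h1
    rw [← TriOp.act3_mul, ← TriOp.act3_mul, ← adjoint_mul, ← adjoint_mul, dpow_mul_dpow,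
      dpow_mul_dpow, neg_add_cancel, dpow_zero, adjoint_one, TriOp.act3_one, neg_add_eq_sub] at h2
    exact h2.symm

theorem act3_single_zero_symbolPd (h : Fin ℓ) (a : PDO D) (v : V) :
    act3 (𝒱.symbolPd h a) (single 0 v : PDO D) = fun i j k => v * 𝒱.symbolPd h a i j k := by
  funext i j k
  have hf : 𝒱.symbolPd h a i j =
      (single 0 ((𝒱.frechet (a.coeff j) h).coeff i) : PDO D).coeff := rfl
  rw [act3, hf, rmul_coeff, single_zero_mul, smul_single, coeff_single, coeff_single, mul_ite,
    mul_zero, mul_comm v]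

theorem act2_symbolPd_single (h : Fin ℓ) (n : ℤ) (v : V) (b : PDO D) :
    act2 (𝒱.symbolPd h (single n v)) b =
      ofTwo fun i j => (dpow n * b).coeff j * (𝒱.frechet v h).coeff i := by
  funext i j k
  by_cases hk : k = 0
  · subst hk
    have hf : (fun j' => 𝒱.symbolPd h (single n v) i j' 0) =
        (single n ((𝒱.frechet v h).coeff i) : PDO D).coeff := by
      funext j'
      rw [symbolPd, ofTwo, if_pos rfl, coeff_single, coeff_single]
      split_ifs
      · rfl
      · rw [frechet_zero, coeff_zero]
    rw [act2, hf, rmul_coeff, single_mul, coeff_smul, ofTwo, if_pos rfl, mul_comm]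
  · have hf : (fun j' => 𝒱.symbolPd h (single n v) i j' k) = (0 : PDO D).coeff :=
      funext fun j' => if_neg hk
    rw [act2, hf, rmul_coeff, zero_mul, coeff_zero, ofTwo, if_neg hk]

/-- The ordinary Leibniz rule for the coefficient v, combined with the previous rule for the power
of ∂, whose own symbol has constant coefficients. -/
theorem variation_single_mul (h : Fin ℓ) (n : ℤ) (v : V) (b : PDO D) :
    𝒱.variation h (single n v * b) = TriOp.act2 b (𝒱.variation h (single n v)) +
      TriOp.act3 (single n v).adjoint (𝒱.variation h b) := by
  have h1 : TriOp.act3 (single n v).adjoint (𝒱.variation h b) =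
      TriOp.act3 (single 0 v) (𝒱.variation h (dpow n * b)) := by
    rw [variation_dpow_mul, ← TriOp.act3_mul, single_eq_smul, adjoint_smul]
  rw [h1, variation_apply, variation_apply, variation_apply, TriOp.act2_mk, TriOp.act3_mk,
    ← TriOp.mk_add]
  refine TriOp.mk_congr _ ?_
  rw [act2_symbolPd_single, act3_single_zero_symbolPd]
  funext i j k
  simp only [symbolPd, ofTwo, Pi.add_apply, single_mul, coeff_smul, frechet_mul, coeff_add]
  split_ifs
  · ring
  · ring

/-- The Leibniz rule for composition: the right factor acts in the second slot, and the left factor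
is moved to the third slot by integration by parts, hence its adjoint. Density reduces it to a
monomial left factor. -/
theorem variation_mul (h : Fin ℓ) (a b : PDO D) :
    𝒱.variation h (a * b) = TriOp.act2 b (𝒱.variation h a) +
      TriOp.act3 a.adjoint (𝒱.variation h b) := by
  have hb := 𝒱.isWide_symbolPd h b
  obtain ⟨M, hM⟩ := b.exists_ordLE
  let Ψ : PDO D →+ (ℤ → ℤ → ℤ → V) := AddMonoidHom.mk' (fun a => 𝒱.symbolPd h (a * b) -
    (act2 (𝒱.symbolPd h a) b + act3 (𝒱.symbolPd h b) a.adjoint)) fun a a' => by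
      rw [add_mul, symbolPd_add, symbolPd_add,
        act2_add (𝒱.isWide_symbolPd h a) (𝒱.isWide_symbolPd h a'), adjoint_add,
        act3_add_right hb]
      abel
  have key := TriOp.isNull_of_single (Ψ := Ψ) (d := M)
    (fun a => (𝒱.isWide_symbolPd h _).sub (((𝒱.isWide_symbolPd h a).act2 b).add (hb.act3 _)))
    (fun a N ha i j k hjk => ?_) (fun n v => ?_) a
  · rw [variation_apply, variation_apply, variation_apply, TriOp.act2_mk, TriOp.act3_mk,
      ← TriOp.mk_add, TriOp.mk_eq_iff]
    exact key
  · have e1 : 𝒱.symbolPd h (a * b) i j k = 0 :=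
      𝒱.symbolPd_eq_zero h (ha.mul hM) (by omega)
    have e2 : act2 (𝒱.symbolPd h a) b i j k = 0 := by
      by_cases hk : k = 0
      · exact rmul_eq_zero (fun j' hj' => 𝒱.symbolPd_eq_zero h ha (Or.inl hj')) hM (by omega)
      · rw [act2, show (fun j' => 𝒱.symbolPd h a i j' k) = (0 : PDO D).coeff from
          funext fun j' => 𝒱.symbolPd_eq_zero h ha (Or.inr hk), rmul_coeff, zero_mul, coeff_zero]
    have e3 : act3 (𝒱.symbolPd h b) a.adjoint i j k = 0 := by
      by_cases hj : M < j
      · rw [act3, show 𝒱.symbolPd h b i j = (0 : PDO D).coeff from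
          funext fun k' => 𝒱.symbolPd_eq_zero h hM (Or.inl hj), rmul_coeff, zero_mul, coeff_zero]
      · exact rmul_eq_zero (N := 0) (fun k' hk' => 𝒱.symbolPd_eq_zero h hM (Or.inr hk'.ne'))
          ha.adjoint (by omega)
    change 𝒱.symbolPd h (a * b) i j k - (act2 (𝒱.symbolPd h a) b i j k +
      act3 (𝒱.symbolPd h b) a.adjoint i j k) = 0
    rw [e1, e2, e3, add_zero, sub_zero]
  · have := 𝒱.variation_single_mul h n v b
    rw [variation_apply, variation_apply, variation_apply, TriOp.act2_mk, TriOp.act3_mk,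
      ← TriOp.mk_add, TriOp.mk_eq_iff] at this
    exact this

theorem variation_dpow (h : Fin ℓ) (n : ℤ) : 𝒱.variation h (dpow n) = 0 := by
  refine (TriOp.mk_congr _ ?_).trans (rfl : TriOp.mk D 0 isWide_zero = 0)
  funext i j k
  simp only [symbolPd, ofTwo, coeff_dpow]
  split_ifs
  · rw [frechet_one]; rfl
  · rw [frechet_zero]; rfl
  · rfl

/-- The second and third slots hold the two arguments of the bilinear form given by the operator,
and the adjoint exchanges them. -/
theorem variation_adjoint (h : Fin ℓ) (a : PDO D) :
    𝒱.variation h a.adjoint = TriOp.swap23 (𝒱.variation h a) := by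
  let Ψ : PDO D →+ (ℤ → ℤ → ℤ → V) := AddMonoidHom.mk' (fun a => 𝒱.symbolPd h a.adjoint -
    swap23 (𝒱.symbolPd h a)) fun a a' => by
      rw [adjoint_add, symbolPd_add, symbolPd_add]
      funext i j k
      simp only [Pi.add_apply, Pi.sub_apply, swap23]
      abel
  have key := TriOp.isNull_of_single (Ψ := Ψ) (d := 0)
    (fun a => (𝒱.isWide_symbolPd h _).sub (𝒱.isWide_symbolPd h a).swap23)
    (fun a N ha i j k hjk => ?_) (fun n v => ?_) a
  · rw [variation_apply, variation_apply, TriOp.swap23_mk, TriOp.mk_eq_iff]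
    exact key
  · have e1 : 𝒱.symbolPd h a.adjoint i j k = 0 :=
      𝒱.symbolPd_eq_zero h ha.adjoint (by omega)
    have e2 : 𝒱.symbolPd h a i k j = 0 := 𝒱.symbolPd_eq_zero h ha (by omega)
    change 𝒱.symbolPd h a.adjoint i j k - 𝒱.symbolPd h a i k j = 0
    rw [e1, e2, sub_zero]
  · have e : 𝒱.variation h (single n v).adjoint =
        TriOp.swap23 (𝒱.variation h (single n v)) := by
      have hadj : (single n v : PDO D).adjoint = (dpow n).adjoint * single 0 v := by
        rw [adjoint_single, adjoint_dpow, smul_mul_assoc]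
      rw [hadj, variation_mul, adjoint_dpow, map_zsmul, variation_dpow, smul_zero, map_zero,
        zero_add, ← adjoint_dpow, adjoint_adjoint, variation_apply, variation_apply,
        TriOp.act3_mk, TriOp.swap23_mk]
      refine TriOp.mk_congr _ ?_
      rw [act3_dpow (𝒱.isWide_symbolPd h _)]
      funext i j k
      simp only [symbolPd, ofTwo, swap23, coeff_single, sub_eq_zero]
      split_ifs <;> first | rfl | (rw [frechet_zero]; rfl)
    rw [variation_apply, variation_apply, TriOp.swap23_mk, TriOp.mk_eq_iff] at e
    exact e

end DiffFunctions

/-! ### Adjoints of matrices. -/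

section AdjointMatrix

variable {F V : Type*} [Field F] [CommRing V] [Algebra F V] {D : Derivation F V V}

theorem adjointMatrix_apply {r s : ℕ} (M : Matrix (Fin r) (Fin s) (PDO D)) (i : Fin s)
    (j : Fin r) : adjointMatrix M i j = (M j i).adjoint := rfl

theorem adjointMatrix_mul {r s t : ℕ} (M : Matrix (Fin r) (Fin s) (PDO D))
    (N : Matrix (Fin s) (Fin t) (PDO D)) :
    adjointMatrix (M * N) = adjointMatrix N * adjointMatrix M := by
  ext1 i j
  simp only [adjointMatrix_apply, Matrix.mul_apply, PDO.adjoint_sum, PDO.adjoint_mul]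

theorem adjointMatrix_sub {r s : ℕ} (M N : Matrix (Fin r) (Fin s) (PDO D)) :
    adjointMatrix (M - N) = adjointMatrix M - adjointMatrix N := by
  ext1 i j
  exact PDO.adjoint_sub _ _

theorem adjointMatrix_adjointMatrix {r s : ℕ} (M : Matrix (Fin r) (Fin s) (PDO D)) :
    adjointMatrix (adjointMatrix M) = M := by
  ext1 i j
  exact PDO.adjoint_adjoint _

theorem adjointMatrix_one {r : ℕ} :
    adjointMatrix (1 : Matrix (Fin r) (Fin r) (PDO D)) = 1 := by
  ext1 i j
  rw [adjointMatrix_apply, Matrix.one_apply, Matrix.one_apply]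
  by_cases h : i = j
  · rw [if_pos h, if_pos h.symm, PDO.adjoint_one]
  · rw [if_neg h, if_neg (Ne.symm h), PDO.adjoint_zero]

end AdjointMatrix

/-! ### Differentiating the Dirac modification in an abstract ring. -/

section Derivations

open MulOpposite TrivSqZeroExt

variable {R M : Type*} [Ring R] [AddCommGroup M]

/-- The entrywise application of `d`, inside the square zero extension. -/
def mapInr {ι κ : Type*} (d : R →+ M) (A : Matrix ι κ R) : Matrix ι κ (TrivSqZeroExt R M) :=
  A.map fun a => inr (d a)

/-- The entrywise inclusion of a matrix into the square zero extension. -/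
def mapInl {ι κ : Type*} (M : Type*) [AddCommGroup M] (A : Matrix ι κ R) :
    Matrix ι κ (TrivSqZeroExt R M) := A.map inl

theorem mapInl_sub {ι κ : Type*} (A B : Matrix ι κ R) :
    mapInl M (A - B) = mapInl M A - mapInl M B := by
  ext1 i j
  simp only [mapInl, Matrix.map_apply, Matrix.sub_apply, inl_sub]

theorem mapInl_one {ι : Type*} [DecidableEq ι] : mapInl M (1 : Matrix ι ι R) = 1 := by
  ext1 i j
  simp only [mapInl, Matrix.map_apply, Matrix.one_apply]
  split_ifs <;> simp

theorem mapInr_sub {ι κ : Type*} (d : R →+ M) (A B : Matrix ι κ R) :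
    mapInr d (A - B) = mapInr d A - mapInr d B := by
  ext1 i j
  simp only [mapInr, Matrix.map_apply, Matrix.sub_apply, map_sub, inr_sub]

variable [Module R M] [Module Rᵐᵒᵖ M]

theorem mapInl_mul {ι κ σ : Type*} [Fintype κ] (A : Matrix ι κ R) (B : Matrix κ σ R) :
    mapInl M (A * B) = mapInl M A * mapInl M B := by
  ext1 i j
  simp only [mapInl, Matrix.map_apply, Matrix.mul_apply, inl_sum, inl_mul]

theorem mapInr_mul {ι κ σ : Type*} [Fintype κ] {d : R →+ M}
    (hd : ∀ a b, d (a * b) = op b • d a + a • d b) (A : Matrix ι κ R) (B : Matrix κ σ R) :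
    mapInr d (A * B) = mapInr d A * mapInl M B + mapInl M A * mapInr d B := by
  ext1 i j
  simp only [mapInl, mapInr, Matrix.map_apply, Matrix.mul_apply, Matrix.add_apply, map_sum, inr_sum,
    hd, inr_add, Finset.sum_add_distrib, inl_mul_inr, inr_mul_inl]

theorem mapInl_mul_mapInr_mul_mapInl_apply {ι κ σ τ : Type*} [Fintype κ] [Fintype σ]
    (d : R →+ M) (A : Matrix ι κ R) (B : Matrix κ σ R) (C : Matrix σ τ R) (i : ι) (j : τ) :
    (mapInl M A * mapInr d B * mapInl M C) i j =
      inr (∑ b, op (C b j) • ∑ a, A i a • d (B a b)) := by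
  simp only [mapInl, mapInr, Matrix.map_apply, Matrix.mul_apply, inl_mul_inr, ← inr_sum,
    inr_mul_inl]

/-- The derivative of the Dirac modification `H - H S C⁻¹ N H`, where `C = N H S`. -/
theorem derivation_diracModification [SMulCommClass R Rᵐᵒᵖ M] {ι κ : Type*} [Fintype ι]
    [Fintype κ] [DecidableEq ι] [DecidableEq κ] {d : R →+ M} (hd : ∀ a b, d (a * b) = op b • d a + a • d b)
    {H : Matrix ι ι R} {N : Matrix κ ι R} {S : Matrix ι κ R} {c : Matrix κ κ R}
    (h1 : N * H * S * c = 1) (h2 : c * (N * H * S) = 1) (k j : ι) :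
    d ((H - H * S * c * N * H) k j) =
      ∑ b, op ((1 - S * c * N * H : Matrix ι ι R) b j) • ∑ a, (1 - H * S * c * N : Matrix ι ι R) k a • d (H a b) -
      ∑ b, op ((c * N * H) b j) • ∑ a, (H - H * S * c * N * H) k a • d (S a b) -
      ∑ b, op ((H - H * S * c * N * H) b j) • ∑ a, (H * S * c) k a • d (N a b) := by
  have hd1 : d 1 = 0 := by
    have h := hd 1 1
    rw [mul_one, op_one, one_smul, one_smul] at h
    exact left_eq_add.1 h
  have hdone : mapInr d (1 : Matrix κ κ R) = 0 := by
    ext1 i j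
    simp only [mapInr, Matrix.map_apply, Matrix.one_apply]
    split_ifs <;> simp [hd1]
  have h1' : mapInl M N * mapInl M H * mapInl M S * mapInl M c = 1 := by
    rw [← mapInl_mul, ← mapInl_mul, ← mapInl_mul, h1, mapInl_one]
  have h2' : mapInl M c * (mapInl M N * mapInl M H * mapInl M S) = 1 := by
    rw [← mapInl_mul, ← mapInl_mul, ← mapInl_mul, h2, mapInl_one]
  -- The derivative of an inverse. Inside the square zero extension scalars and derivatives are
  -- matrices over one ring, so the bimodule computation becomes plain matrix algebra.
  have hdc : mapInr d c = -(mapInl M c * mapInr d (N * H * S) * mapInl M c) := by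
    have h := mapInr_mul hd (N * H * S) c
    rw [h1, hdone, mapInl_mul, mapInl_mul] at h
    have h' := congrArg (mapInl M c * ·) h
    simp only [Matrix.mul_zero, Matrix.mul_add] at h'
    rw [← Matrix.mul_assoc _ _ (mapInr d c), h2', Matrix.one_mul, ← Matrix.mul_assoc] at h'
    exact eq_neg_of_add_eq_zero_right h'.symm
  have key : mapInr d (H - H * S * c * N * H) =
      mapInl M (1 - H * S * c * N) * mapInr d H * mapInl M (1 - S * c * N * H) -
      mapInl M (H - H * S * c * N * H) * mapInr d S * mapInl M (c * N * H) -
      mapInl M (H * S * c) * mapInr d N * mapInl M (H - H * S * c * N * H) := by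
    simp only [mapInr_sub, mapInr_mul hd, hdc, mapInl_sub, mapInl_mul, mapInl_one]
    simp only [Matrix.mul_add, Matrix.add_mul, Matrix.mul_sub, Matrix.sub_mul, Matrix.mul_neg,
      Matrix.neg_mul, ← Matrix.mul_assoc, Matrix.one_mul, Matrix.mul_one]
    abel
  have h := congrFun (congrFun key k) j
  rw [Matrix.sub_apply, Matrix.sub_apply, mapInl_mul_mapInr_mul_mapInl_apply,
    mapInl_mul_mapInr_mul_mapInl_apply, mapInl_mul_mapInr_mul_mapInl_apply, ← inr_sub,
    ← inr_sub] at h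
  exact inr_injective h

end Derivations

/-! ### Representatives of trilinear operators and their transport. -/

section Represents

variable {F V : Type*} [Field F] [CommRing V] [Algebra F V] {D : Derivation F V V}

/-- The family `T` represents the trilinear operator `x`. -/
def Represents (T : ℤ → ℤ → ℤ → V) (x : TriOp D) : Prop := ∃ hT : IsWide T, TriOp.mk D T hT = x

namespace Represents

variable {S T : ℤ → ℤ → ℤ → V} {x y : TriOp D}

theorem add (hS : Represents S x) (hT : Represents T y) : Represents (S + T) (x + y) := by
  obtain ⟨hS, rfl⟩ := hS
  obtain ⟨hT, rfl⟩ := hT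
  exact ⟨hS.add hT, rfl⟩

theorem sub (hS : Represents S x) (hT : Represents T y) : Represents (S - T) (x - y) := by
  obtain ⟨hS, rfl⟩ := hS
  obtain ⟨hT, rfl⟩ := hT
  exact ⟨hS.sub hT, rfl⟩

theorem sum {ι : Type*} {s : Finset ι} {S : ι → ℤ → ℤ → ℤ → V} {x : ι → TriOp D}
    (h : ∀ i, Represents (S i) (x i)) : Represents (∑ i ∈ s, S i) (∑ i ∈ s, x i) := by
  classical
  induction s using Finset.induction_on with
  | empty => exact ⟨isWide_zero, rfl⟩
  | insert i s hi ih => rw [Finset.sum_insert hi, Finset.sum_insert hi]; exact (h i).add ih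

theorem act1 (hT : Represents T x) (L : PDO D) : Represents (act1 T L) (TriOp.act1 L x) := by
  obtain ⟨hT, rfl⟩ := hT
  exact ⟨hT.act1 L, rfl⟩

theorem act2 (hT : Represents T x) (L : PDO D) : Represents (act2 T L) (TriOp.act2 L x) := by
  obtain ⟨hT, rfl⟩ := hT
  exact ⟨hT.act2 L, rfl⟩

theorem act3 (hT : Represents T x) (L : PDO D) : Represents (act3 T L) (TriOp.act3 L x) := by
  obtain ⟨hT, rfl⟩ := hT
  exact ⟨hT.act3 L, rfl⟩

theorem swap23 (hT : Represents T x) : Represents (swap23 T) (TriOp.swap23 x) := by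
  obtain ⟨hT, rfl⟩ := hT
  exact ⟨hT.swap23, rfl⟩

theorem isNull_sub (hS : Represents S x) (hT : Represents T x) : IsNull D (S - T) := by
  obtain ⟨hS, rfl⟩ := hS
  obtain ⟨hT, h⟩ := hT
  exact (TriOp.mk_eq_iff hS hT).1 h.symm

theorem of_isNull_sub (hT : Represents T x) (hS : IsWide S) (h : IsNull D (S - T)) :
    Represents S x := by
  obtain ⟨hT, rfl⟩ := hT
  exact ⟨hS, (TriOp.mk_eq_iff hS hT).2 h⟩

end Represents

theorem IsTripleSeries.sum {ι : Type*} {s : Finset ι} {S : ι → ℤ → ℤ → ℤ → V}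
    (h : ∀ i ∈ s, IsTripleSeries (S i)) : IsTripleSeries (∑ i ∈ s, S i) :=
  Finset.sum_induction S IsTripleSeries (fun _ _ => IsTripleSeries.add) isTripleSeries_zero h

/-- Right composition in all three variables. -/
def act123 (T : ℤ → ℤ → ℤ → V) (L₁ L₂ L₃ : PDO D) : ℤ → ℤ → ℤ → V :=
  act1 (act2 (act3 T L₃) L₂) L₁

theorem IsTripleSeries.act123 {T : ℤ → ℤ → ℤ → V} (hT : IsTripleSeries T) (L₁ L₂ L₃ : PDO D) :
    IsTripleSeries (act123 T L₁ L₂ L₃) := ((hT.act3 L₃).act2 L₂).act1 L₁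

theorem act123_add {S T : ℤ → ℤ → ℤ → V} (hS : IsWide S) (hT : IsWide T) (L₁ L₂ L₃ : PDO D) :
    act123 (S + T) L₁ L₂ L₃ = act123 S L₁ L₂ L₃ + act123 T L₁ L₂ L₃ := by
  rw [act123, act3_add hS hT, act2_add (hS.act3 _) (hT.act3 _),
    act1_add ((hS.act3 _).act2 _) ((hT.act3 _).act2 _)]
  rfl

theorem act123_sub {S T : ℤ → ℤ → ℤ → V} (hS : IsWide S) (hT : IsWide T) (L₁ L₂ L₃ : PDO D) :
    act123 (S - T) L₁ L₂ L₃ = act123 S L₁ L₂ L₃ - act123 T L₁ L₂ L₃ := by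
  rw [eq_sub_iff_add_eq, ← act123_add (hS.sub hT) hT, sub_add_cancel]

theorem act123_neg {T : ℤ → ℤ → ℤ → V} (hT : IsWide T) (L₁ L₂ L₃ : PDO D) :
    act123 (-T) L₁ L₂ L₃ = -act123 T L₁ L₂ L₃ := by
  have h := act123_sub hT hT L₁ L₂ L₃
  rw [sub_self, sub_self] at h
  rw [← zero_sub, act123_sub isWide_zero hT, h, zero_sub]

theorem act123_total {T : ℤ → ℤ → ℤ → V} (hT : IsWide T) (L₁ L₂ L₃ : PDO D) :
    act123 (total D T) L₁ L₂ L₃ = total D (act123 T L₁ L₂ L₃) := by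
  rw [act123, act3_total hT, act2_total (hT.act3 _), act1_total ((hT.act3 _).act2 _)]
  rfl

theorem swap12_act123_swap12 {T : ℤ → ℤ → ℤ → V} (hT : IsWide T) (L₁ L₂ L₃ : PDO D) :
    swap12 (act123 (swap12 T) L₁ L₂ L₃) = act123 T L₂ L₁ L₃ := by
  change act2 (act1 (act3 T L₃) L₂) L₁ = _
  rw [← act1_act2 (hT.act3 _)]
  rfl

theorem rotate_rotate_act123_rotate {T : ℤ → ℤ → ℤ → V} (hT : IsWide T) (L₁ L₂ L₃ : PDO D) :
    rotate (rotate (act123 (rotate T) L₁ L₂ L₃)) = act123 T L₂ L₃ L₁ := by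
  change act3 (act1 (act2 T L₃) L₂) L₁ = _
  rw [act1_act2 hT, ← act2_act3 (hT.act1 _), ← act1_act3 hT, ← act1_act2 (hT.act3 _)]
  rfl

theorem total_sum {ι : Type*} (s : Finset ι) (T : ι → ℤ → ℤ → ℤ → V) :
    total D (∑ i ∈ s, T i) = ∑ i ∈ s, total D (T i) :=
  map_sum (AddMonoidHom.mk' (total D) (total_add D)) T s

variable {n : ℕ} (A : Matrix (Fin n) (Fin n) (PDO D))

/-- Transport of a three-tensor of families along a matrix operator. -/
def transport (X : Fin n → Fin n → Fin n → ℤ → ℤ → ℤ → V) (i j k : Fin n) : ℤ → ℤ → ℤ → V :=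
  ∑ a, ∑ b, ∑ c, act123 (X a b c) (A a i) (A b j) (A c k)

end Represents

/-! ### The Jacobi identity as an identity of trilinear operators. -/

namespace DiffFunctions

open PDO

variable {F V : Type*} [Field F] [CommRing V] [Algebra F V] {D : Derivation F V V} {ℓ : ℕ}
  (𝒱 : DiffFunctions D ℓ)

theorem bracket_u_left (H : Matrix (Fin ℓ) (Fin ℓ) (PDO D)) (i : Fin ℓ) (f : V) :
    𝒱.bracket H (𝒱.u i) f = ∑ h, 𝒱.frechet f h * H h i := by
  rw [bracket, Finset.sum_eq_single i]
  · simp only [frechet_u, if_true, adjoint_one, mul_one]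
  · intro b _ hb
    simp only [frechet_u, if_neg hb, adjoint_zero, mul_zero, Finset.sum_const_zero]
  · exact fun h => absurd (Finset.mem_univ i) h

theorem bracket_u_right (H : Matrix (Fin ℓ) (Fin ℓ) (PDO D)) (f : V) (k : Fin ℓ) :
    𝒱.bracket H f (𝒱.u k) = ∑ h, H k h * (𝒱.frechet f h).adjoint := by
  refine Finset.sum_congr rfl fun h _ => ?_
  simp only [frechet_u, ite_mul, one_mul, zero_mul, Finset.sum_ite_eq', Finset.mem_univ, if_true]

theorem bracket_u_u (H : Matrix (Fin ℓ) (Fin ℓ) (PDO D)) (i j : Fin ℓ) :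
    𝒱.bracket H (𝒱.u i) (𝒱.u j) = H j i := by
  rw [bracket_u_left]
  simp only [frechet_u, ite_mul, one_mul, zero_mul, Finset.sum_ite_eq', Finset.mem_univ, if_true]

/-- The coefficients of `{u_i λ {u_j μ u_k}}`. -/
def doubleBracket (H : Matrix (Fin ℓ) (Fin ℓ) (PDO D)) (i j k : Fin ℓ) (r s : ℤ) : V :=
  (𝒱.bracket H (𝒱.u i) ((H k j).coeff s)).coeff r

/-- The trilinear operator `{u_i λ {u_j μ u_k}}`. -/
def doubleBracketOp (H : Matrix (Fin ℓ) (Fin ℓ) (PDO D)) (i j k : Fin ℓ) : TriOp D :=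
  ∑ h, TriOp.act1 (H h i) (𝒱.variation h (H k j))

theorem represents_symbolPd (h : Fin ℓ) (a : PDO D) :
    Represents (𝒱.symbolPd h a) (𝒱.variation h a) := ⟨𝒱.isWide_symbolPd h a, rfl⟩

theorem act1_symbolPd (h : Fin ℓ) (a L : PDO D) :
    act1 (𝒱.symbolPd h a) L = ofTwo fun i j => (𝒱.frechet (a.coeff j) h * L).coeff i := by
  funext i j k
  by_cases hk : k = 0
  · subst hk
    rw [act1, show (fun i' => 𝒱.symbolPd h a i' j 0) = (𝒱.frechet (a.coeff j) h).coeff from rfl,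
      rmul_coeff]
    rfl
  · rw [act1, show (fun i' => 𝒱.symbolPd h a i' j k) = (0 : PDO D).coeff from
      funext fun i' => if_neg hk, rmul_coeff, zero_mul, coeff_zero, ofTwo, if_neg hk]

theorem represents_doubleBracket (H : Matrix (Fin ℓ) (Fin ℓ) (PDO D)) (i j k : Fin ℓ) :
    Represents (ofTwo (𝒱.doubleBracket H i j k)) (𝒱.doubleBracketOp H i j k) := by
  have h : ofTwo (𝒱.doubleBracket H i j k) =
      ∑ h, act1 (𝒱.symbolPd h (H k j)) (H h i) := by
    simp only [act1_symbolPd]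
    funext r s t
    simp only [Finset.sum_apply, ofTwo, doubleBracket, bracket_u_left, coeff_sum]
    split_ifs
    · rfl
    · rw [Finset.sum_const_zero]
  rw [h]
  exact Represents.sum fun h => (𝒱.represents_symbolPd h (H k j)).act1 (H h i)

theorem represents_doubleBracketOp_iff (H : Matrix (Fin ℓ) (Fin ℓ) (PDO D)) (i j k : Fin ℓ)
    {X : ℤ → ℤ → ℤ → V} (hX : IsWide X) : Represents X (𝒱.doubleBracketOp H i j k) ↔
      IsNull D (X - ofTwo (𝒱.doubleBracket H i j k)) :=
  ⟨fun h => h.isNull_sub (𝒱.represents_doubleBracket H i j k),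
    fun h => (𝒱.represents_doubleBracket H i j k).of_isNull_sub hX h⟩

/-- Skewsymmetry of the bracket: the adjoint moves the inner bracket to the right-hand argument, so
the third Jacobi term takes the shape of the other two with indices permuted cyclically. -/
theorem adjFun_bracket {H : Matrix (Fin ℓ) (Fin ℓ) (PDO D)} (hH : adjointMatrix H = -H)
    (i j k : Fin ℓ) (r s : ℤ) :
    adjFun D (fun t => (𝒱.bracket H ((𝒱.bracket H (𝒱.u i) (𝒱.u j)).coeff s) (𝒱.u k)).coeff t) r =
      -𝒱.doubleBracket H k i j r s := by
  change (𝒱.bracket H ((𝒱.bracket H (𝒱.u i) (𝒱.u j)).coeff s) (𝒱.u k)).adjoint.coeff r = _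
  rw [doubleBracket, ← coeff_neg, bracket_u_u, bracket_u_right, bracket_u_left, adjoint_sum,
    ← Finset.sum_neg_distrib]
  congr 1
  refine Finset.sum_congr rfl fun h _ => ?_
  rw [adjoint_mul, adjoint_adjoint, ← adjointMatrix_apply, hH, Matrix.neg_apply, mul_neg]

/-- The Jacobi identity on generators for a skewadjoint operator, in terms of trilinear
operators. -/
theorem jacobi_iff {H : Matrix (Fin ℓ) (Fin ℓ) (PDO D)} (hH : adjointMatrix H = -H)
    (i j k : Fin ℓ) : 𝒱.Jacobi H (𝒱.u i) (𝒱.u j) (𝒱.u k) ↔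
      ∃ X Y Z : ℤ → ℤ → ℤ → V, IsTripleSeries X ∧ IsTripleSeries Y ∧ IsTripleSeries Z ∧
        Represents X (𝒱.doubleBracketOp H i j k) ∧
        Represents (swap12 Y) (𝒱.doubleBracketOp H j i k) ∧
        Represents (-rotate Z) (𝒱.doubleBracketOp H k i j) ∧
        ∃ W, IsTripleSeries W ∧ X - Y - Z = total D W := by
  -- The three terms are translated separately by `e1`, `e2` and `e3`; each embedding condition
  -- becomes representation of a class after the adjoint in ν.
  have e1 : ∀ X : ℤ → ℤ → ℤ → V, IsTripleSeries X →
      ((∀ r s, expandMuLam X r s =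
        (𝒱.bracket H (𝒱.u i) ((𝒱.bracket H (𝒱.u j) (𝒱.u k)).coeff s)).coeff r) ↔
      Represents (adjThird D X) (𝒱.doubleBracketOp H i j k)) := fun X hX => by
    rw [𝒱.represents_doubleBracketOp_iff H i j k hX.isWide.adjThird,
      ← expandMuLam_eq_iff_isNull hX.isWide, bracket_u_u]
    rfl
  have e2 : ∀ Y : ℤ → ℤ → ℤ → V, IsTripleSeries Y →
      ((∀ r s, expandLamMu Y r s =
        (𝒱.bracket H (𝒱.u j) ((𝒱.bracket H (𝒱.u i) (𝒱.u k)).coeff r)).coeff s) ↔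
      Represents (swap12 (adjThird D Y)) (𝒱.doubleBracketOp H j i k)) := fun Y hY => by
    change _ ↔ Represents (adjThird D (swap12 Y)) _
    rw [𝒱.represents_doubleBracketOp_iff H j i k hY.swap12.isWide.adjThird,
      ← expandMuLam_eq_iff_isNull hY.swap12.isWide, bracket_u_u]
    simp only [expandLamMu_eq]
    exact forall_comm
  have e3 : ∀ Z : ℤ → ℤ → ℤ → V, IsTripleSeries Z →
      ((∀ r t, expandLamNu Z r t =
        (𝒱.bracket H ((𝒱.bracket H (𝒱.u i) (𝒱.u j)).coeff r) (𝒱.u k)).coeff t) ↔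
      Represents (-rotate (adjThird D Z)) (𝒱.doubleBracketOp H k i j)) := fun Z hZ => by
    rw [𝒱.represents_doubleBracketOp_iff H k i j hZ.adjThird.rotate.neg.isWide]
    have h := expandLamNu_eq_iff_isNull (D := D) hZ (R := fun r t =>
      (𝒱.bracket H ((𝒱.bracket H (𝒱.u i) (𝒱.u j)).coeff r) (𝒱.u k)).coeff t)
      fun r => PDO.coeff_mem _
    rw [h]
    have hn : (ofTwo fun r s => adjFun D (fun t =>
        (𝒱.bracket H ((𝒱.bracket H (𝒱.u i) (𝒱.u j)).coeff s) (𝒱.u k)).coeff t) r) =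
        -ofTwo (𝒱.doubleBracket H k i j) := by
      funext r s t
      simp only [ofTwo, Pi.neg_apply, 𝒱.adjFun_bracket hH]
      split_ifs
      · rfl
      · rw [neg_zero]
    rw [hn, sub_neg_eq_add]
    constructor
    · intro h
      have := h.neg
      rwa [neg_add'] at this
    · intro h
      have := h.neg
      rwa [neg_sub_left, neg_neg, add_comm] at this
  constructor
  · rintro ⟨X, Y, Z, hX, hY, hZ, h1, h2, h3, W, hW, h4⟩
    -- The sign in the witness compensates the one in `adjThird_relation`.
    refine ⟨_, _, _, hX.adjThird, hY.adjThird, hZ.adjThird, (e1 X hX).1 h1, (e2 Y hY).1 h2,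
      (e3 Z hZ).1 h3, -adjThird D W, hW.adjThird.neg, ?_⟩
    have h : X - Y - Z = relation W := by
      funext i j k; exact h4 i j k
    rw [← adjThird_sub hX.isWide hY.isWide, ← adjThird_sub (hX.sub hY).isWide hZ.isWide, h,
      adjThird_relation hW.isWide, total_neg]
  · rintro ⟨X, Y, Z, hX, hY, hZ, h1, h2, h3, W, hW, h4⟩
    refine ⟨adjThird D X, adjThird D Y, adjThird D Z, hX.adjThird, hY.adjThird, hZ.adjThird,
      (e1 _ hX.adjThird).2 ?_, (e2 _ hY.adjThird).2 ?_, (e3 _ hZ.adjThird).2 ?_,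
      -adjThird D W, hW.adjThird.neg, ?_⟩
    · rwa [adjThird_adjThird hX.isWide]
    · rwa [adjThird_adjThird hY.isWide]
    · rwa [adjThird_adjThird hZ.isWide]
    · have h : adjThird D X - adjThird D Y - adjThird D Z = relation (-adjThird D W) := by
        rw [← adjThird_sub hX.isWide hY.isWide, ← adjThird_sub (hX.sub hY).isWide hZ.isWide, h4]
        have h5 := adjThird_relation (D := D) (hW.isWide.adjThird (D := D)).neg
        rw [adjThird_neg (D := D) (hW.isWide.adjThird (D := D)), adjThird_adjThird hW.isWide,
          total_neg, neg_neg] at h5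
        rw [← h5, adjThird_adjThird (hW.isWide.adjThird (D := D)).neg.relation]
      intro i j k
      exact congrFun (congrFun (congrFun h i) j) k

end DiffFunctions

/-! ### Transport by one matrix in all three slots. -/

section Transport

variable {F V : Type*} [Field F] [CommRing V] [Algebra F V] {D : Derivation F V V}
  {n : ℕ} (A : Matrix (Fin n) (Fin n) (PDO D))

theorem swap12_sum {ι : Type*} (s : Finset ι) (T : ι → ℤ → ℤ → ℤ → V) :
    swap12 (∑ i ∈ s, T i) = ∑ i ∈ s, swap12 (T i) := by
  funext i j k; simp only [swap12, Finset.sum_apply]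

theorem rotate_sum {ι : Type*} (s : Finset ι) (T : ι → ℤ → ℤ → ℤ → V) :
    rotate (∑ i ∈ s, T i) = ∑ i ∈ s, rotate (T i) := by
  funext i j k; simp only [rotate, Finset.sum_apply]

theorem isTripleSeries_transport {X : Fin n → Fin n → Fin n → ℤ → ℤ → ℤ → V}
    (hX : ∀ a b c, IsTripleSeries (X a b c)) (i j k : Fin n) :
    IsTripleSeries (transport A X i j k) :=
  IsTripleSeries.sum fun a _ => IsTripleSeries.sum fun b _ => IsTripleSeries.sum fun c _ =>
    (hX a b c).act123 _ _ _

theorem transport_sub {X Y : Fin n → Fin n → Fin n → ℤ → ℤ → ℤ → V}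
    (hX : ∀ a b c, IsTripleSeries (X a b c)) (hY : ∀ a b c, IsTripleSeries (Y a b c))
    (i j k : Fin n) : transport A (fun a b c => X a b c - Y a b c) i j k =
      transport A X i j k - transport A Y i j k := by
  simp only [transport, act123_sub (hX _ _ _).isWide (hY _ _ _).isWide, Finset.sum_sub_distrib]

theorem transport_total {W : Fin n → Fin n → Fin n → ℤ → ℤ → ℤ → V}
    (hW : ∀ a b c, IsTripleSeries (W a b c)) (i j k : Fin n) :
    transport A (fun a b c => total D (W a b c)) i j k = total D (transport A W i j k) := by
  simp only [transport, act123_total (hW _ _ _).isWide, total_sum]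

/-- Since the same matrix acts in every slot and actions in different slots commute, transport is
compatible with permuting slots and indices together. This and the cyclic version below let the
three Jacobi terms be transported consistently. -/
theorem swap12_transport {Y : Fin n → Fin n → Fin n → ℤ → ℤ → ℤ → V}
    (hY : ∀ a b c, IsTripleSeries (Y a b c)) (i j k : Fin n) :
    swap12 (transport A (fun a b c => swap12 (Y b a c)) j i k) = transport A Y i j k := by
  simp only [transport, swap12_sum, swap12_act123_swap12 (hY _ _ _).isWide]
  exact Finset.sum_comm

theorem rotate_rotate_transport {Z : Fin n → Fin n → Fin n → ℤ → ℤ → ℤ → V}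
    (hZ : ∀ a b c, IsTripleSeries (Z a b c)) (i j k : Fin n) :
    rotate (rotate (transport A (fun a b c => -rotate (Z b c a)) k i j)) =
      -transport A Z i j k := by
  have hneg : ∀ T : ℤ → ℤ → ℤ → V, rotate (rotate (-T)) = -rotate (rotate T) := fun T => rfl
  simp only [transport, rotate_sum, act123_neg (hZ _ _ _).rotate.isWide, hneg,
    rotate_rotate_act123_rotate (hZ _ _ _).isWide, Finset.sum_neg_distrib]
  rw [neg_inj, Finset.sum_comm]
  exact Finset.sum_congr rfl fun b _ => Finset.sum_comm

theorem represents_transport {X : Fin n → Fin n → Fin n → ℤ → ℤ → ℤ → V}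
    {x : Fin n → Fin n → Fin n → TriOp D} (hX : ∀ a b c, Represents (X a b c) (x a b c))
    (i j k : Fin n) : Represents (transport A X i j k) (∑ a, ∑ b, ∑ c,
      TriOp.act1 (A a i) (TriOp.act2 (A b j) (TriOp.act3 (A c k) (x a b c)))) :=
  Represents.sum fun a => Represents.sum fun b => Represents.sum fun c =>
    (((hX a b c).act3 _).act2 _).act1 _

end Transport

/-! ### The double bracket of the Dirac modification. -/

namespace DiffFunctions

open PDO MulOpposite

variable {F V : Type*} [Field F] [CommRing V] [Algebra F V] {D : Derivation F V V} {ℓ : ℕ}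
  (𝒱 : DiffFunctions D ℓ)

/-- The derivation of `PDO D` into trilinear operators in the direction of the `i`-th column of
`G`. -/
def columnVariation (G : Matrix (Fin ℓ) (Fin ℓ) (PDO D)) (i : Fin ℓ) : PDO D →+ TriOp D :=
  ∑ h, (TriOp.act1 (G h i)).comp (𝒱.variation h)

theorem columnVariation_apply (G : Matrix (Fin ℓ) (Fin ℓ) (PDO D)) (i : Fin ℓ) (a : PDO D) :
    𝒱.columnVariation G i a = ∑ h, TriOp.act1 (G h i) (𝒱.variation h a) := by
  simp [columnVariation]

theorem columnVariation_mul (G : Matrix (Fin ℓ) (Fin ℓ) (PDO D)) (i : Fin ℓ) (a b : PDO D) :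
    𝒱.columnVariation G i (a * b) =
      op b • 𝒱.columnVariation G i a + a • 𝒱.columnVariation G i b := by
  rw [TriOp.op_smul_def, TriOp.smul_def]
  simp only [columnVariation_apply, variation_mul, map_add, map_sum, Finset.sum_add_distrib,
    TriOp.act1_act2, TriOp.act1_act3]

theorem columnVariation_adjoint (G : Matrix (Fin ℓ) (Fin ℓ) (PDO D)) (i : Fin ℓ) (a : PDO D) :
    𝒱.columnVariation G i a.adjoint = TriOp.swap23 (𝒱.columnVariation G i a) := by
  simp only [columnVariation_apply, variation_adjoint, map_sum, TriOp.swap23_act1]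

theorem doubleBracketOp_eq (G : Matrix (Fin ℓ) (Fin ℓ) (PDO D)) (i j k : Fin ℓ) :
    𝒱.doubleBracketOp G i j k = 𝒱.columnVariation G i (G k j) :=
  (𝒱.columnVariation_apply G i (G k j)).symm

/-- The columns of H A are combinations of those of H, so differentiating along them only adds an
action of A in the first slot. -/
theorem columnVariation_mul_matrix (H A : Matrix (Fin ℓ) (Fin ℓ) (PDO D)) (i b a : Fin ℓ) :
    𝒱.columnVariation (H * A) i (H a b) =
      ∑ e, TriOp.act1 (A e i) (𝒱.doubleBracketOp H e b a) := by
  simp only [columnVariation_apply, doubleBracketOp, Matrix.mul_apply, TriOp.act1_sum,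
    TriOp.act1_mul, map_sum]
  exact Finset.sum_comm

theorem swap12_symbolPd_frechet (f : V) (g h : Fin ℓ) :
    swap12 (𝒱.symbolPd h (𝒱.frechet f g)) = 𝒱.symbolPd g (𝒱.frechet f h) := by
  funext i j k
  simp only [swap12, symbolPd, ofTwo, frechet_coeff]
  split_ifs <;> first | rfl | exact 𝒱.pd_comm _ _ _ _ _ | simp

/-- The Frechet derivative is a differential operator, so it has finitely many nonzero coefficients
and their orders of differentiation are bounded together. Thus the Hessian terms lie in V_{λ,μ} and
not merely among wide families. -/
theorem isTripleSeries_symbolPd_frechet (f : V) (g h : Fin ℓ) :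
    IsTripleSeries (𝒱.symbolPd h (𝒱.frechet f g)) := by
  obtain ⟨M, hM⟩ := (𝒱.frechet f g).exists_ordLE
  choose B hB using fun j => (𝒱.frechet ((𝒱.frechet f g).coeff j) h).exists_ordLE
  obtain ⟨K, hK⟩ := ((Finset.Icc 0 M).image B).exists_le
  refine ⟨max K (max M 0), fun i j k hijk => ?_⟩
  rw [symbolPd, ofTwo]
  split_ifs with hk
  · by_cases hj : j ∈ Finset.Icc 0 M
    · have := hK _ (Finset.mem_image_of_mem B hj)
      rw [Finset.mem_Icc] at hj
      exact hB j i (by omega)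
    · have : (𝒱.frechet f g).coeff j = 0 := by
        rw [Finset.mem_Icc] at hj
        by_cases h0 : j < 0
        · exact 𝒱.isDifferential_frechet f g j h0
        · exact hM j (by omega)
      rw [this, frechet_zero, coeff_zero]
  · rfl

variable {m : ℕ} (θ : Fin m → V)

/-- The second Frechet derivative of `θ`, composed with `G`, `G` and `E`. -/
def hessian (G : Matrix (Fin ℓ) (Fin ℓ) (PDO D)) (E : Matrix (Fin m) (Fin ℓ) (PDO D))
    (i j k : Fin ℓ) : ℤ → ℤ → ℤ → V :=
  ∑ g, ∑ h, ∑ α, act123 (𝒱.symbolPd h (𝒱.frechetMatrix θ α g)) (G h i) (G g j) (E α k)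

theorem isTripleSeries_hessian (G : Matrix (Fin ℓ) (Fin ℓ) (PDO D))
    (E : Matrix (Fin m) (Fin ℓ) (PDO D)) (i j k : Fin ℓ) :
    IsTripleSeries (𝒱.hessian θ G E i j k) :=
  IsTripleSeries.sum fun g _ => IsTripleSeries.sum fun h _ => IsTripleSeries.sum fun α _ =>
    (𝒱.isTripleSeries_symbolPd_frechet (θ α) g h).act123 _ _ _

theorem swap12_hessian (G : Matrix (Fin ℓ) (Fin ℓ) (PDO D))
    (E : Matrix (Fin m) (Fin ℓ) (PDO D)) (i j k : Fin ℓ) :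
    swap12 (𝒱.hessian θ G E i j k) = 𝒱.hessian θ G E j i k := by
  simp only [hessian, swap12_sum]
  rw [Finset.sum_comm]
  refine Finset.sum_congr rfl fun h _ => Finset.sum_congr rfl fun g _ =>
    Finset.sum_congr rfl fun α _ => ?_
  change swap12 (act123 (𝒱.symbolPd h (𝒱.frechet (θ α) g)) _ _ _) =
    act123 (𝒱.symbolPd g (𝒱.frechet (θ α) h)) _ _ _
  rw [← 𝒱.swap12_symbolPd_frechet (θ α) h g,
    swap12_act123_swap12 (𝒱.isTripleSeries_symbolPd_frechet (θ α) h g).isWide]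

theorem represents_hessian (G : Matrix (Fin ℓ) (Fin ℓ) (PDO D))
    (E : Matrix (Fin m) (Fin ℓ) (PDO D)) (i j k : Fin ℓ) :
    Represents (𝒱.hessian θ G E i j k) (∑ g, TriOp.act2 (G g j) (∑ α, TriOp.act3 (E α k)
      (𝒱.columnVariation G i (𝒱.frechetMatrix θ α g)))) := by
  have h : ∑ g, TriOp.act2 (G g j) (∑ α, TriOp.act3 (E α k)
      (𝒱.columnVariation G i (𝒱.frechetMatrix θ α g))) = ∑ g, ∑ h, ∑ α,
      TriOp.act1 (G h i) (TriOp.act2 (G g j) (TriOp.act3 (E α k)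
        (𝒱.variation h (𝒱.frechetMatrix θ α g)))) := by
    refine Finset.sum_congr rfl fun g _ => ?_
    simp only [columnVariation_apply, map_sum, TriOp.act1_act2, TriOp.act1_act3]
    exact Finset.sum_comm
  rw [h]
  exact Represents.sum fun g => Represents.sum fun h => Represents.sum fun α =>
    (((𝒱.represents_symbolPd h _).act3 _).act2 _).act1 _

section Dirac

variable {H : Matrix (Fin ℓ) (Fin ℓ) (PDO D)} {c : Matrix (Fin m) (Fin m) (PDO D)}

theorem adjointMatrix_constraintMatrix (hH : adjointMatrix H = -H) :
    adjointMatrix (𝒱.constraintMatrix H θ) = -𝒱.constraintMatrix H θ := by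
  rw [constraintMatrix, adjointMatrix_mul, adjointMatrix_mul, adjointMatrix_adjointMatrix, hH,
    Matrix.neg_mul, Matrix.mul_neg, Matrix.mul_assoc]

theorem adjointMatrix_constraintMatrix_inv (hH : adjointMatrix H = -H)
    (h1 : 𝒱.constraintMatrix H θ * c = 1) : adjointMatrix c = -c := by
  have h := congrArg adjointMatrix h1
  rw [adjointMatrix_mul, adjointMatrix_one, 𝒱.adjointMatrix_constraintMatrix θ hH,
    Matrix.mul_neg, ← Matrix.neg_mul] at h
  have h' := congrArg (· * c) h
  simp only [Matrix.mul_assoc, h1, Matrix.mul_one, Matrix.one_mul] at h'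
  exact neg_eq_iff_eq_neg.1 h'

theorem adjointMatrix_diracModification (hH : adjointMatrix H = -H)
    (h1 : 𝒱.constraintMatrix H θ * c = 1) :
    adjointMatrix (𝒱.diracModification H θ c) = -𝒱.diracModification H θ c := by
  simp only [diracModification, adjointMatrix_sub, adjointMatrix_mul, adjointMatrix_adjointMatrix,
    hH, 𝒱.adjointMatrix_constraintMatrix_inv θ hH h1, Matrix.neg_mul, Matrix.mul_neg,
    Matrix.mul_assoc]
  abel

/-- The derivative formula for G along its own i-th column, with explicit representatives. The dS
term is the dN term with slots 2 and 3 exchanged because S = N*. -/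
theorem doubleBracketOp_diracModification (hH : adjointMatrix H = -H)
    (h1 : 𝒱.constraintMatrix H θ * c = 1) (h2 : c * 𝒱.constraintMatrix H θ = 1)
    {X : Fin ℓ → Fin ℓ → Fin ℓ → ℤ → ℤ → ℤ → V}
    (hX : ∀ i j k, Represents (X i j k) (𝒱.doubleBracketOp H i j k)) (i j k : Fin ℓ) :
    Represents (transport (1 - adjointMatrix (𝒱.frechetMatrix θ) * c * 𝒱.frechetMatrix θ * H) X i j k
      + swap23 (𝒱.hessian θ (𝒱.diracModification H θ c) (c * 𝒱.frechetMatrix θ * H) i k j)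
      - 𝒱.hessian θ (𝒱.diracModification H θ c) (c * 𝒱.frechetMatrix θ * H) i j k)
      (𝒱.doubleBracketOp (𝒱.diracModification H θ c) i j k) := by
  set N := 𝒱.frechetMatrix θ with hN
  set S := adjointMatrix N with hS
  set A := 1 - S * c * N * H with hA
  set G := 𝒱.diracModification H θ c with hG
  have hG' : G = H * A := by
    rw [hA, Matrix.mul_sub, Matrix.mul_one, hG, diracModification]
    simp only [Matrix.mul_assoc]
    rfl
  have hcs := 𝒱.adjointMatrix_constraintMatrix_inv θ hH h1
  have hGs : adjointMatrix G = -G := 𝒱.adjointMatrix_diracModification θ hH h1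
  have hSs : adjointMatrix S = N := adjointMatrix_adjointMatrix N
  -- The left factor acts in the third slot through its adjoint; the signs of H and c cancel, so the
  -- same `A` occurs in all three slots.
  have hP : adjointMatrix (1 - H * S * c * N) = A := by
    simp only [adjointMatrix_sub, adjointMatrix_one, adjointMatrix_mul, hH, hcs, hSs, hA,
      Matrix.neg_mul, Matrix.mul_neg, Matrix.mul_assoc, neg_neg]
    rfl
  have hW : adjointMatrix (H * S * c) = c * N * H := by
    simp only [adjointMatrix_mul, hH, hcs, hSs, Matrix.neg_mul, Matrix.mul_neg, Matrix.mul_assoc,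
      neg_neg]
  have key := derivation_diracModification (d := 𝒱.columnVariation G i)
    (𝒱.columnVariation_mul G i) (H := H) (N := N) (S := S) (c := c) h1 h2 k j
  have hform : 𝒱.doubleBracketOp G i j k =
      (∑ e, ∑ b, ∑ a, TriOp.act1 (A e i) (TriOp.act2 (A b j) (TriOp.act3 (A a k)
        (𝒱.doubleBracketOp H e b a)))) +
      TriOp.swap23 (∑ g, TriOp.act2 (G g k) (∑ α, TriOp.act3 ((c * N * H) α j)
        (𝒱.columnVariation G i (N α g)))) -
      ∑ g, TriOp.act2 (G g j) (∑ α, TriOp.act3 ((c * N * H) α k)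
        (𝒱.columnVariation G i (N α g))) := by
    rw [doubleBracketOp_eq]
    refine key.trans ?_
    rw [sub_eq_add_neg (∑ b, _) (∑ b, _)]
    congr 1
    · congr 1
      · simp only [TriOp.op_smul_def, TriOp.smul_def, ← adjointMatrix_apply, hP]
        rw [hG']
        simp only [columnVariation_mul_matrix, map_sum, TriOp.act1_act2, TriOp.act1_act3]
        symm
        rw [Finset.sum_comm]
        refine Finset.sum_congr rfl fun b _ => ?_
        rw [Finset.sum_comm]
      · have hGa : ∀ a b, (G a b).adjoint = -G b a := fun a b => congrFun (congrFun hGs b) a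
        have hSa : ∀ a b, S a b = (N b a).adjoint := fun _ _ => rfl
        simp only [TriOp.op_smul_def, TriOp.smul_def]
        change -∑ x, TriOp.act2 ((c * N * H) x j) (∑ g, TriOp.act3 (G k g).adjoint _) = _
        simp only [hGa, hSa, columnVariation_adjoint, TriOp.act3_neg, map_sum, map_neg,
          TriOp.swap23_act2, TriOp.swap23_act3, Finset.sum_neg_distrib, neg_neg, TriOp.act2_act3]
        exact Finset.sum_comm
    · simp only [TriOp.op_smul_def, TriOp.smul_def, ← adjointMatrix_apply, hW]
      rfl
  rw [hform]
  exact ((represents_transport A hX i j k).add (𝒱.represents_hessian θ G _ i k j).swap23).sub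
    (𝒱.represents_hessian θ G _ i j k)

end Dirac

end DiffFunctions

/-! ### The Dirac modification is a Poisson structure. -/

namespace DiffFunctions

open PDO

variable {F V : Type*} [Field F] [CommRing V] [Algebra F V] {D : Derivation F V V} {ℓ : ℕ}
  (𝒱 : DiffFunctions D ℓ) {m : ℕ} (θ : Fin m → V)
  {H : Matrix (Fin ℓ) (Fin ℓ) (PDO D)} {c : Matrix (Fin m) (Fin m) (PDO D)}

theorem jacobi_diracModification (hH : adjointMatrix H = -H)
    (hJ : ∀ i j k, 𝒱.Jacobi H (𝒱.u i) (𝒱.u j) (𝒱.u k))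
    (h1 : 𝒱.constraintMatrix H θ * c = 1) (h2 : c * 𝒱.constraintMatrix H θ = 1) (i j k : Fin ℓ) :
    𝒱.Jacobi (𝒱.diracModification H θ c) (𝒱.u i) (𝒱.u j) (𝒱.u k) := by
  rw [𝒱.jacobi_iff (𝒱.adjointMatrix_diracModification θ hH h1)]
  choose X Y Z hX hY hZ rX rY rZ W hW hXYZ using fun i j k => (𝒱.jacobi_iff hH i j k).1 (hJ i j k)
  have tX := 𝒱.doubleBracketOp_diracModification θ hH h1 h2 rX i j k
  have tY := 𝒱.doubleBracketOp_diracModification θ hH h1 h2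
    (X := fun a b c => swap12 (Y b a c)) (fun a b c => rY b a c) j i k
  have tZ := 𝒱.doubleBracketOp_diracModification θ hH h1 h2
    (X := fun a b c => -rotate (Z b c a)) (fun a b c => rZ b c a) k i j
  set A := 1 - adjointMatrix (𝒱.frechetMatrix θ) * c * 𝒱.frechetMatrix θ * H
  set t := 𝒱.hessian θ (𝒱.diracModification H θ c) (c * 𝒱.frechetMatrix θ * H) with ht
  have hts : ∀ a b c, IsTripleSeries (t a b c) := 𝒱.isTripleSeries_hessian θ _ _
  have hsw : ∀ a b c p q r, t b a c q p r = t a b c p q r := fun a b c p q r =>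
    congrFun (congrFun (congrFun (𝒱.swap12_hessian θ _ _ b a c) p) q) r
  -- The lemma represents `swap12 Y` and `-rotate Z`, so the series themselves are recovered by the
  -- inverse permutations; the inverse of `rotate` is its square.
  refine ⟨_, swap12 (transport A (fun a b c => swap12 (Y b a c)) j i k + swap23 (t j k i) -
      t j i k), -rotate (rotate (transport A (fun a b c => -rotate (Z b c a)) k i j +
      swap23 (t k j i) - t k i j)), ?_, ?_, ?_, tX, tY, ?_, transport A W i j k,
      isTripleSeries_transport A hW i j k, ?_⟩
  · exact ((isTripleSeries_transport A hX i j k).add (hts _ _ _).swap23).sub (hts _ _ _)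
  · exact (((isTripleSeries_transport A (fun a b c => (hY b a c).swap12) j i k).add
      (hts _ _ _).swap23).sub (hts _ _ _)).swap12
  · exact (((isTripleSeries_transport A (fun a b c => (hZ b c a).rotate.neg) k i j).add
      (hts _ _ _).swap23).sub (hts _ _ _)).rotate.rotate.neg
  · have h3 : ∀ T : ℤ → ℤ → ℤ → V, -rotate (-rotate (rotate T)) = T := fun T =>
      neg_neg (rotate (rotate (rotate T)))
    rw [h3]
    exact tZ
  · have e1 := swap12_transport A hY i j k
    have e2 := rotate_rotate_transport A hZ i j k
    have e3 : transport A (fun a b c => X a b c - Y a b c - Z a b c) i j k =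
        total D (transport A W i j k) := by
      rw [← transport_total A hW]
      simp only [hXYZ]
    rw [transport_sub A (fun a b c => (hX a b c).sub (hY a b c)) hZ, transport_sub A hX hY] at e3
    rw [← e3]
    funext p q r
    have e1' := congrFun (congrFun (congrFun e1 p) q) r
    have e2' := congrFun (congrFun (congrFun e2 p) q) r
    simp only [swap12, swap23, rotate, Pi.add_apply, Pi.sub_apply, Pi.neg_apply] at e1' e2' ⊢
    rw [e1', e2', hsw j i k q p r, hsw k j i r q p, hsw k i j r p q]
    ring

theorem IsPoisson.diracModification [CharZero F] [IsDomain V] (hH : 𝒱.IsPoisson H)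
    (h1 : 𝒱.constraintMatrix H θ * c = 1) (h2 : c * 𝒱.constraintMatrix H θ = 1) :
    𝒱.IsPoisson (𝒱.diracModification H θ c) where
  skewadjoint := 𝒱.adjointMatrix_diracModification θ hH.skewadjoint h1
  rational := by
    have hN : ∀ i j, (𝒱.frechetMatrix θ i j).IsRational := fun α i =>
      (𝒱.isDifferential_frechet (θ α) i).isRational
    have hS : ∀ i j, (adjointMatrix (𝒱.frechetMatrix θ) i j).IsRational := fun i α =>
      (𝒱.isDifferential_frechet (θ α) i).adjoint.isRational
    have hc := IsRational.of_mul_eq_one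
      (IsRational.matrix_mul (IsRational.matrix_mul hN hH.rational) hS) h1
    intro i j
    rw [DiffFunctions.diracModification, sub_eq_add_neg]
    exact (hH.rational i j).add (IsRational.matrix_mul (IsRational.matrix_mul
      (IsRational.matrix_mul (IsRational.matrix_mul hH.rational hS) hc) hN) hH.rational i j).neg
  jacobi := 𝒱.jacobi_diracModification θ hH.skewadjoint hH.jacobi h1 h2

end DiffFunctions

/-! ### The modified partial derivatives. -/

namespace PDO

variable {F V : Type*} [Field F] [CommRing V] [Algebra F V] {D : Derivation F V V}

theorem IsDifferential.mul_coeff_eq_finsum {a : PDO D} (ha : a.IsDifferential) (b : PDO D)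
    (n : ℤ) : (a * b).coeff n = ∑ᶠ i : ℕ, a.coeff i * (dpow i * b).coeff n := by
  obtain ⟨N, hN⟩ := a.exists_ordLE
  obtain ⟨M, hM⟩ := b.exists_ordLE
  have hN' : a.OrdLE (N.toNat : ℤ) := fun i hi => hN i (by omega)
  have hM' : b.OrdLE (max M n) := fun i hi => hM i (lt_of_le_of_lt (le_max_left _ _) hi)
  rw [mul_coeff_eq_sum_dpow a b hN' hM',
    finsum_eq_sum_of_support_subset (s := Finset.range (N.toNat + 1)) _ fun i hi => by
      by_contra h
      rw [Finset.mem_coe, Finset.mem_range] at h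
      exact hi (mul_eq_zero_of_left (hN' i (by omega)) _)]
  refine ((Finset.sum_map (Finset.range (N.toNat + 1)) Nat.castEmbedding
    fun i : ℤ => a.coeff i * (dpow i * b).coeff n).symm.trans ?_).symm
  refine Finset.sum_subset (fun i hi => ?_) fun i hi h => ?_
  · obtain ⟨j, hj, rfl⟩ := Finset.mem_map.1 hi
    rw [Finset.mem_range] at hj
    rw [Finset.mem_Icc, Nat.castEmbedding_apply]
    have := le_max_right M n
    omega
  · by_cases h0 : i < 0
    · rw [ha i h0, zero_mul]
    · refine absurd (Finset.mem_map.2 ⟨i.toNat, ?_, ?_⟩) h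
      · rw [Finset.mem_Icc] at hi
        rw [Finset.mem_range]; omega
      · rw [Nat.castEmbedding_apply]; omega

end PDO

namespace DiffFunctions

open PDO

variable {F V : Type*} [Field F] [CommRing V] [Algebra F V] {D : Derivation F V V}

section

variable {ℓ : ℕ} (𝒱 : DiffFunctions D ℓ)

theorem frechet_iterate (f : V) (i : Fin ℓ) (n : ℕ) :
    𝒱.frechet (D^[n] f) i = dpow n * 𝒱.frechet f i := by
  induction n with
  | zero => exact (dpow_zero_mul _).symm
  | succ n ih => rw [Function.iterate_succ_apply', frechet_D, ih, Nat.cast_succ, dpow_succ_mul]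

theorem frechet_algebraMap (r : F) (i : Fin ℓ) : 𝒱.frechet (algebraMap F V r) i = 0 := by
  ext n; simp [frechet_coeff]

end

variable {k m : ℕ} (𝒱 : DiffFunctions D (k + m)) (p : Fin m → V)

/-- The Frechet derivative with respect to the modified partial derivatives. -/
def modifiedFrechet (f : V) (i : Fin k) : PDO D :=
  𝒱.frechet f (Fin.castAdd m i) -
    ∑ α, 𝒱.frechet f (Fin.natAdd k α) * 𝒱.frechet (p α) (Fin.castAdd m i)

theorem isDifferential_modifiedFrechet (f : V) (i : Fin k) :
    (𝒱.modifiedFrechet p f i).IsDifferential := by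
  rw [modifiedFrechet, sub_eq_add_neg]
  exact (𝒱.isDifferential_frechet _ _).add (IsDifferential.sum fun α _ =>
    (𝒱.isDifferential_frechet _ _).mul (𝒱.isDifferential_frechet _ _)).neg

/-- The Frechet derivative of ∂ⁿp is ∂ⁿ∘D_p, so the correction sum is a coefficient of a composition
of differential operators. This makes commutation with ∂ formal. -/
theorem modifiedPd_eq_coeff (i : Fin k) (s : ℕ) (f : V) :
    𝒱.modifiedPd p i s f = (𝒱.modifiedFrechet p f i).coeff s := by
  rw [modifiedPd, modifiedFrechet, coeff_sub, frechet_coeff_natCast, coeff_sum]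
  congr 1
  refine Finset.sum_congr rfl fun α _ => ?_
  rw [(𝒱.isDifferential_frechet f _).mul_coeff_eq_finsum]
  refine finsum_congr fun n => ?_
  rw [← frechet_iterate, frechet_coeff_natCast, frechet_coeff_natCast, mul_comm]

theorem modifiedFrechet_add (f g : V) (i : Fin k) : 𝒱.modifiedFrechet p (f + g) i =
    𝒱.modifiedFrechet p f i + 𝒱.modifiedFrechet p g i := by
  simp only [modifiedFrechet, frechet_add, add_mul, Finset.sum_add_distrib]
  abel

theorem modifiedFrechet_mul (f g : V) (i : Fin k) : 𝒱.modifiedFrechet p (f * g) i =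
    f • 𝒱.modifiedFrechet p g i + g • 𝒱.modifiedFrechet p f i := by
  simp only [modifiedFrechet, frechet_mul, add_mul, PDO.smul_mul, Finset.sum_add_distrib,
    smul_sub, Finset.smul_sum]
  abel

theorem modifiedFrechet_algebraMap (r : F) (i : Fin k) :
    𝒱.modifiedFrechet p (algebraMap F V r) i = 0 := by
  simp [modifiedFrechet, frechet_algebraMap]

theorem modifiedFrechet_D (f : V) (i : Fin k) :
    𝒱.modifiedFrechet p (D f) i = dmul (𝒱.modifiedFrechet p f i) := by
  simp only [modifiedFrechet, frechet_D, dmul_mul, map_sub, map_sum]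

theorem modifiedFrechet_iterate (f : V) (i : Fin k) (n : ℕ) :
    𝒱.modifiedFrechet p (D^[n] f) i = dpow n * 𝒱.modifiedFrechet p f i := by
  simp only [modifiedFrechet, frechet_iterate, mul_assoc, mul_sub, Finset.mul_sum]

theorem modifiedFrechet_u (i j : Fin k) :
    𝒱.modifiedFrechet p (𝒱.u (Fin.castAdd m j)) i = if i = j then 1 else 0 := by
  have h : ∀ α, (Fin.natAdd k α : Fin (k + m)) ≠ Fin.castAdd m j := fun α h => by
    have := congrArg Fin.val h
    simp at this
    omega
  simp [modifiedFrechet, frechet_u, h]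

/-- The modified partial derivative, as a derivation. -/
def modifiedDerivation (i : Fin k) (s : ℕ) : Derivation F V V :=
  Derivation.mk'
    { toFun := 𝒱.modifiedPd p i s
      map_add' := fun f g => by
        simp only [modifiedPd_eq_coeff, modifiedFrechet_add, coeff_add]
      map_smul' := fun r f => by
        simp only [modifiedPd_eq_coeff, Algebra.smul_def, modifiedFrechet_mul,
          modifiedFrechet_algebraMap, smul_zero, add_zero, coeff_smul, RingHom.id_apply] }
    fun f g => by
      simp only [LinearMap.coe_mk, AddHom.coe_mk, modifiedPd_eq_coeff, modifiedFrechet_mul,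
        coeff_add, coeff_smul, smul_eq_mul]

theorem modifiedDerivation_apply (i : Fin k) (s : ℕ) (f : V) :
    𝒱.modifiedDerivation p i s f = 𝒱.modifiedPd p i s f := rfl

theorem modifiedPd_eq_sum {f : V} {T : Finset (Fin m × ℕ)}
    (hT : ∀ q ∉ T, 𝒱.pd (Fin.natAdd k q.1) q.2 f = 0) (i : Fin k) (s : ℕ) :
    𝒱.modifiedPd p i s f = 𝒱.pd (Fin.castAdd m i) s f -
      ∑ q ∈ T, 𝒱.pd (Fin.castAdd m i) s (D^[q.2] (p q.1)) * 𝒱.pd (Fin.natAdd k q.1) q.2 f := by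
  have h : ∑ q ∈ T, 𝒱.pd (Fin.castAdd m i) s (D^[q.2] (p q.1)) *
      𝒱.pd (Fin.natAdd k q.1) q.2 f =
      ∑ q ∈ Finset.univ ×ˢ T.image Prod.snd, 𝒱.pd (Fin.castAdd m i) s (D^[q.2] (p q.1)) *
      𝒱.pd (Fin.natAdd k q.1) q.2 f := by
    refine Finset.sum_subset (fun q hq => ?_) fun q _ hq => by rw [hT q hq, mul_zero]
    exact Finset.mem_product.2 ⟨Finset.mem_univ _, Finset.mem_image_of_mem _ hq⟩
  rw [modifiedPd, h, Finset.sum_product]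
  congr 1
  refine Finset.sum_congr rfl fun α _ => finsum_eq_sum_of_support_subset _ fun n hn => ?_
  by_contra hn'
  refine hn ?_
  change _ * _ = _
  rw [hT (α, n) fun hq => hn' (Finset.mem_coe.2 (Finset.mem_image_of_mem Prod.snd hq)), mul_zero]

variable {p}

theorem frechet_natAdd_eq_zero (hp : ∀ α β n, 𝒱.pd (Fin.natAdd k β) n (p α) = 0)
    (α β : Fin m) : 𝒱.frechet (p α) (Fin.natAdd k β) = 0 := by
  ext n
  rw [frechet_coeff, hp, ite_self]
  rfl

theorem pd_natAdd_iterate (hp : ∀ α β n, 𝒱.pd (Fin.natAdd k β) n (p α) = 0)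
    (α β : Fin m) (n r : ℕ) :
    𝒱.pd (Fin.natAdd k β) n (D^[r] (p α)) = 0 := by
  rw [← frechet_coeff_natCast, frechet_iterate, 𝒱.frechet_natAdd_eq_zero hp, mul_zero, coeff_zero]

/-- The modified derivatives are partial derivatives in the coordinates (u₁, …, u_{ℓ−m}, θ). As p
does not depend on the last variables, expanding leaves only terms that are symmetric in the two
derivatives. -/
theorem modifiedPd_comm (hp : ∀ α β n, 𝒱.pd (Fin.natAdd k β) n (p α) = 0)
    (i : Fin k) (s : ℕ) (j : Fin k) (r : ℕ) (f : V) :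
    𝒱.modifiedPd p i s (𝒱.modifiedPd p j r f) = 𝒱.modifiedPd p j r (𝒱.modifiedPd p i s f) := by
  classical
  have hfin : {q : Fin m × ℕ | 𝒱.pd (Fin.natAdd k q.1) q.2 f ≠ 0}.Finite :=
    (𝒱.pd_finite f).preimage (f := fun q : Fin m × ℕ => (Fin.natAdd k q.1, q.2))
      fun a _ b _ h => by
        rw [Prod.mk.injEq, Fin.natAdd_inj] at h
        exact Prod.ext h.1 h.2
  set T := hfin.toFinset
  have hT : ∀ q ∉ T, 𝒱.pd (Fin.natAdd k q.1) q.2 f = 0 := fun q hq => by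
    by_contra h
    exact hq (hfin.mem_toFinset.2 h)
  -- Independence of p from the last variables enters here: their partial derivatives pass through
  -- the coefficients of the correction term.
  have hmod : ∀ (i : Fin k) (s : ℕ) (q : Fin m × ℕ), 𝒱.pd (Fin.natAdd k q.1) q.2
      (𝒱.modifiedPd p i s f) = 𝒱.pd (Fin.castAdd m i) s (𝒱.pd (Fin.natAdd k q.1) q.2 f) -
      ∑ q' ∈ T, 𝒱.pd (Fin.castAdd m i) s (D^[q'.2] (p q'.1)) *
        𝒱.pd (Fin.natAdd k q'.1) q'.2 (𝒱.pd (Fin.natAdd k q.1) q.2 f) := fun i s q => by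
    rw [𝒱.modifiedPd_eq_sum p hT, map_sub, map_sum, 𝒱.pd_comm]
    congr 1
    refine Finset.sum_congr rfl fun q' _ => ?_
    rw [Derivation.leibniz, 𝒱.pd_comm _ _ (Fin.castAdd m i), 𝒱.pd_natAdd_iterate hp, map_zero,
      smul_zero, add_zero, smul_eq_mul, 𝒱.pd_comm]
  have hmodT : ∀ (i : Fin k) (s : ℕ), ∀ q ∉ T,
      𝒱.pd (Fin.natAdd k q.1) q.2 (𝒱.modifiedPd p i s f) = 0 := fun i s q hq => by
    rw [hmod, hT q hq]
    simp
  have key : ∀ (i : Fin k) (s : ℕ) (j : Fin k) (r : ℕ),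
      𝒱.modifiedPd p i s (𝒱.modifiedPd p j r f) =
      𝒱.pd (Fin.castAdd m i) s (𝒱.pd (Fin.castAdd m j) r f) -
      ∑ q ∈ T, (𝒱.pd (Fin.castAdd m i) s (𝒱.pd (Fin.castAdd m j) r (D^[q.2] (p q.1))) *
          𝒱.pd (Fin.natAdd k q.1) q.2 f) -
      (∑ q ∈ T, 𝒱.pd (Fin.castAdd m j) r (D^[q.2] (p q.1)) *
        𝒱.pd (Fin.castAdd m i) s (𝒱.pd (Fin.natAdd k q.1) q.2 f) +
      ∑ q ∈ T, 𝒱.pd (Fin.castAdd m i) s (D^[q.2] (p q.1)) *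
        𝒱.pd (Fin.castAdd m j) r (𝒱.pd (Fin.natAdd k q.1) q.2 f)) +
      ∑ q ∈ T, ∑ q' ∈ T, 𝒱.pd (Fin.castAdd m i) s (D^[q.2] (p q.1)) *
        (𝒱.pd (Fin.castAdd m j) r (D^[q'.2] (p q'.1)) *
        𝒱.pd (Fin.natAdd k q'.1) q'.2 (𝒱.pd (Fin.natAdd k q.1) q.2 f)) := fun i s j r => by
    rw [𝒱.modifiedPd_eq_sum p (hmodT j r)]
    simp only [hmod]
    rw [𝒱.modifiedPd_eq_sum p hT]
    simp only [map_sub, map_sum, Derivation.leibniz, smul_eq_mul, mul_sub, Finset.mul_sum,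
      Finset.sum_sub_distrib, Finset.sum_add_distrib]
    simp only [mul_comm (𝒱.pd (Fin.natAdd k _) _ f)]
    ring
  rw [key, key j r i s, 𝒱.pd_comm (Fin.castAdd m i) s (Fin.castAdd m j) r f]
  congr 1
  · congr 1
    · congr 1
      refine Finset.sum_congr rfl fun q _ => ?_
      rw [𝒱.pd_comm]
    · exact add_comm _ _
  · rw [Finset.sum_comm]
    refine Finset.sum_congr rfl fun q _ => Finset.sum_congr rfl fun q' _ => ?_
    rw [𝒱.pd_comm (Fin.natAdd k q.1)]
    ring

variable (hp : ∀ α β n, 𝒱.pd (Fin.natAdd k β) n (p α) = 0)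

/-- The algebra of differential functions in the first variables, with the modified partial
derivatives. -/
def reduction : DiffFunctions D k where
  u i := 𝒱.u (Fin.castAdd m i)
  pd := 𝒱.modifiedDerivation p
  algebraicIndependent := 𝒱.algebraicIndependent.comp
    (fun q : Fin k × ℕ => (Fin.castAdd m q.1, q.2)) fun a b h => by
      rw [Prod.mk.injEq, Fin.castAdd_inj] at h
      exact Prod.ext h.1 h.2
  pd_u i n j r := by
    rw [modifiedDerivation_apply, modifiedPd_eq_coeff, modifiedFrechet_iterate, modifiedFrechet_u]
    by_cases h : i = j
    · simp [h, coeff_dpow]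
    · simp [h]
  pd_comm := 𝒱.modifiedPd_comm hp
  pd_finite f := by
    choose N hN using fun i => (𝒱.modifiedFrechet p f i).exists_ordLE
    refine (Set.finite_univ.prod (Set.finite_iUnion fun i => Set.finite_Iic (N i).toNat)).subset
      fun q hq => ⟨Set.mem_univ _, Set.mem_iUnion.2 ⟨q.1, ?_⟩⟩
    by_contra h
    rw [Set.mem_Iic] at h
    refine hq ?_
    rw [modifiedDerivation_apply, modifiedPd_eq_coeff]
    exact hN q.1 q.2 (by omega)
  pd_D_zero i f := by
    simp only [modifiedDerivation_apply, modifiedPd_eq_coeff, modifiedFrechet_D, coeff_dmul]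
    rw [𝒱.isDifferential_modifiedFrechet p f i (((0 : ℕ) : ℤ) - 1) (by simp), add_zero, sub_self]
  pd_D_succ i n f := by
    simp only [modifiedDerivation_apply, modifiedPd_eq_coeff, modifiedFrechet_D, coeff_dmul]
    rw [add_sub_cancel_left]
    congr 1
    push_cast
    ring

theorem reduction_pd (i : Fin k) (s : ℕ) (f : V) :
    (𝒱.reduction hp).pd i s f = 𝒱.modifiedPd p i s f := rfl

theorem frechet_reduction (f : V) (i : Fin k) :
    (𝒱.reduction hp).frechet f i = 𝒱.modifiedFrechet p f i := by
  ext n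
  rw [frechet_coeff]
  split_ifs with hn
  · rw [reduction_pd, modifiedPd_eq_coeff, Int.toNat_of_nonneg hn]
  · exact (𝒱.isDifferential_modifiedFrechet p f i n (by omega)).symm

end DiffFunctions

/-! ### Reduction of the bracket to the first variables. -/

namespace DiffFunctions

open PDO

variable {F V : Type*} [Field F] [CommRing V] [Algebra F V] {D : Derivation F V V}

section

variable {ℓ m : ℕ} (𝒱 : DiffFunctions D ℓ) {θ : Fin m → V}
  {H : Matrix (Fin ℓ) (Fin ℓ) (PDO D)} {c : Matrix (Fin m) (Fin m) (PDO D)}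

/-- The constraints become central: N G = N H − (C c) N H. Together with its right-hand counterpart
this drives the reduction. -/
theorem frechetMatrix_mul_diracModification (h1 : 𝒱.constraintMatrix H θ * c = 1) :
    𝒱.frechetMatrix θ * 𝒱.diracModification H θ c = 0 := by
  have h : 𝒱.frechetMatrix θ * 𝒱.diracModification H θ c = 𝒱.frechetMatrix θ * H -
      𝒱.constraintMatrix H θ * c * (𝒱.frechetMatrix θ * H) := by
    simp only [diracModification, constraintMatrix, Matrix.mul_sub, Matrix.mul_assoc]
  rw [h, h1, Matrix.one_mul, sub_self]

theorem diracModification_mul_adjoint (h2 : c * 𝒱.constraintMatrix H θ = 1) :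
    𝒱.diracModification H θ c * adjointMatrix (𝒱.frechetMatrix θ) = 0 := by
  have h : 𝒱.diracModification H θ c * adjointMatrix (𝒱.frechetMatrix θ) =
      H * adjointMatrix (𝒱.frechetMatrix θ) -
      H * adjointMatrix (𝒱.frechetMatrix θ) * (c * 𝒱.constraintMatrix H θ) := by
    simp only [diracModification, constraintMatrix, Matrix.sub_mul, Matrix.mul_assoc]
  rw [h, h2, Matrix.mul_one, sub_self]

end

variable {k m : ℕ} (𝒱 : DiffFunctions D (k + m)) {p θ : Fin m → V}
  {H : Matrix (Fin (k + m)) (Fin (k + m)) (PDO D)} {c : Matrix (Fin m) (Fin m) (PDO D)}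

theorem frechet_constraint_castAdd (hθ : ∀ α, θ α = 𝒱.u (Fin.natAdd k α) + p α) (α : Fin m)
    (i : Fin k) : 𝒱.frechet (θ α) (Fin.castAdd m i) = 𝒱.frechet (p α) (Fin.castAdd m i) := by
  have h : (Fin.castAdd m i : Fin (k + m)) ≠ Fin.natAdd k α := fun h => by
    have := congrArg Fin.val h
    simp at this
    omega
  rw [hθ, frechet_add, frechet_u, if_neg h, zero_add]

theorem frechet_constraint_natAdd (hp : ∀ α β n, 𝒱.pd (Fin.natAdd k β) n (p α) = 0)
    (hθ : ∀ α, θ α = 𝒱.u (Fin.natAdd k α) + p α) (α β : Fin m) :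
    𝒱.frechet (θ α) (Fin.natAdd k β) = if β = α then 1 else 0 := by
  rw [hθ, frechet_add, frechet_u, 𝒱.frechet_natAdd_eq_zero hp, add_zero]
  simp only [Fin.natAdd_inj]

theorem frechetMatrix_mul_apply (hp : ∀ α β n, 𝒱.pd (Fin.natAdd k β) n (p α) = 0)
    (hθ : ∀ α, θ α = 𝒱.u (Fin.natAdd k α) + p α) {ι : Type*}
    (M : Matrix (Fin (k + m)) ι (PDO D)) (α : Fin m) (j : ι) :
    (𝒱.frechetMatrix θ * M) α j = ∑ i, 𝒱.frechet (p α) (Fin.castAdd m i) * M (Fin.castAdd m i) j +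
      M (Fin.natAdd k α) j := by
  simp only [Matrix.mul_apply, Fin.sum_univ_add, frechetMatrix, Matrix.of_apply,
    𝒱.frechet_constraint_castAdd hθ, 𝒱.frechet_constraint_natAdd hp hθ, ite_mul, one_mul, zero_mul,
    Finset.sum_ite_eq', Finset.mem_univ, if_true]

theorem mul_adjoint_frechetMatrix_apply (hp : ∀ α β n, 𝒱.pd (Fin.natAdd k β) n (p α) = 0)
    (hθ : ∀ α, θ α = 𝒱.u (Fin.natAdd k α) + p α) {ι : Type*}
    (M : Matrix ι (Fin (k + m)) (PDO D)) (i : ι) (α : Fin m) :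
    (M * adjointMatrix (𝒱.frechetMatrix θ)) i α =
      ∑ j, M i (Fin.castAdd m j) * (𝒱.frechet (p α) (Fin.castAdd m j)).adjoint +
      M i (Fin.natAdd k α) := by
  simp only [Matrix.mul_apply, Fin.sum_univ_add, adjointMatrix_apply, frechetMatrix,
    Matrix.of_apply, 𝒱.frechet_constraint_castAdd hθ, 𝒱.frechet_constraint_natAdd hp hθ,
    apply_ite adjoint, adjoint_one, adjoint_zero, mul_ite, mul_one, mul_zero,
    Finset.sum_ite_eq', Finset.mem_univ, if_true]

/-- Because D_θ = (D_p, 1), the factor B + A D_p* is the upper block of H D_θ*. Skewadjointness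
makes the lower left block −B*, so B* − D_p A is minus the left block of D_θ H. -/
theorem diracReduced_eq_submatrix (hp : ∀ α β n, 𝒱.pd (Fin.natAdd k β) n (p α) = 0)
    (hθ : ∀ α, θ α = 𝒱.u (Fin.natAdd k α) + p α) (hH : adjointMatrix H = -H) :
    𝒱.diracReduced H p c =
      (𝒱.diracModification H θ c).submatrix (Fin.castAdd m) (Fin.castAdd m) := by
  have e1 : H.submatrix (Fin.castAdd m) (Fin.natAdd k) +
      H.submatrix (Fin.castAdd m) (Fin.castAdd m) * adjointMatrix (𝒱.reducedFrechet p) =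
      (H * adjointMatrix (𝒱.frechetMatrix θ)).submatrix (Fin.castAdd m) id := by
    ext1 i α
    rw [Matrix.submatrix_apply, id, 𝒱.mul_adjoint_frechetMatrix_apply hp hθ, add_comm]
    rfl
  have e2 : adjointMatrix (H.submatrix (Fin.castAdd m) (Fin.natAdd k)) -
      𝒱.reducedFrechet p * H.submatrix (Fin.castAdd m) (Fin.castAdd m) =
      -(𝒱.frechetMatrix θ * H).submatrix id (Fin.castAdd m) := by
    ext1 α j
    have h : adjointMatrix (H.submatrix (Fin.castAdd m) (Fin.natAdd k)) α j =
        -H (Fin.natAdd k α) (Fin.castAdd m j) :=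
      congrFun (congrFun hH (Fin.natAdd k α)) (Fin.castAdd m j)
    rw [Matrix.neg_apply, Matrix.submatrix_apply, id, 𝒱.frechetMatrix_mul_apply hp hθ,
      Matrix.sub_apply, h, neg_add_rev, sub_eq_add_neg]
    rfl
  rw [diracReduced, e1, e2, Matrix.mul_neg, ← sub_eq_add_neg, diracModification]
  ext1 i j
  rw [Matrix.mul_assoc (H * _ * c)]
  rfl

/-- Solving D_θ G = 0 and G D_θ* = 0 for the last rows and columns and inserting the result leaves
D_g − (last part of D_g)∘D_p on the left, which is the modified Frechet derivative, and its adjoint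
form on the right. -/
theorem bracket_diracModification (hp : ∀ α β n, 𝒱.pd (Fin.natAdd k β) n (p α) = 0)
    (hθ : ∀ α, θ α = 𝒱.u (Fin.natAdd k α) + p α) (hH : adjointMatrix H = -H)
    (h1 : 𝒱.constraintMatrix H θ * c = 1) (h2 : c * 𝒱.constraintMatrix H θ = 1) (f g : V) :
    𝒱.bracket (𝒱.diracModification H θ c) f g =
      (𝒱.reduction hp).bracket (𝒱.diracReduced H p c) f g := by
  rw [𝒱.diracReduced_eq_submatrix hp hθ hH]
  set G := 𝒱.diracModification H θ c
  have hrow : ∀ α j, G (Fin.natAdd k α) j =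
      -∑ i, 𝒱.frechet (p α) (Fin.castAdd m i) * G (Fin.castAdd m i) j := fun α j => by
    have h := congrFun (congrFun (𝒱.frechetMatrix_mul_diracModification h1) α) j
    rw [𝒱.frechetMatrix_mul_apply hp hθ] at h
    exact (neg_eq_of_add_eq_zero_right h).symm
  have hcol : ∀ i α, G i (Fin.natAdd k α) = -∑ j, G i (Fin.castAdd m j) *
      (𝒱.frechet (p α) (Fin.castAdd m j)).adjoint := fun i α => by
    have h := congrFun (congrFun (𝒱.diracModification_mul_adjoint h2) i) α
    rw [𝒱.mul_adjoint_frechetMatrix_apply hp hθ] at h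
    exact (neg_eq_of_add_eq_zero_right h).symm
  have hleft : ∀ i, ∑ j, 𝒱.frechet g j * G j i =
      ∑ j, 𝒱.modifiedFrechet p g j * G (Fin.castAdd m j) i := fun i => by
    simp only [Fin.sum_univ_add, hrow, modifiedFrechet, sub_mul, Finset.sum_sub_distrib, mul_neg,
      Finset.sum_neg_distrib, Finset.mul_sum, Finset.sum_mul, mul_assoc]
    rw [Finset.sum_comm, sub_eq_add_neg]
  have hright : ∀ j, ∑ i, G j i * (𝒱.frechet f i).adjoint =
      ∑ i, G j (Fin.castAdd m i) * (𝒱.modifiedFrechet p f i).adjoint := fun j => by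
    simp only [Fin.sum_univ_add, hcol, modifiedFrechet, mul_sub, adjoint_sub, adjoint_sum,
      adjoint_mul, Finset.sum_sub_distrib, neg_mul,
      Finset.sum_neg_distrib, Finset.mul_sum, Finset.sum_mul, mul_assoc]
    rw [Finset.sum_comm, sub_eq_add_neg]
  simp only [bracket, frechet_reduction, Matrix.submatrix_apply, ← Finset.sum_mul, hleft]
  simp only [Finset.sum_mul, mul_assoc]
  rw [Finset.sum_comm]
  simp only [← Finset.mul_sum, hright]
  simp only [Finset.mul_sum]
  exact Finset.sum_comm

theorem IsPoisson.diracReduced [CharZero F] [IsDomain V] {𝒱 : DiffFunctions D (k + m)}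
    (hH : 𝒱.IsPoisson H)
    (hp : ∀ α β n, 𝒱.pd (Fin.natAdd k β) n (p α) = 0)
    (hθ : ∀ α, θ α = 𝒱.u (Fin.natAdd k α) + p α)
    (h1 : 𝒱.constraintMatrix H θ * c = 1) (h2 : c * 𝒱.constraintMatrix H θ = 1) :
    (𝒱.reduction hp).IsPoisson (𝒱.diracReduced H p c) := by
  have h := IsPoisson.diracModification 𝒱 θ hH h1 h2
  have hsub := 𝒱.diracReduced_eq_submatrix (c := c) hp hθ hH.skewadjoint
  refine ⟨?_, fun i j => ?_, fun i j l => ?_⟩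
  · rw [hsub]
    ext1 i j
    exact congrFun (congrFun h.skewadjoint (Fin.castAdd m i)) (Fin.castAdd m j)
  · rw [hsub]
    exact h.rational _ _
  · have hJ := h.jacobi (Fin.castAdd m i) (Fin.castAdd m j) (Fin.castAdd m l)
    simp only [Jacobi, 𝒱.bracket_diracModification hp hθ hH.skewadjoint h1 h2] at hJ
    exact hJ

end DiffFunctions

/-! ### Change of coefficients along a differential ring homomorphism. -/

section MapCoeff

variable {F V W : Type*} [Field F] [CommRing V] [Algebra F V] [CommRing W] [Algebra F W]
  {D : Derivation F V V} {D' : Derivation F W W} (φ : V →+* W)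

namespace PDO

theorem coeff_mapCoeff (a : PDO D) (n : ℤ) :
    (a.mapCoeff (φ : V →+ W) : PDO D').coeff n = φ (a.coeff n) := rfl

theorem OrdLE.mapCoeff {a : PDO D} {N : ℤ} (ha : a.OrdLE N) :
    (a.mapCoeff (φ : V →+ W) : PDO D').OrdLE N := fun n hn => by
  rw [coeff_mapCoeff, ha n hn, map_zero]

theorem mapCoeff_sum {ι : Type*} (s : Finset ι) (f : ι → PDO D) :
    ((∑ i ∈ s, f i).mapCoeff (φ : V →+ W) : PDO D') =
      ∑ i ∈ s, (f i).mapCoeff (φ : V →+ W) := by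
  ext n
  simp only [coeff_mapCoeff, coeff_sum, map_sum]

theorem mapCoeff_neg (a : PDO D) :
    ((-a).mapCoeff (φ : V →+ W) : PDO D') = -a.mapCoeff (φ : V →+ W) := by
  ext n
  simp only [coeff_mapCoeff, coeff_neg, map_neg]

variable {φ}

theorem mapCoeff_mul (hφ : ∀ v, φ (D v) = D' (φ v)) (a b : PDO D) :
    ((a * b).mapCoeff (φ : V →+ W) : PDO D') =
      a.mapCoeff (φ : V →+ W) * b.mapCoeff (φ : V →+ W) := by
  have hit : ∀ (n : ℕ) v, φ (D^[n] v) = D'^[n] (φ v) := fun n =>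
    (Function.Semiconj.iterate_right (f := φ) (ga := D) (gb := D') hφ n)
  obtain ⟨N, hN⟩ := a.exists_ordLE
  obtain ⟨M, hM⟩ := b.exists_ordLE
  ext n
  rw [coeff_mapCoeff, mul_coeff_eq_sum hN hM, mul_coeff_eq_sum (hN.mapCoeff φ) (hM.mapCoeff φ),
    map_sum]
  simp only [map_zsmul, map_mul, hit, coeff_mapCoeff]

theorem mapCoeff_adjoint (hφ : ∀ v, φ (D v) = D' (φ v)) (a : PDO D) :
    (a.adjoint.mapCoeff (φ : V →+ W) : PDO D') = (a.mapCoeff (φ : V →+ W)).adjoint := by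
  have hit : ∀ (n : ℕ) v, φ (D^[n] v) = D'^[n] (φ v) := fun n =>
    (Function.Semiconj.iterate_right (f := φ) (ga := D) (gb := D') hφ n)
  obtain ⟨N, hN⟩ := a.exists_ordLE
  ext n
  rw [coeff_mapCoeff, adjoint_coeff_eq_sum (K := (N - n).toNat + 1) fun k hk => hN _ (by omega),
    adjoint_coeff_eq_sum (K := (N - n).toNat + 1) fun k hk => hN.mapCoeff φ _ (by omega), map_sum]
  simp only [map_zsmul, hit, coeff_mapCoeff]

end PDO

theorem adjointMatrix_map_mapCoeff {φ : V →+* W} (hφ : ∀ v, φ (D v) = D' (φ v)) {r s : ℕ}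
    (M : Matrix (Fin r) (Fin s) (PDO D)) :
    adjointMatrix (M.map (PDO.mapCoeff (φ : V →+ W)) : Matrix _ _ (PDO D')) =
      (adjointMatrix M).map (PDO.mapCoeff (φ : V →+ W)) := by
  ext1 i j
  exact (PDO.mapCoeff_adjoint hφ (M j i)).symm

theorem IsTripleSeries.map {X : ℤ → ℤ → ℤ → V} (hX : IsTripleSeries X) :
    IsTripleSeries fun i j k => φ (X i j k) := by
  obtain ⟨N, hN⟩ := hX
  exact ⟨N, fun i j k h => (congrArg φ (hN i j k h)).trans (map_zero φ)⟩

theorem expandMuLam_map {X : ℤ → ℤ → ℤ → V} (hX : IsTripleSeries X) (a b : ℤ) :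
    expandMuLam (fun i j k => φ (X i j k)) a b = φ (expandMuLam X a b) := by
  obtain ⟨N, hN⟩ := hX
  have h := (φ : V →+ W).map_finsum (f := fun q : ℕ × ℤ =>
    Ring.choose q.2 q.1 • X (a - q.1) (b - q.2 + q.1) q.2) (by
      refine ((Finset.range ((2 * N - b).toNat + 1)) ×ˢ Finset.Icc (b - N) N).finite_toSet.subset
        fun q hq => ?_
      have h1 : ¬(N < b - q.2 + q.1 ∨ N < q.2) := fun h => hq (by
        change Ring.choose q.2 q.1 • X (a - q.1) (b - q.2 + q.1) q.2 = 0
        rw [hN _ _ _ (Or.inr h), smul_zero])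
      rw [Finset.mem_coe, Finset.mem_product, Finset.mem_range, Finset.mem_Icc]
      omega)
  refine Eq.trans (finsum_congr fun q => ?_) h.symm
  exact (map_zsmul φ _ _).symm

theorem expandLamMu_map {X : ℤ → ℤ → ℤ → V} (hX : IsTripleSeries X) (a b : ℤ) :
    expandLamMu (fun i j k => φ (X i j k)) a b = φ (expandLamMu X a b) :=
  expandMuLam_map φ hX.swap12 b a

theorem expandLamNu_map {X : ℤ → ℤ → ℤ → V} (hX : IsTripleSeries X) (a c : ℤ) :
    expandLamNu (fun i j k => φ (X i j k)) a c = φ (expandLamNu X a c) := by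
  have hs : IsTripleSeries (signSecond (rotate X)) := by
    obtain ⟨N, hN⟩ := hX.rotate
    exact ⟨N, fun i j k h => by rw [signSecond, hN i j k h, smul_zero]⟩
  rw [expandLamNu_eq, expandLamNu_eq, map_zsmul, ← expandMuLam_map φ hs]
  congr 2
  funext i j k
  exact (map_zsmul φ _ _).symm

theorem VanishesModRelation.map {X : ℤ → ℤ → ℤ → V} (hX : VanishesModRelation X) :
    VanishesModRelation fun i j k => φ (X i j k) := by
  obtain ⟨T, hT, h⟩ := hX
  exact ⟨_, hT.map φ, fun i j k => by simp only [h, map_sub]⟩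

end MapCoeff

/-! ### Brackets and Poisson structures on the quotient. -/

namespace DiffFunctions

open PDO

variable {F V W : Type*} [Field F] [CommRing V] [Algebra F V] [CommRing W] [Algebra F W]
  {D : Derivation F V V} {D' : Derivation F W W} {φ : V →+* W} {ℓ : ℕ}
  {𝒱 : DiffFunctions D ℓ} {𝒬 : DiffFunctions D' ℓ}

theorem mapCoeff_frechet (hpd : ∀ i s f, 𝒬.pd i s (φ f) = φ (𝒱.pd i s f)) (f : V) (i : Fin ℓ) :
    ((𝒱.frechet f i).mapCoeff (φ : V →+ W) : PDO D') = 𝒬.frechet (φ f) i := by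
  ext n
  rw [coeff_mapCoeff, frechet_coeff, frechet_coeff, apply_ite φ, map_zero, hpd]

theorem mapCoeff_bracket (hφ : ∀ v, φ (D v) = D' (φ v))
    (hpd : ∀ i s f, 𝒬.pd i s (φ f) = φ (𝒱.pd i s f))
    (A : Matrix (Fin ℓ) (Fin ℓ) (PDO D)) (f g : V) :
    ((𝒱.bracket A f g).mapCoeff (φ : V →+ W) : PDO D') =
      𝒬.bracket (A.map (PDO.mapCoeff (φ : V →+ W))) (φ f) (φ g) := by
  simp only [bracket, mapCoeff_sum, mapCoeff_mul hφ, mapCoeff_adjoint hφ, mapCoeff_frechet hpd,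
    Matrix.map_apply]

theorem Jacobi.map (hφ : ∀ v, φ (D v) = D' (φ v))
    (hpd : ∀ i s f, 𝒬.pd i s (φ f) = φ (𝒱.pd i s f))
    {A : Matrix (Fin ℓ) (Fin ℓ) (PDO D)} {a b c : V} (h : 𝒱.Jacobi A a b c) :
    𝒬.Jacobi (A.map (PDO.mapCoeff (φ : V →+ W))) (φ a) (φ b) (φ c) := by
  obtain ⟨X, Y, Z, hX, hY, hZ, h1, h2, h3, h4⟩ := h
  refine ⟨_, _, _, hX.map φ, hY.map φ, hZ.map φ, fun r s => ?_, fun r s => ?_, fun r s => ?_, ?_⟩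
  · rw [expandMuLam_map φ hX, h1]
    simp only [← mapCoeff_bracket hφ hpd, coeff_mapCoeff]
  · rw [expandLamMu_map φ hY, h2]
    simp only [← mapCoeff_bracket hφ hpd, coeff_mapCoeff]
  · rw [expandLamNu_map φ hZ, h3]
    simp only [← mapCoeff_bracket hφ hpd, coeff_mapCoeff]
  · have := h4.map φ
    simpa only [map_sub] using this

/-- Skewadjointness and the Jacobi witnesses map forward. Rationality is a separate assumption
because a nonzero denominator may map to zero. -/
theorem IsPoisson.map (hφ : ∀ v, φ (D v) = D' (φ v))
    (hpd : ∀ i s f, 𝒬.pd i s (φ f) = φ (𝒱.pd i s f)) (hu : ∀ i, 𝒬.u i = φ (𝒱.u i))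
    {A : Matrix (Fin ℓ) (Fin ℓ) (PDO D)} (h : 𝒱.IsPoisson A)
    (hrat : ∀ i j, ((A i j).mapCoeff (φ : V →+ W) : PDO D').IsRational) :
    𝒬.IsPoisson (A.map (PDO.mapCoeff (φ : V →+ W))) where
  skewadjoint := by
    rw [adjointMatrix_map_mapCoeff hφ, h.skewadjoint]
    ext1 i j
    exact mapCoeff_neg φ _
  rational := hrat
  jacobi i j k := by
    rw [hu, hu, hu]
    exact (h.jacobi i j k).map hφ hpd

section Quotient

variable {k m : ℕ} (𝒲 : DiffFunctions D k) (θ : Fin m → V)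

theorem iterate_quotDerivation_mk (n : ℕ) (f : V) :
    (quotDerivation D θ)^[n] (Ideal.Quotient.mk (diffIdeal D θ) f) =
      Ideal.Quotient.mk (diffIdeal D θ) (D^[n] f) :=
  (Function.Semiconj.iterate_right (f := Ideal.Quotient.mk (diffIdeal D θ)) (ga := D)
    (gb := quotDerivation D θ) (fun _ => rfl) n f).symm

/-- The derivation induced on a quotient by a derivation which preserves the ideal. -/
def inducedDerivation {I : Ideal V} (d : Derivation F V V) (hd : ∀ x ∈ I, d x ∈ I) :
    Derivation F (V ⧸ I) (V ⧸ I) :=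
  Derivation.mk'
    (Submodule.mapQ (I.restrictScalars F) (I.restrictScalars F) (d : V →ₗ[F] V) hd :
      (V ⧸ I) →ₗ[F] (V ⧸ I))
    (by
      intro a b
      obtain ⟨a, rfl⟩ := Ideal.Quotient.mk_surjective a
      obtain ⟨b, rfl⟩ := Ideal.Quotient.mk_surjective b
      exact congrArg (Ideal.Quotient.mk I) (d.leibniz a b))

/-- The partial derivatives kill all generators ∂ⁿθ_α, whose Frechet derivatives are ∂ⁿ∘0, so the
Leibniz rule keeps the ideal stable. -/
theorem pd_mem_diffIdeal (hθ : ∀ α i, 𝒲.frechet (θ α) i = 0) (i : Fin k) (s : ℕ) {x : V}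
    (hx : x ∈ diffIdeal D θ) : 𝒲.pd i s x ∈ diffIdeal D θ := by
  unfold diffIdeal at hx ⊢
  induction hx using Submodule.span_induction with
  | mem x hx =>
    obtain ⟨q, rfl⟩ := hx
    rw [← frechet_coeff_natCast, frechet_iterate, hθ, mul_zero, coeff_zero]
    exact zero_mem _
  | zero => simp
  | add x y _ _ hx hy => rw [map_add]; exact add_mem hx hy
  | smul a x hmem hx =>
    rw [smul_eq_mul, Derivation.leibniz, smul_eq_mul, smul_eq_mul]
    exact add_mem (Ideal.mul_mem_left _ _ hx) (Ideal.mul_mem_right _ _ hmem)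

/-- The algebra of differential functions on the quotient by a differential ideal which is
preserved by the partial derivatives and contains no nonzero differential polynomial. -/
def quotient (hθ : ∀ α i, 𝒲.frechet (θ α) i = 0)
    (h0 : ∀ x ∈ diffIdeal D θ,
      x ∈ Algebra.adjoin F (Set.range fun q : Fin k × ℕ => D^[q.2] (𝒲.u q.1)) → x = 0) :
    DiffFunctions (quotDerivation D θ) k where
  u i := Ideal.Quotient.mk (diffIdeal D θ) (𝒲.u i)
  pd i s := inducedDerivation (𝒲.pd i s) fun _ => 𝒲.pd_mem_diffIdeal θ hθ i s
  algebraicIndependent := by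
    rw [algebraicIndependent_iff]
    intro P hP
    -- A polynomial relation in the quotient lifts to a differential polynomial lying in the ideal,
    -- which `h0` forces to be zero.
    refine algebraicIndependent_iff.1 𝒲.algebraicIndependent P (h0 _ ?_ ?_)
    · rw [← Ideal.Quotient.eq_zero_iff_mem, ← hP]
      simp only [iterate_quotDerivation_mk]
      exact MvPolynomial.comp_aeval_apply _ (Ideal.Quotient.mkₐ F (diffIdeal D θ)) P
    · rw [Algebra.adjoin_range_eq_range_aeval]
      exact ⟨P, rfl⟩
  pd_u i n j r := by
    rw [iterate_quotDerivation_mk]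
    refine (congrArg (Ideal.Quotient.mk (diffIdeal D θ)) (𝒲.pd_u i n j r)).trans ?_
    rw [apply_ite (Ideal.Quotient.mk (diffIdeal D θ)), map_one, map_zero]
  pd_comm i n j r f := by
    obtain ⟨f, rfl⟩ := Ideal.Quotient.mk_surjective f
    exact congrArg (Ideal.Quotient.mk (diffIdeal D θ)) (𝒲.pd_comm i n j r f)
  pd_finite f := by
    obtain ⟨f, rfl⟩ := Ideal.Quotient.mk_surjective f
    refine (𝒲.pd_finite f).subset fun q hq h => hq ?_
    exact (congrArg (Ideal.Quotient.mk (diffIdeal D θ)) h).trans (map_zero _)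
  pd_D_zero i f := by
    obtain ⟨f, rfl⟩ := Ideal.Quotient.mk_surjective f
    exact congrArg (Ideal.Quotient.mk (diffIdeal D θ)) (𝒲.pd_D_zero i f)
  pd_D_succ i n f := by
    obtain ⟨f, rfl⟩ := Ideal.Quotient.mk_surjective f
    exact congrArg (Ideal.Quotient.mk (diffIdeal D θ)) (𝒲.pd_D_succ i n f)

end Quotient

/-- The contribution of p_α cancels the correction coming from u_{ℓ−m+α}: the modified derivatives
are taken with θ held fixed. -/
theorem frechet_reduction_constraint {k m : ℕ} (𝒱 : DiffFunctions D (k + m)) {p θ : Fin m → V}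
    (hp : ∀ α β n, 𝒱.pd (Fin.natAdd k β) n (p α) = 0)
    (hθ : ∀ α, θ α = 𝒱.u (Fin.natAdd k α) + p α) (α : Fin m) (i : Fin k) :
    (𝒱.reduction hp).frechet (θ α) i = 0 := by
  rw [frechet_reduction, modifiedFrechet, 𝒱.frechet_constraint_castAdd hθ]
  simp only [𝒱.frechet_constraint_natAdd hp hθ, ite_mul, one_mul, zero_mul, Finset.sum_ite_eq',
    Finset.mem_univ, if_true, sub_self]

end DiffFunctions

end DiracReduction

theorem corollary6p2 {F V : Type*} [Field F] [CharZero F] [CommRing V] [IsDomain V] [Algebra F V]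
    (D : Derivation F V V) (k m : ℕ) (𝒱 : DiracReduction.DiffFunctions D (k + m))
    (H : Matrix (Fin (k + m)) (Fin (k + m)) (DiracReduction.PDO D))
    (hH : 𝒱.IsPoisson H)
    -- the constraints `θ_α = u_{ℓ-m+α} + p_α`, with `p_α` independent of the last `m` variables
    (p θ : Fin m → V)
    (hp : ∀ α β n, 𝒱.pd (Fin.natAdd k β) n (p α) = 0)
    (hθ : ∀ α, θ α = 𝒱.u (Fin.natAdd k α) + p α)
    -- `C(∂)` is invertible, with inverse `Cinv`
    (Cinv : Matrix (Fin m) (Fin m) (DiracReduction.PDO D))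
    (hCinv : 𝒱.constraintMatrix H θ * Cinv = 1)
    (hCinv' : Cinv * 𝒱.constraintMatrix H θ = 1) :
    -- (a)
    𝒱.IsPoisson (𝒱.diracModification H θ Cinv) ∧
    -- (b)
    ∃ 𝒲 : DiracReduction.DiffFunctions D k,
      (∀ i, 𝒲.u i = 𝒱.u (Fin.castAdd m i)) ∧
      (∀ i s f, 𝒲.pd i s f = 𝒱.modifiedPd p i s f) ∧
      𝒲.IsPoisson (𝒱.diracReduced H p Cinv) ∧
      (∀ f g, 𝒱.bracket (𝒱.diracModification H θ Cinv) f g =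
        𝒲.bracket (𝒱.diracReduced H p Cinv) f g) ∧
      -- (c)
      ∀ HD : Matrix (Fin k) (Fin k) (DiracReduction.PDO (DiracReduction.quotDerivation D θ)),
        HD = (𝒱.diracReduced H p Cinv).map (DiracReduction.PDO.mapCoeff
          (Ideal.Quotient.mk (DiracReduction.diffIdeal D θ) : V →+ _)) →
        (∀ x ∈ DiracReduction.diffIdeal D θ, x ∈ 𝒱.reducedPolynomials → x = 0) →
        IsDomain (V ⧸ DiracReduction.diffIdeal D θ) →
        (∀ i j, (HD i j).IsRational) →
        ∃ 𝒬 : DiracReduction.DiffFunctions (DiracReduction.quotDerivation D θ) k,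
          (∀ i, 𝒬.u i =
            Ideal.Quotient.mk (DiracReduction.diffIdeal D θ) (𝒱.u (Fin.castAdd m i))) ∧
          (∀ i s f, 𝒬.pd i s (Ideal.Quotient.mk (DiracReduction.diffIdeal D θ) f) =
            Ideal.Quotient.mk (DiracReduction.diffIdeal D θ) (𝒱.modifiedPd p i s f)) ∧
          𝒬.IsPoisson HD ∧
          ∀ f g, 𝒬.bracket HD (Ideal.Quotient.mk (DiracReduction.diffIdeal D θ) f)
              (Ideal.Quotient.mk (DiracReduction.diffIdeal D θ) g) =
            (𝒲.bracket (𝒱.diracReduced H p Cinv) f g).mapCoeff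
              (Ideal.Quotient.mk (DiracReduction.diffIdeal D θ) : V →+ _) := by
  refine ⟨hH.diracModification 𝒱 θ hCinv hCinv', 𝒱.reduction hp, fun _ => rfl, fun _ _ _ => rfl,
    hH.diracReduced hp hθ hCinv hCinv',
    𝒱.bracket_diracModification hp hθ hH.skewadjoint hCinv hCinv', ?_⟩
  rintro HD rfl h0 - hrat
  exact ⟨(𝒱.reduction hp).quotient θ (𝒱.frechet_reduction_constraint hp hθ) h0,
    fun _ => rfl, fun _ _ _ => rfl,
    (hH.diracReduced hp hθ hCinv hCinv').map (fun _ => rfl) (fun _ _ _ => rfl) (fun _ => rfl) hrat,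
    fun f g => (DiracReduction.DiffFunctions.mapCoeff_bracket (fun _ => rfl)
      (fun _ _ _ => rfl) _ f g).symm⟩

end
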